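/- Let $\Bbbk$ be a field of characteristic $0$ and let $B=\operatorname{Spf}\Bbbk[[t_1,\dots,t_n]]$ be the formal neighbourhood of the point $b=0$ in an affine space. An *F-bundle* $(\mathcal H,\nabla)$ over $B$ is a vector bundle $\mathcal H$ over $B\times\operatorname{Spf}\Bbbk[[u]]$ (a finite projective $\Bbbk[[t,u]]$-module) with a meromorphic flat connection $\nabla$ with poles along $u=0$ such that $\nabla_{u^2\partial_u}$ and $\nabla_{u\xi}$ are regular (preserve $\mathcal H$) for every vector field $\xi$ on $B$. Let $\mathcal H_{b,0}$ be the fibre of $\mathcal H$ at $t=0$, $u=0$. The operators $\nabla_{u^2\partial_u}$ and $\nabla_{u\xi}$ induce $K_b\in\operatorname{End}_\Bbbk(\mathcal H_{b,0})$ and a linear map $\mu_b\colon T_bB\to\operatorname{End}_\Bbbk(\mathcal H_{b,0})$, $\xi\mapsto\nabla_{u\xi}|_{b,0}$. The F-bundle is *maximal at $b$* if there is $h\in\mathcal H_{b,0}$ such that $T_bB\to\mathcal H_{b,0}$, $v\mapsto\mu_b(v)(h)$, is an isomorphism; since $b$ is the only closed point of $B$, the F-bundle is then called *maximal*. An isomorphism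 $(\mathcal H,\nabla)/B\to(\mathcal H',\nabla')/B'$ is a pair of an isomorphism $f\colon B\to B'$ and an isomorphism $\Phi\colon\mathcal H\to(f\times\mathrm{id}_u)^*\mathcal H'$ that identifies $\nabla$ with $(f\times\mathrm{id}_u)^*\nabla'$. The *product* of a finite family $(\mathcal H_i,\nabla_i)/B_i$, $i\in I$, is the F-bundle $\bigoplus_{i\in I}\mathrm{pr}_i^*(\mathcal H_i,\nabla_i)$ over $\prod_{i\in I}B_i$, where $\mathrm{pr}_i\colon\prod_jB_j\to B_i$ is the projection (times the identity of $\operatorname{Spf}\Bbbk[[u]]$). **Theorem (Formal spectral decomposition).** Let $(\mathcal H,\nabla)$ be an F-bundle over $B$ that is maximal at $b$. Let $\mathcal H_{b,0}=\bigoplus_{i\in I}H_i$, with $I$ finite, be a direct sum decomposition into $K_b$-stable subspaces such that for all $i\ne j$ in $I$ the spectra of $K_b|_{H_i}$ and $K_b|_{H_j}$ (their sets of eigenvalues in an algebraic closure of $\Bbbk$) are disjoint. Then there are maximal F-bundles $(\mathcal H_i,\nabla_i)$ over formal neighbourhoods $B_i=\operatorname{Spf}\Bbbk[[t_{i,1},\dots,t_{i,m_i}]]$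 of $0$ in affine spaces, for $i\in I$, and an isomorphism of F-bundles from $(\mathcal H,\nabla)/B$ to the product $\bigoplus_{i\in I}\mathrm{pr}_i^*(\mathcal H_i,\nabla_i)$ over $\prod_{i\in I}B_i$, such that for every $i\in I$ the induced isomorphism of fibres at the origin maps $H_i\subset\mathcal H_{b,0}$ onto the fibre of the summand $\mathrm{pr}_i^*\mathcal H_i$. -/

import Mathlib

open scoped TensorProduct

universe u v w

namespace FormalFBundle

/-! ### Functions on `B` and on `B × Spf k⟦u⟧` -/

/-- The ring of functions `k⟦t_s : s ∈ σ⟧` of the formal neighbourhood `B` of `0` in the affine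
space with coordinates indexed by the finite set `σ`. -/
abbrev BaseRing (k : Type u) [Field k] (σ : Type w) : Type (max u w) := MvPowerSeries σ k

/-- The ring of functions `k⟦t⟧⟦u⟧` of `B × Spf k⟦u⟧`; the variable `u` is `PowerSeries.X`. -/
abbrev TotalRing (k : Type u) [Field k] (σ : Type w) : Type (max u w) :=
  PowerSeries (MvPowerSeries σ k)

section Rings

variable {k : Type u} [Field k] {σ : Type w}

/-- The coordinate `u`. -/
noncomputable abbrev uVar (k : Type u) [Field k] (σ : Type w) : TotalRing k σ := PowerSeries.X

/-- The coordinate vector field `∂_u` on `B × Spf k⟦u⟧`. -/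
noncomputable def ddu (k : Type u) [Field k] (σ : Type w) :
    Derivation k (TotalRing k σ) (TotalRing k σ) :=
  (PowerSeries.derivative (MvPowerSeries σ k)).restrictScalars k

/-- The coordinate vector field `∂_{t_i}` on `B × Spf k⟦u⟧`, acting on the coefficients of a power
series in `u`. -/
noncomputable def ddt (k : Type u) [Field k] {σ : Type w} (i : σ) :
    Derivation k (TotalRing k σ) (TotalRing k σ) :=
  Derivation.mk'
    { toFun := fun f => PowerSeries.mk fun n => MvPowerSeries.pderiv k i (PowerSeries.coeff n f)
      map_add' := fun f g => by ext1 n; simp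
      map_smul' := fun c f => by ext1 n; simp }
    (fun f g => by
      ext1 n
      simp only [LinearMap.coe_mk, AddHom.coe_mk, PowerSeries.coeff_mk, map_add, smul_eq_mul,
        PowerSeries.coeff_mul, map_sum, Derivation.leibniz, Finset.sum_add_distrib]
      congr 1
      exact Finset.Nat.sum_antidiagonal_swap (n := n) (f := fun x : ℕ × ℕ =>
        PowerSeries.coeff x.1 g * MvPowerSeries.pderiv k i (PowerSeries.coeff x.2 f)))

theorem coeff_ddt (i : σ) (f : TotalRing k σ) (n : ℕ) :
    PowerSeries.coeff n (ddt k i f) = MvPowerSeries.pderiv k i (PowerSeries.coeff n f) := by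
  simp [ddt]

theorem coeff_ddu (f : TotalRing k σ) (n : ℕ) :
    PowerSeries.coeff n (ddu k σ f) = PowerSeries.coeff (n + 1) f * (n + 1) := by
  simp [ddu, PowerSeries.coeff_derivative]

@[simp]
theorem ddu_uVar : ddu k σ (uVar k σ) = 1 := by
  simp [ddu]

@[simp]
theorem ddt_uVar (i : σ) : ddt k i (uVar k σ) = 0 := by
  ext1 n
  rw [coeff_ddt, PowerSeries.coeff_X]
  split_ifs <;> simp

theorem pderiv_comm (i j : σ) (f : MvPowerSeries σ k) :
    MvPowerSeries.pderiv k i (MvPowerSeries.pderiv k j f) =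
      MvPowerSeries.pderiv k j (MvPowerSeries.pderiv k i f) := by
  classical
  ext n
  simp only [MvPowerSeries.coeff_pderiv, Finsupp.add_apply, Finsupp.single_apply]
  rw [add_right_comm]
  by_cases h : i = j
  · subst h; rfl
  · simp only [h, Ne.symm h, if_false, add_zero]
    ring

theorem ddt_comm (i j : σ) (f : TotalRing k σ) : ddt k i (ddt k j f) = ddt k j (ddt k i f) := by
  ext1 n
  simp only [coeff_ddt, pderiv_comm]

theorem ddu_ddt_comm (i : σ) (f : TotalRing k σ) :
    ddu k σ (ddt k i f) = ddt k i (ddu k σ f) := by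
  ext1 n
  have h : MvPowerSeries.pderiv k i ((n : MvPowerSeries σ k) + 1) = 0 := by
    rw [map_add, Derivation.map_natCast, MvPowerSeries.pderiv_one, add_zero]
  simp only [coeff_ddt, coeff_ddu, Derivation.leibniz, h, smul_eq_mul, mul_zero, zero_add]
  ring

/-- Evaluation of functions at the point `(b, 0)`, that is at `t = 0`, `u = 0`. -/
noncomputable def evalOrigin (k : Type u) [Field k] (σ : Type w) : TotalRing k σ →+* k :=
  (MvPowerSeries.constantCoeff (σ := σ) (R := k)).comp
    (PowerSeries.constantCoeff (R := MvPowerSeries σ k))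

/-- The ideal `(t, u)` of the point `(b, 0)`. -/
noncomputable def originIdeal (k : Type u) [Field k] (σ : Type w) : Ideal (TotalRing k σ) :=
  RingHom.ker (evalOrigin k σ)

theorem uVar_mem_originIdeal : uVar k σ ∈ originIdeal k σ := by
  simp [originIdeal, evalOrigin, RingHom.mem_ker]

end Rings

/-! ### Meromorphic connections -/

section Meromorphic

variable {k : Type u} [Field k] {σ : Type w}

/-- The module `H[1/u]` of meromorphic sections, with poles along `u = 0`, of the sheaf attached to
a module `H` over `k⟦t, u⟧`. -/
abbrev Mer (k : Type u) [Field k] (σ : Type w) (H : Type v) [AddCommGroup H]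
    [Module (TotalRing k σ) H] : Type (max u w v) :=
  LocalizedModule (Submonoid.powers (uVar k σ)) H

/-- The map `H → H[1/u]`. -/
noncomputable abbrev toMer {H : Type v} [AddCommGroup H] [Module (TotalRing k σ) H] :
    H →ₗ[TotalRing k σ] Mer k σ H :=
  LocalizedModule.mkLinearMap (Submonoid.powers (uVar k σ)) H

end Meromorphic

/-- A (formal) F-bundle over the formal neighbourhood `B` of `0` in the affine space with
coordinates `t_s`, `s ∈ σ`: a vector bundle `H` over `B × Spf k⟦u⟧` (a finite projective module
over `k⟦t, u⟧`) with a meromorphic flat connection `∇` with poles along `u = 0` such that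
`∇_{u² ∂_u}` and all `∇_{u ∂_{t_i}}` are regular, that is, preserve the sections of `H`.
The connection is given by its values on the coordinate fields `∂_u` and `∂_{t_i}`, which form a
basis of the vector fields; for `ξ = ∑ f_i ∂_{t_i}` on `B` one has `∇_{uξ} = ∑ f_i ∇_{u ∂_{t_i}}`.
Taking `f` constant in the Leibniz rules shows that the operators are `k`-linear. -/
structure FBundle (k : Type u) [Field k] (σ : Type w) where
  /-- The module of sections of the vector bundle. -/
  H : Type v
  [addCommGroup : AddCommGroup H]
  [module : Module (TotalRing k σ) H]
  [finite : Module.Finite (TotalRing k σ) H]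
  [projective : Module.Projective (TotalRing k σ) H]
  /-- The operator `∇_{∂_u}` on meromorphic sections. -/
  nablaU : Mer k σ H →+ Mer k σ H
  /-- The operators `∇_{∂_{t_i}}` on meromorphic sections. -/
  nablaT : σ → Mer k σ H →+ Mer k σ H
  leibniz_nablaU : ∀ (f : TotalRing k σ) (s : Mer k σ H),
    nablaU (f • s) = ddu k σ f • s + f • nablaU s
  leibniz_nablaT : ∀ (i : σ) (f : TotalRing k σ) (s : Mer k σ H),
    nablaT i (f • s) = ddt k i f • s + f • nablaT i s
  flat_UT : ∀ (i : σ) (s : Mer k σ H), nablaU (nablaT i s) = nablaT i (nablaU s)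
  flat_TT : ∀ (i j : σ) (s : Mer k σ H), nablaT i (nablaT j s) = nablaT j (nablaT i s)
  regularU : ∀ s : H, uVar k σ ^ 2 • nablaU (toMer s) ∈ LinearMap.range (toMer (k := k) (σ := σ))
  regularT : ∀ (i : σ) (s : H),
    uVar k σ • nablaT i (toMer s) ∈ LinearMap.range (toMer (k := k) (σ := σ))

attribute [instance] FBundle.addCommGroup FBundle.module FBundle.finite FBundle.projective

/-- The regular operators `∇_{u² ∂_u}` and `∇_{u ∂_{t_i}}` of a flat meromorphic connection on a
module `H`, with the Leibniz and flatness relations that they inherit. -/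
structure RegularForm (k : Type u) [Field k] (σ : Type w) (H : Type v) [AddCommGroup H]
    [Module (TotalRing k σ) H] where
  /-- The operator `∇_{u² ∂_u}` on `H`. -/
  opU : H →+ H
  /-- The operators `∇_{u ∂_{t_i}}` on `H`. -/
  opT : σ → H →+ H
  leibnizU : ∀ (f : TotalRing k σ) (s : H), opU (f • s) = (uVar k σ ^ 2 * ddu k σ f) • s + f • opU s
  leibnizT : ∀ (i : σ) (f : TotalRing k σ) (s : H),
    opT i (f • s) = (uVar k σ * ddt k i f) • s + f • opT i s
  commUT : ∀ (i : σ) (s : H), opU (opT i s) = opT i (opU s) + uVar k σ • opT i s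
  commTT : ∀ (i j : σ) (s : H), opT i (opT j s) = opT j (opT i s)

/-! ### Extending differential operators to localizations -/

section Extension

variable {k : Type u} [Field k] {A : Type w} [CommRing A] [Algebra k A] {S : Submonoid A}
  {H : Type v} [AddCommGroup H] [Module A H]

/-- Extension to `S⁻¹H`, by the quotient rule, of an additive operator `T` on `H` satisfying the
Leibniz rule over a derivation `D` of `A`. -/
noncomputable def extendLocalized (S : Submonoid A) (D : Derivation k A A) (T : H →+ H)
    (hT : ∀ (f : A) (s : H), T (f • s) = D f • s + f • T s) :
    LocalizedModule S H →+ LocalizedModule S H where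
  toFun x := x.liftOn
    (fun p => LocalizedModule.mk ((p.2 : A) • T p.1 - D (p.2 : A) • p.1) (p.2 * p.2)) (by
    rintro ⟨m, s⟩ ⟨m', s'⟩ ⟨c, hc⟩
    obtain ⟨c, hcS⟩ := c
    obtain ⟨s, hs⟩ := s
    obtain ⟨s', hs'⟩ := s'
    change c • s' • m = c • s • m' at hc
    have h2 := congrArg T hc
    simp only [hT] at h2
    refine LocalizedModule.mk_eq.mpr ⟨⟨c * c, mul_mem hcS hcS⟩, ?_⟩
    change (c * c) • (s' * s') • (s • T m - D s • m) = (c * c) • (s * s) • (s' • T m' - D s' • m')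
    linear_combination (norm := module)
      (c * s * s') • h2 - (s * s' * D c + c * s * D s' + c * s' * D s) • hc)
  map_zero' := by
    rw [← LocalizedModule.zero_mk 1, LocalizedModule.liftOn_mk]
    simp
  map_add' x y := by
    induction x, y using LocalizedModule.induction_on₂ with
    | h m m' s s' =>
      rw [LocalizedModule.mk_add_mk, LocalizedModule.liftOn_mk, LocalizedModule.liftOn_mk,
        LocalizedModule.liftOn_mk, LocalizedModule.mk_add_mk, LocalizedModule.mk_eq]
      refine ⟨1, ?_⟩
      obtain ⟨s, hs⟩ := s
      obtain ⟨s', hs'⟩ := s'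
      change (1 : A) • (s * s * (s' * s')) • ((s * s') • T (s' • m + s • m') -
          D (s * s') • (s' • m + s • m')) = (1 : A) • (s * s' * (s * s')) •
          ((s' * s') • (s • T m - D s • m) + (s * s) • (s' • T m' - D s' • m'))
      simp only [map_add, hT, Derivation.leibniz, smul_eq_mul]
      module

theorem extendLocalized_mk (D : Derivation k A A) (T : H →+ H)
    (hT : ∀ (f : A) (s : H), T (f • s) = D f • s + f • T s) (m : H) (s : S) :
    extendLocalized S D T hT (LocalizedModule.mk m s) =
      LocalizedModule.mk ((s : A) • T m - D (s : A) • m) (s * s) :=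
  rfl

theorem extendLocalized_mkLinearMap (D : Derivation k A A) (T : H →+ H)
    (hT : ∀ (f : A) (s : H), T (f • s) = D f • s + f • T s) (m : H) :
    extendLocalized S D T hT (LocalizedModule.mkLinearMap S H m) =
      LocalizedModule.mkLinearMap S H (T m) := by
  simp [LocalizedModule.mkLinearMap_apply, extendLocalized_mk]

theorem extendLocalized_smul (D : Derivation k A A) (T : H →+ H)
    (hT : ∀ (f : A) (s : H), T (f • s) = D f • s + f • T s) (f : A) (x : LocalizedModule S H) :
    extendLocalized S D T hT (f • x) = D f • x + f • extendLocalized S D T hT x := by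
  induction x using LocalizedModule.induction_on with
  | h m s =>
    rw [LocalizedModule.smul'_mk, extendLocalized_mk, extendLocalized_mk, LocalizedModule.smul'_mk,
      LocalizedModule.smul'_mk, LocalizedModule.mk_add_mk, LocalizedModule.mk_eq]
    refine ⟨1, ?_⟩
    obtain ⟨s, hs⟩ := s
    change (1 : A) • (s * (s * s)) • (s • T (f • m) - D s • f • m) =
      (1 : A) • (s * s) • ((s * s) • D f • m + s • f • (s • T m - D s • m))
    rw [hT]
    module

end Extension

/-! ### Passing between a regular connection on `H` and the connection on `H[1/u]` -/

section Passage

variable {k : Type u} [Field k] {σ : Type w} {H : Type v} [AddCommGroup H]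
  [Module (TotalRing k σ) H]

/-- Division by `u ^ n` on meromorphic sections. -/
noncomputable def divU (n : ℕ) : Mer k σ H →ₗ[TotalRing k σ] Mer k σ H :=
  LocalizedModule.divBy (⟨uVar k σ ^ n, n, rfl⟩ : Submonoid.powers (uVar k σ))

theorem smul_divU (n : ℕ) (x : Mer k σ H) : uVar k σ ^ n • divU n x = x :=
  LocalizedModule.mul_by_divBy (⟨uVar k σ ^ n, n, rfl⟩ : Submonoid.powers (uVar k σ)) x

theorem divU_smul (n : ℕ) (x : Mer k σ H) : divU n (uVar k σ ^ n • x) = x := by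
  rw [map_smul, smul_divU]

theorem smul_divU_one (x : Mer k σ H) : uVar k σ • divU 1 x = x :=
  (congrArg (fun f : TotalRing k σ => f • divU 1 x) (pow_one (uVar k σ))).symm.trans (smul_divU 1 x)

theorem divU_one_smul (x : Mer k σ H) : divU 1 (uVar k σ • x) = x := by
  rw [map_smul, smul_divU_one]

theorem mer_smul_injective (n : ℕ) {x y : Mer k σ H}
    (h : uVar k σ ^ n • x = uVar k σ ^ n • y) : x = y := by
  rw [← divU_smul n x, h, divU_smul]

theorem mer_exists (x : Mer k σ H) : ∃ (n : ℕ) (s : H), uVar k σ ^ n • x = toMer s := by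
  induction x using LocalizedModule.induction_on with
  | h m s =>
    obtain ⟨_, n, rfl⟩ := s
    refine ⟨n, m, ?_⟩
    rw [LocalizedModule.smul'_mk, LocalizedModule.mkLinearMap_apply]
    exact LocalizedModule.mk_cancel (⟨uVar k σ ^ n, n, rfl⟩ : Submonoid.powers (uVar k σ)) m

theorem uVar_smul_injective [Module.Projective (TotalRing k σ) H] (n : ℕ) {x y : H}
    (h : uVar k σ ^ n • x = uVar k σ ^ n • y) : x = y := by
  have hn : uVar k σ ^ n ≠ 0 := pow_ne_zero n PowerSeries.X_ne_zero
  exact smul_right_injective H hn h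

theorem toMer_injective [Module.Projective (TotalRing k σ) H] :
    Function.Injective (toMer (k := k) (σ := σ) (H := H)) := by
  intro x y h
  rw [LocalizedModule.mkLinearMap_apply, LocalizedModule.mkLinearMap_apply,
    LocalizedModule.mk_eq] at h
  obtain ⟨⟨_, n, rfl⟩, h⟩ := h
  simp only [one_smul] at h
  exact uVar_smul_injective n h

/-- The meromorphic operator `∇_{∂_u} = u⁻² ∇_{u² ∂_u}`. -/
noncomputable def RegularForm.nablaU (R : RegularForm k σ H) : Mer k σ H →+ Mer k σ H :=
  (divU 2).toAddMonoidHom.comp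
    (extendLocalized (Submonoid.powers (uVar k σ)) (uVar k σ ^ 2 • ddu k σ) R.opU R.leibnizU)

/-- The meromorphic operator `∇_{∂_{t_i}} = u⁻¹ ∇_{u ∂_{t_i}}`. -/
noncomputable def RegularForm.nablaT (R : RegularForm k σ H) (i : σ) : Mer k σ H →+ Mer k σ H :=
  (divU 1).toAddMonoidHom.comp
    (extendLocalized (Submonoid.powers (uVar k σ)) (uVar k σ • ddt k i) (R.opT i) (R.leibnizT i))

theorem RegularForm.nablaU_apply (R : RegularForm k σ H) (x : Mer k σ H) :
    R.nablaU x = divU 2 (extendLocalized (Submonoid.powers (uVar k σ)) (uVar k σ ^ 2 • ddu k σ)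
      R.opU R.leibnizU x) :=
  rfl

theorem RegularForm.nablaT_apply (R : RegularForm k σ H) (i : σ) (x : Mer k σ H) :
    R.nablaT i x = divU 1 (extendLocalized (Submonoid.powers (uVar k σ)) (uVar k σ • ddt k i)
      (R.opT i) (R.leibnizT i) x) :=
  rfl

theorem RegularForm.smul_nablaU_toMer (R : RegularForm k σ H) (s : H) :
    uVar k σ ^ 2 • R.nablaU (toMer s) = toMer (R.opU s) := by
  rw [R.nablaU_apply, smul_divU, extendLocalized_mkLinearMap]

theorem RegularForm.smul_nablaT_toMer (R : RegularForm k σ H) (i : σ) (s : H) :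
    uVar k σ • R.nablaT i (toMer s) = toMer (R.opT i s) := by
  rw [R.nablaT_apply, smul_divU_one, extendLocalized_mkLinearMap]

theorem RegularForm.leibniz_nablaU (R : RegularForm k σ H) (f : TotalRing k σ) (x : Mer k σ H) :
    R.nablaU (f • x) = ddu k σ f • x + f • R.nablaU x := by
  change divU 2 _ = _ + f • divU 2 _
  rw [extendLocalized_smul, map_add, map_smul (divU 2) f]
  congr 1
  change divU 2 ((uVar k σ ^ 2 * ddu k σ f) • x) = _
  rw [mul_smul, divU_smul]

theorem RegularForm.leibniz_nablaT (R : RegularForm k σ H) (i : σ) (f : TotalRing k σ)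
    (x : Mer k σ H) : R.nablaT i (f • x) = ddt k i f • x + f • R.nablaT i x := by
  change divU 1 _ = _ + f • divU 1 _
  rw [extendLocalized_smul, map_add, map_smul (divU 1) f]
  congr 1
  change divU 1 ((uVar k σ * ddt k i f) • x) = _
  rw [mul_smul, divU_one_smul]

/-- Two operators on `H[1/u]` that obey Leibniz rules over commuting derivations commute as soon
as they commute on `H`. -/
theorem commute_of_toMer (D E : Derivation k (TotalRing k σ) (TotalRing k σ))
    (P Q : Mer k σ H →+ Mer k σ H)
    (hP : ∀ (f : TotalRing k σ) (x : Mer k σ H), P (f • x) = D f • x + f • P x)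
    (hQ : ∀ (f : TotalRing k σ) (x : Mer k σ H), Q (f • x) = E f • x + f • Q x)
    (hDE : ∀ f, D (E f) = E (D f))
    (h : ∀ s : H, P (Q (toMer s)) = Q (P (toMer s))) (x : Mer k σ H) : P (Q x) = Q (P x) := by
  obtain ⟨n, s, hs⟩ := mer_exists x
  have h1 := h s
  rw [← hs] at h1
  simp only [hP, hQ, map_add, hDE] at h1
  apply mer_smul_injective n
  have h2 : ∀ a b c d e : Mer k σ H, a + b + (c + d) = a + c + (b + e) → d = e := by
    intro a b c d e h
    have h' : a + b + c + d = a + b + c + e := by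
      rw [← add_assoc] at h
      rw [h]; abel
    exact add_left_cancel h'
  exact h2 _ _ _ _ _ h1

/-- The F-bundle with given regular operators `∇_{u² ∂_u}` and `∇_{u ∂_{t_i}}`. -/
noncomputable def RegularForm.toFBundle (R : RegularForm k σ H) [Module.Finite (TotalRing k σ) H]
    [Module.Projective (TotalRing k σ) H] : FBundle.{u, v, w} k σ where
  H := H
  nablaU := R.nablaU
  nablaT := R.nablaT
  leibniz_nablaU := R.leibniz_nablaU
  leibniz_nablaT := R.leibniz_nablaT
  flat_UT i x := by
    refine commute_of_toMer (ddu k σ) (ddt k i) _ _ R.leibniz_nablaU (R.leibniz_nablaT i)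
      (ddu_ddt_comm i) (fun s => ?_) x
    apply mer_smul_injective 3
    have e1 : uVar k σ • R.nablaU (R.nablaT i (toMer s)) =
        R.nablaU (toMer (R.opT i s)) - R.nablaT i (toMer s) := by
      rw [← R.smul_nablaT_toMer, R.leibniz_nablaU, ddu_uVar, one_smul, add_sub_cancel_left]
    have e2 : uVar k σ ^ 2 • R.nablaT i (R.nablaU (toMer s)) = R.nablaT i (toMer (R.opU s)) := by
      rw [← R.smul_nablaU_toMer, R.leibniz_nablaT, Derivation.leibniz_pow, ddt_uVar]
      simp
    rw [pow_succ, mul_smul, e1, smul_sub, R.smul_nablaU_toMer, mul_comm, mul_smul, e2,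
      R.smul_nablaT_toMer, pow_two, mul_smul, R.smul_nablaT_toMer, R.commUT, map_add, map_smul,
      add_sub_cancel_right]
  flat_TT i j x := by
    have e : ∀ (i j : σ) (s : H), uVar k σ ^ 2 • R.nablaT i (R.nablaT j (toMer s)) =
        toMer (R.opT i (R.opT j s)) := by
      intro i j s
      rw [← R.smul_nablaT_toMer, ← R.smul_nablaT_toMer, R.leibniz_nablaT, ddt_uVar, zero_smul,
        zero_add, pow_two, mul_smul]
    refine commute_of_toMer (ddt k i) (ddt k j) _ _ (R.leibniz_nablaT i) (R.leibniz_nablaT j)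
      (ddt_comm i j) (fun s => ?_) x
    apply mer_smul_injective 2
    rw [e, e, R.commTT]
  regularU s := ⟨R.opU s, (R.smul_nablaU_toMer s).symm⟩
  regularT i s := ⟨R.opT i s, (R.smul_nablaT_toMer i s).symm⟩

end Passage

namespace FBundle

variable {k : Type u} [Field k] {σ : Type w} (F : FBundle.{u, v, w} k σ)

/-- The operator `∇_{u² ∂_u}` on sections of `H`: the section `opU s` is the unique element of `H`
whose image in `H[1/u]` is `u² ∇_{∂_u} s`. -/
noncomputable def opU : F.H →+ F.H :=
  have hF : ∀ s : F.H, toMer (k := k) (σ := σ) (Classical.choose (F.regularU s)) =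
      uVar k σ ^ 2 • F.nablaU (toMer s) := fun s => Classical.choose_spec (F.regularU s)
  AddMonoidHom.mk' (fun s => Classical.choose (F.regularU s)) fun a b =>
    toMer_injective (k := k) (σ := σ)
      ((hF (a + b)).trans (by simp only [map_add, hF, smul_add]))

/-- The operator `∇_{u ∂_{t_i}}` on sections of `H`: the section `opT i s` is the unique element of
`H` whose image in `H[1/u]` is `u ∇_{∂_{t_i}} s`. -/
noncomputable def opT (i : σ) : F.H →+ F.H :=
  have hF : ∀ s : F.H, toMer (k := k) (σ := σ) (Classical.choose (F.regularT i s)) =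
      uVar k σ • F.nablaT i (toMer s) := fun s => Classical.choose_spec (F.regularT i s)
  AddMonoidHom.mk' (fun s => Classical.choose (F.regularT i s)) fun a b =>
    toMer_injective (k := k) (σ := σ)
      ((hF (a + b)).trans (by simp only [map_add, hF, smul_add]))

theorem toMer_opU (s : F.H) : toMer (F.opU s) = uVar k σ ^ 2 • F.nablaU (toMer s) :=
  Classical.choose_spec (F.regularU s)

theorem toMer_opT (i : σ) (s : F.H) : toMer (F.opT i s) = uVar k σ • F.nablaT i (toMer s) :=
  Classical.choose_spec (F.regularT i s)

/-- The regular operators `∇_{u² ∂_u}` and `∇_{u ∂_{t_i}}` of an F-bundle. -/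
noncomputable def regularForm : RegularForm k σ F.H where
  opU := F.opU
  opT := F.opT
  leibnizU f s := toMer_injective (k := k) (σ := σ) (by
    rw [F.toMer_opU, map_add, LinearMap.map_smul, LinearMap.map_smul, LinearMap.map_smul,
      F.toMer_opU, F.leibniz_nablaU, smul_add, mul_smul, smul_comm f])
  leibnizT i f s := toMer_injective (k := k) (σ := σ) (by
    rw [F.toMer_opT, map_add, LinearMap.map_smul, LinearMap.map_smul, LinearMap.map_smul,
      F.toMer_opT, F.leibniz_nablaT, smul_add, mul_smul, smul_comm f])
  commUT i s := toMer_injective (k := k) (σ := σ) (by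
    rw [F.toMer_opU, F.toMer_opT, map_add, LinearMap.map_smul, F.toMer_opT, F.toMer_opT,
      F.toMer_opU, F.leibniz_nablaU, F.leibniz_nablaT, F.flat_UT, Derivation.leibniz_pow, ddt_uVar,
      ddu_uVar]
    simp only [smul_zero, zero_smul, zero_add, one_smul, smul_add, smul_smul]
    rw [add_comm]
    congr 2 <;> ring)
  commTT i j s := toMer_injective (k := k) (σ := σ) (by
    rw [F.toMer_opT, F.toMer_opT, F.toMer_opT, F.toMer_opT, F.leibniz_nablaT, F.leibniz_nablaT,
      F.flat_TT, ddt_uVar, ddt_uVar, zero_smul, zero_smul])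

end FBundle

theorem RegularForm.toFBundle_opU {k : Type u} [Field k] {σ : Type w} {H : Type v}
    [AddCommGroup H] [Module (TotalRing k σ) H] (R : RegularForm k σ H)
    [Module.Finite (TotalRing k σ) H] [Module.Projective (TotalRing k σ) H] (s : H) :
    R.toFBundle.opU s = R.opU s :=
  toMer_injective (k := k) (σ := σ)
    ((R.toFBundle.toMer_opU s).trans (R.smul_nablaU_toMer s))

theorem RegularForm.toFBundle_opT {k : Type u} [Field k] {σ : Type w} {H : Type v}
    [AddCommGroup H] [Module (TotalRing k σ) H] (R : RegularForm k σ H)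
    [Module.Finite (TotalRing k σ) H] [Module.Projective (TotalRing k σ) H] (i : σ) (s : H) :
    R.toFBundle.opT i s = R.opT i s :=
  toMer_injective (k := k) (σ := σ)
    ((R.toFBundle.toMer_opT i s).trans (R.smul_nablaT_toMer i s))

/-! ### Pullback along coordinate projections and products -/

section TensorOperators

variable {k : Type u} [Field k] {R S M : Type*} [CommRing R] [CommRing S] [Algebra R S]
  [Algebra k R] [Algebra k S] [AddCommGroup M] [Module R M]

/-- Given a derivation `D` of `S` extending a derivation `E` of `R`, and an operator `T` on the
`R`-module `M` with the Leibniz rule over `E`, the operator `D ⊗ 1 + 1 ⊗ T` on `S ⊗ M`. -/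
noncomputable def tensorOp (D : Derivation k S S) (E : Derivation k R R) (T : M →+ M)
    (hDE : ∀ r, D (algebraMap R S r) = algebraMap R S (E r))
    (hT : ∀ (r : R) (m : M), T (r • m) = E r • m + r • T m) : S ⊗[R] M →+ S ⊗[R] M :=
  TensorProduct.liftAddHom
    (AddMonoidHom.mk' (fun s => AddMonoidHom.mk' (fun m => D s ⊗ₜ[R] m + s ⊗ₜ[R] T m)
      (fun m m' => by simp only [map_add, TensorProduct.tmul_add]; abel))
      (fun s s' => by
        ext m
        simp only [map_add, TensorProduct.add_tmul, AddMonoidHom.mk'_apply, AddMonoidHom.add_apply]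
        abel))
    (fun r s m => by
      have h : D (r • s) = E r • s + r • D s := by
        rw [Algebra.smul_def, Derivation.leibniz, hDE, smul_eq_mul, smul_eq_mul, mul_comm s,
          ← Algebra.smul_def, ← Algebra.smul_def, add_comm]
      simp only [AddMonoidHom.mk'_apply, hT, h, TensorProduct.tmul_add, TensorProduct.add_tmul,
        TensorProduct.smul_tmul]
      abel)

variable {D : Derivation k S S} {E : Derivation k R R} {T : M →+ M}
  (hDE : ∀ r, D (algebraMap R S r) = algebraMap R S (E r))
  (hT : ∀ (r : R) (m : M), T (r • m) = E r • m + r • T m)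

theorem tensorOp_tmul (s : S) (m : M) :
    tensorOp D E T hDE hT (s ⊗ₜ[R] m) = D s ⊗ₜ[R] m + s ⊗ₜ[R] T m :=
  rfl

theorem tensorOp_smul (f : S) (x : S ⊗[R] M) :
    tensorOp D E T hDE hT (f • x) = D f • x + f • tensorOp D E T hDE hT x := by
  induction x with
  | zero => simp
  | tmul s m =>
    simp only [TensorProduct.smul_tmul', tensorOp_tmul, smul_eq_mul, Derivation.leibniz,
      TensorProduct.add_tmul, smul_add]
    rw [mul_comm s]
    abel
  | add x y hx hy =>
    simp only [smul_add, map_add, hx, hy]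
    abel

theorem tensorOp_comm {D' : Derivation k S S} {E' : Derivation k R R} {T' : M →+ M}
    (hDE' : ∀ r, D' (algebraMap R S r) = algebraMap R S (E' r))
    (hT' : ∀ (r : R) (m : M), T' (r • m) = E' r • m + r • T' m) (c : R)
    (hD : ∀ s, D (D' s) = D' (D s) + algebraMap R S c * D' s)
    (hTT : ∀ m, T (T' m) = T' (T m) + c • T' m) (x : S ⊗[R] M) :
    tensorOp D E T hDE hT (tensorOp D' E' T' hDE' hT' x) =
      tensorOp D' E' T' hDE' hT' (tensorOp D E T hDE hT x) +
        algebraMap R S c • tensorOp D' E' T' hDE' hT' x := by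
  induction x with
  | zero => simp
  | tmul s m =>
    simp only [tensorOp_tmul, map_add, hD, hTT, TensorProduct.add_tmul, TensorProduct.tmul_add,
      smul_add, TensorProduct.smul_tmul', smul_eq_mul]
    rw [← Algebra.smul_def c s, TensorProduct.smul_tmul]
    abel
  | add x y hx hy =>
    simp only [smul_add, map_add, hx, hy]
    abel

end TensorOperators

section Pullback

variable {k : Type u} [Field k] {σ τ : Type*}

/-- For an injection `e` of coordinates, the pullback of functions along the projection
`B_σ × Spf k⟦u⟧ → B_τ × Spf k⟦u⟧` to the coordinates in the image of `e`. -/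
noncomputable def projHom (k : Type u) [Field k] (e : τ ↪ σ) : TotalRing k τ →+* TotalRing k σ :=
  PowerSeries.map (MvPowerSeries.rename (R := k) e).toRingHom

theorem projHom_uVar (e : τ ↪ σ) : projHom k e (uVar k τ) = uVar k σ :=
  PowerSeries.map_X _

theorem ddu_projHom (e : τ ↪ σ) (f : TotalRing k τ) :
    ddu k σ (projHom k e f) = projHom k e (ddu k τ f) := by
  ext1 n
  simp [projHom, coeff_ddu]

theorem pderiv_rename_self (e : τ ↪ σ) (l : τ) (p : MvPowerSeries τ k) :
    MvPowerSeries.pderiv k (e l) (MvPowerSeries.rename e p) =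
      MvPowerSeries.rename e (MvPowerSeries.pderiv k l p) := by
  classical
  ext x
  rw [MvPowerSeries.coeff_pderiv]
  by_cases hx : x ∈ Set.range (Finsupp.mapDomain (M := ℕ) e)
  · obtain ⟨y, rfl⟩ := hx
    have h1 : Finsupp.mapDomain e y + Finsupp.single (e l) 1 =
        Finsupp.embDomain e (y + Finsupp.single l 1) := by
      rw [Finsupp.embDomain_eq_mapDomain, Finsupp.mapDomain_add, Finsupp.mapDomain_single]
    rw [h1, MvPowerSeries.coeff_embDomain_rename, Finsupp.mapDomain_apply e.injective,
      ← Finsupp.embDomain_eq_mapDomain, MvPowerSeries.coeff_embDomain_rename,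
      MvPowerSeries.coeff_pderiv]
  · rw [MvPowerSeries.coeff_rename_eq_zero _ _ hx, MvPowerSeries.coeff_rename_eq_zero, zero_mul]
    rintro ⟨y, hy⟩
    apply hx
    refine ⟨y - Finsupp.single l 1, ?_⟩
    have hl : 1 ≤ y l := by
      have := DFunLike.congr_fun hy (e l)
      rw [Finsupp.mapDomain_apply e.injective, Finsupp.add_apply, Finsupp.single_eq_same] at this
      omega
    have hle : Finsupp.single l 1 ≤ y := by
      rw [Finsupp.single_le_iff]; exact hl
    have := Finsupp.mapDomain_add (f := e) (v₁ := y - Finsupp.single l 1)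
      (v₂ := Finsupp.single l 1)
    rw [tsub_add_cancel_of_le hle, hy, Finsupp.mapDomain_single] at this
    exact (add_right_cancel this).symm

theorem pderiv_rename_of_notMem (e : τ ↪ σ) (s : σ) (hs : s ∉ Set.range e)
    (p : MvPowerSeries τ k) : MvPowerSeries.pderiv k s (MvPowerSeries.rename e p) = 0 := by
  classical
  ext x
  rw [MvPowerSeries.coeff_pderiv, MvPowerSeries.coeff_rename_eq_zero, zero_mul, map_zero]
  rintro ⟨y, hy⟩
  have := DFunLike.congr_fun hy s
  rw [Finsupp.mapDomain_of_notMem_range _ _ hs, Finsupp.add_apply, Finsupp.single_eq_same] at this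
  omega

theorem ddt_projHom_self (e : τ ↪ σ) (l : τ) (f : TotalRing k τ) :
    ddt k (e l) (projHom k e f) = projHom k e (ddt k l f) := by
  ext1 n
  simp [projHom, coeff_ddt, pderiv_rename_self]

theorem ddt_projHom_of_notMem (e : τ ↪ σ) (s : σ) (hs : s ∉ Set.range e) (f : TotalRing k τ) :
    ddt k s (projHom k e f) = 0 := by
  ext1 n
  simp [projHom, coeff_ddt, pderiv_rename_of_notMem e s hs]

/-- The pullback of a module along the projection attached to `e`, namely
`k⟦t_σ, u⟧ ⊗ M` over `k⟦t_τ, u⟧`. -/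
def Pullback (k : Type*) [Field k] {σ τ : Type*} (e : τ ↪ σ) (M : Type*) [AddCommGroup M] [Module (TotalRing k τ) M] : Type _ :=
  letI := (projHom k e).toAlgebra
  TotalRing k σ ⊗[TotalRing k τ] M

variable (e : τ ↪ σ) (M : Type*) [AddCommGroup M] [Module (TotalRing k τ) M]

noncomputable instance : AddCommGroup (Pullback k e M) :=
  @TensorProduct.addCommGroup (TotalRing k τ) _ (TotalRing k σ) M _ _
    (projHom k e).toAlgebra.toModule _

noncomputable instance : Module (TotalRing k σ) (Pullback k e M) :=
  letI := (projHom k e).toAlgebra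
  show Module (TotalRing k σ) (TotalRing k σ ⊗[TotalRing k τ] M) from TensorProduct.leftModule

instance [Module.Finite (TotalRing k τ) M] : Module.Finite (TotalRing k σ) (Pullback k e M) :=
  letI := (projHom k e).toAlgebra
  show Module.Finite (TotalRing k σ) (TotalRing k σ ⊗[TotalRing k τ] M) from inferInstance

instance [Module.Projective (TotalRing k τ) M] :
    Module.Projective (TotalRing k σ) (Pullback k e M) :=
  letI := (projHom k e).toAlgebra
  show Module.Projective (TotalRing k σ) (TotalRing k σ ⊗[TotalRing k τ] M) from inferInstance

variable {M}

/-- The vector field on `B_τ` (times `u`) to which `u ∂_{t_s}` projects: it is `u ∂_{t_l}` if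
`s = e l`, and `0` if `s` is not in the image of `e`. -/
noncomputable def projField (s : σ) : Derivation k (TotalRing k τ) (TotalRing k τ) :=
  (Function.partialInv e s).elim 0 fun l => uVar k τ • ddt k l

/-- The operator `∇_ξ` for the projection `ξ` of `u ∂_{t_s}`. -/
noncomputable def projOp (R : RegularForm k τ M) (s : σ) : M →+ M :=
  (Function.partialInv e s).elim 0 R.opT

theorem partialInv_of_notMem (s : σ) (hs : s ∉ Set.range e) : Function.partialInv e s = none :=
  dif_neg hs

theorem uddt_projHom (s : σ) (f : TotalRing k τ) :
    (uVar k σ • ddt k s) (projHom k e f) = projHom k e (projField e s f) := by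
  by_cases hs : s ∈ Set.range e
  · obtain ⟨l, rfl⟩ := hs
    simp [projField, Function.partialInv_left e.injective, ddt_projHom_self, ← projHom_uVar e]
  · simp [projField, partialInv_of_notMem e s hs, ddt_projHom_of_notMem e s hs]

theorem projOp_leibniz (R : RegularForm k τ M) (s : σ) (f : TotalRing k τ) (m : M) :
    projOp e R s (f • m) = projField (k := k) e s f • m + f • projOp e R s m := by
  unfold projOp projField
  cases Function.partialInv e s with
  | none => simp
  | some l => exact R.leibnizT l f m

/-- The pullback connection `pr^* ∇` along the coordinate projection attached to `e`:
`(pr^* ∇)_ξ (f ⊗ m) = ξ(f) ⊗ m + f ⊗ ∇_{pr_* ξ} m` for the coordinate fields `ξ`. -/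
noncomputable def RegularForm.pullback (R : RegularForm k τ M) :
    RegularForm k σ (Pullback k e M) :=
  letI := (projHom k e).toAlgebra
  { opU := tensorOp (M := M) (uVar k σ ^ 2 • ddu k σ) (uVar k τ ^ 2 • ddu k τ) R.opU
      (fun f => by
        change uVar k σ ^ 2 * ddu k σ (projHom k e f) =
          projHom k e (uVar k τ ^ 2 * ddu k τ f)
        rw [map_mul, map_pow, projHom_uVar, ddu_projHom]) R.leibnizU
    opT := fun s => tensorOp (M := M) (uVar k σ • ddt k s) (projField e s) (projOp e R s)
      (uddt_projHom e s) (projOp_leibniz e R s)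
    leibnizU := fun f x => tensorOp_smul _ _ f x
    leibnizT := fun i f x => tensorOp_smul _ _ f x
    commUT := fun i x => by
      have h := tensorOp_comm (M := M) (D := uVar k σ ^ 2 • ddu k σ) (E := uVar k τ ^ 2 • ddu k τ)
        (T := R.opU) (D' := uVar k σ • ddt k i) (E' := projField e i) (T' := projOp e R i)
        (fun f => by
          change uVar k σ ^ 2 * ddu k σ (projHom k e f) =
            projHom k e (uVar k τ ^ 2 * ddu k τ f)
          rw [map_mul, map_pow, projHom_uVar, ddu_projHom]) R.leibnizU
        (uddt_projHom e i) (projOp_leibniz e R i) (uVar k τ)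
        (fun s => by
          change uVar k σ ^ 2 * ddu k σ (uVar k σ * ddt k i s) =
            uVar k σ * ddt k i (uVar k σ ^ 2 * ddu k σ s) +
              projHom k e (uVar k τ) * (uVar k σ * ddt k i s)
          simp only [projHom_uVar, Derivation.leibniz, Derivation.leibniz_pow, ddu_uVar, ddt_uVar,
            ddu_ddt_comm, smul_eq_mul, smul_zero, mul_zero, add_zero, mul_one]
          ring)
        (fun m => by
          unfold projOp
          cases Function.partialInv e i with
          | none => simp
          | some l => exact R.commUT l m) x
      exact h.trans (congrArg (fun c : TotalRing k σ => _ + c • _) (projHom_uVar e))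
    commTT := fun i j x => by
      have h := tensorOp_comm (M := M) (D := uVar k σ • ddt k i) (E := projField e i)
        (T := projOp e R i) (D' := uVar k σ • ddt k j) (E' := projField e j) (T' := projOp e R j)
        (uddt_projHom e i) (projOp_leibniz e R i) (uddt_projHom e j) (projOp_leibniz e R j) 0
        (fun s => by
          change uVar k σ * ddt k i (uVar k σ * ddt k j s) =
            uVar k σ * ddt k j (uVar k σ * ddt k i s) + projHom k e 0 * (uVar k σ * ddt k j s)
          simp only [map_zero, zero_mul, Derivation.leibniz, ddt_uVar, ddt_comm i j, smul_eq_mul,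
            mul_zero, add_zero])
        (fun m => by
          rw [zero_smul, add_zero]
          unfold projOp
          cases Function.partialInv e i with
          | none => simp
          | some l =>
            cases Function.partialInv e j with
            | none => simp
            | some l' => exact R.commTT l l' m) x
      rw [map_zero, zero_smul, add_zero] at h
      exact h }

end Pullback

section Product

variable {k : Type u} [Field k] {ι σ : Type*}

/-- The direct sum of regular connections on modules `M i`, for a finite index set. -/
noncomputable def RegularForm.pi {M : ι → Type*} [∀ i, AddCommGroup (M i)]
    [∀ i, Module (TotalRing k σ) (M i)] (R : ∀ i, RegularForm k σ (M i)) :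
    RegularForm k σ (∀ i, M i) where
  opU := AddMonoidHom.mk' (fun x i => (R i).opU (x i)) fun x y => by ext i; simp
  opT s := AddMonoidHom.mk' (fun x i => (R i).opT s (x i)) fun x y => by ext i; simp
  leibnizU f x := by ext i; exact (R i).leibnizU f (x i)
  leibnizT s f x := by ext i; exact (R i).leibnizT s f (x i)
  commUT s x := by ext i; exact (R i).commUT s (x i)
  commTT s s' x := by ext i; exact (R i).commTT s s' (x i)

instance pi_projective [Finite ι] {A : Type*} [CommRing A] {M : ι → Type*}
    [∀ i, AddCommGroup (M i)] [∀ i, Module A (M i)] [∀ i, Module.Projective A (M i)] :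
    Module.Projective A (∀ i, M i) := by
  classical
  have := Fintype.ofFinite ι
  exact Module.Projective.of_equiv' (DFinsupp.linearEquivFunOnFintype (R := A) (M := M))

variable {τ : ι → Type w}

/-- The `i`-th summand `pr_i^* H_i` of the product of the F-bundles `G i`. -/
abbrev FBundle.ProdSummand (G : ∀ i, FBundle.{u, v, w} k (τ i)) (i : ι) : Type _ :=
  Pullback k (Function.Embedding.sigmaMk (β := τ) i) (G i).H

/-- The product of a finite family of F-bundles `(H_i, ∇_i) / B_i`: the F-bundle
`⨁ pr_i^* (H_i, ∇_i)` over `∏ B_i`, whose coordinates are indexed by the disjoint union of the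
coordinates of the `B_i`. -/
noncomputable def FBundle.prod [Finite ι] (G : ∀ i, FBundle.{u, v, w} k (τ i)) :
    FBundle k (Σ i, τ i) :=
  (RegularForm.pi fun i =>
    (G i).regularForm.pullback (Function.Embedding.sigmaMk (β := τ) i)).toFBundle

/-- The inclusion of sections `pr_i^* H_i → ⨁ pr_j^* H_j`. -/
noncomputable def FBundle.prodIncl [Finite ι] [DecidableEq ι] (G : ∀ i, FBundle.{u, v, w} k (τ i)) (i : ι)
    (x : FBundle.ProdSummand G i) : (FBundle.prod G).H :=
  (Pi.single i x : ∀ j, FBundle.ProdSummand G j)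

end Product

/-! ### The fibre at `(b, 0)`, the operators `K_b` and `μ_b`, and maximality -/

section Fibre

variable {k : Type u} [Field k] {σ : Type w}

/-- The fibre at the point `(b, 0)`, `t = u = 0`, of the sheaf attached to a module `H`. -/
def Fibre (k : Type u) [Field k] (σ : Type w) (H : Type v) [AddCommGroup H]
    [Module (TotalRing k σ) H] : Type v :=
  H ⧸ (originIdeal k σ • ⊤ : Submodule (TotalRing k σ) H)

variable {H : Type v} [AddCommGroup H] [Module (TotalRing k σ) H]

noncomputable instance : AddCommGroup (Fibre k σ H) :=
  Submodule.Quotient.addCommGroup (originIdeal k σ • ⊤ : Submodule (TotalRing k σ) H)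

noncomputable instance : Module (TotalRing k σ) (Fibre k σ H) :=
  Submodule.Quotient.module (originIdeal k σ • ⊤ : Submodule (TotalRing k σ) H)

/-- The fibre is a vector space over `k`, through the constants `k ⊆ k⟦t, u⟧`. -/
noncomputable instance : Module k (Fibre k σ H) :=
  Module.compHom (Fibre k σ H) (algebraMap k (TotalRing k σ))

theorem fibre_smul_def (c : k) (x : Fibre k σ H) : c • x = algebraMap k (TotalRing k σ) c • x :=
  rfl

/-- The value of a section at `(b, 0)`. -/
noncomputable def toFibre : H →ₗ[TotalRing k σ] Fibre k σ H :=
  (originIdeal k σ • ⊤ : Submodule (TotalRing k σ) H).mkQ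

theorem toFibre_surjective : Function.Surjective (toFibre (k := k) (σ := σ) (H := H)) :=
  Submodule.mkQ_surjective _

theorem toFibre_eq_zero {s : H} :
    toFibre (k := k) (σ := σ) s = 0 ↔ s ∈ (originIdeal k σ • ⊤ : Submodule (TotalRing k σ) H) :=
  Submodule.Quotient.mk_eq_zero _

/-- The endomorphism of the fibre at `(b, 0)` induced by an additive operator `T` on `H` obeying
the Leibniz rule over a vector field `D` that vanishes at `u = 0`. -/
noncomputable def fibreOp (D : TotalRing k σ → TotalRing k σ) (hD : ∀ f, D f ∈ originIdeal k σ)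
    (T : H →+ H) (hT : ∀ (f : TotalRing k σ) (s : H), T (f • s) = D f • s + f • T s) :
    Module.End k (Fibre k σ H) where
  toFun := QuotientAddGroup.map
    (originIdeal k σ • ⊤ : Submodule (TotalRing k σ) H).toAddSubgroup
    (originIdeal k σ • ⊤ : Submodule (TotalRing k σ) H).toAddSubgroup T (by
      intro x hx
      change T x ∈ (originIdeal k σ • ⊤ : Submodule (TotalRing k σ) H)
      refine Submodule.smul_induction_on (p := fun x => T x ∈
        (originIdeal k σ • ⊤ : Submodule (TotalRing k σ) H)) hx (fun f hf s _ => ?_)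
        (fun x y hx hy => ?_)
      · rw [hT]
        exact add_mem (Submodule.smul_mem_smul (hD f) trivial) (Submodule.smul_mem_smul hf trivial)
      · rw [map_add]
        exact add_mem hx hy)
  map_add' x y := map_add _ x y
  map_smul' c x := by
    obtain ⟨s, rfl⟩ := toFibre_surjective x
    change toFibre (k := k) (σ := σ) (T (algebraMap k (TotalRing k σ) c • s)) =
      algebraMap k (TotalRing k σ) c • toFibre (k := k) (σ := σ) (T s)
    rw [hT, map_add, toFibre_eq_zero.mpr (Submodule.smul_mem_smul (hD _) trivial), zero_add,
      LinearMap.map_smul]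

theorem fibreOp_toFibre (D : TotalRing k σ → TotalRing k σ) (hD : ∀ f, D f ∈ originIdeal k σ)
    (T : H →+ H) (hT : ∀ (f : TotalRing k σ) (s : H), T (f • s) = D f • s + f • T s) (s : H) :
    fibreOp D hD T hT (toFibre s) = toFibre (T s) :=
  rfl

end Fibre

/-- The set of eigenvalues in an algebraic closure of `k` of an endomorphism of a vector space
over `k`. -/
noncomputable def geometricSpectrum {k : Type u} [Field k] {V : Type v} [AddCommGroup V]
    [Module k V] (f : Module.End k V) : Set (AlgebraicClosure k) :=
  spectrum (AlgebraicClosure k)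
    (LinearMap.baseChange (AlgebraicClosure k) f :
      Module.End (AlgebraicClosure k) (AlgebraicClosure k ⊗[k] V))

namespace FBundle

variable {k : Type u} [Field k] {σ : Type w} (F : FBundle.{u, v, w} k σ)

/-- The fibre `H_{b,0}`. -/
abbrev fibre : Type v := Fibre k σ F.H

/-- The endomorphism `K_b` of `H_{b,0}` induced by `∇_{u² ∂_u}`. -/
noncomputable def K : Module.End k F.fibre :=
  fibreOp (fun f => uVar k σ ^ 2 * ddu k σ f)
    (fun _ => Ideal.mul_mem_right _ _ (Ideal.pow_mem_of_mem _ uVar_mem_originIdeal 2 two_pos))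
    F.opU F.regularForm.leibnizU

/-- The action `μ_b(∂_{t_i})` on `H_{b,0}` induced by `∇_{u ∂_{t_i}}`. -/
noncomputable def muCoord (i : σ) : Module.End k F.fibre :=
  fibreOp (fun f => uVar k σ * ddt k i f)
    (fun _ => Ideal.mul_mem_right _ _ uVar_mem_originIdeal)
    (F.opT i) (F.regularForm.leibnizT i)

/-- The action `μ_b : T_b B → End(H_{b,0})`, where the tangent vector `∑ v_i ∂_{t_i}` at `b` is
written as `v : σ → k`. -/
noncomputable def mu [Fintype σ] : (σ → k) →ₗ[k] Module.End k F.fibre :=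
  ∑ i, (LinearMap.proj i : (σ → k) →ₗ[k] k).smulRight (F.muCoord i)

/-- `F` is maximal at `b`: there is a cyclic vector `h` in `H_{b,0}`, i.e. one for which
`v ↦ μ_b(v)(h)` is an isomorphism `T_b B → H_{b,0}`. As `b` is the only closed point of `B`, this
is also maximality of `F` over `B`. -/
def IsMaximal [Fintype σ] : Prop :=
  ∃ h : F.fibre, Function.Bijective fun v : σ → k => F.mu v h

end FBundle

/-- An isomorphism `(f, Φ) : (H, ∇)/B → (H', ∇')/B'` of F-bundles. The isomorphism `f : B → B'` of
formal schemes is given by its pullback `f^*` on functions (a `k`-algebra isomorphism between these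
power series rings is automatically local, hence continuous), and the isomorphism
`Φ : H → (f × id_u)^* H'` by the map on sections `s ↦ Φ⁻¹((f × id_u)^* s)`, a bijection `H' → H`
that is semilinear over `(f × id_u)^*`. The last two conditions say that `Φ` identifies `∇` with
`(f × id_u)^* ∇'`; here `(f^* ∇')_{∂_{t_i}} = ∑_l ∂(f^* t'_l)/∂t_i · f^*(∇'_{∂_{t'_l}})`. -/
structure FBundle.Iso {k : Type u} [Field k] {σ : Type*} {σ' : Type*} [Fintype σ']
    (F : FBundle k σ) (F' : FBundle k σ') where
  /-- The pullback `f^*` of functions. -/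
  base : BaseRing k σ' ≃ₐ[k] BaseRing k σ
  /-- The map `s ↦ Φ⁻¹((f × id_u)^* s)` on sections. -/
  sections : F'.H ≃+ F.H
  map_smul : ∀ (a : TotalRing k σ') (s : F'.H),
    sections (a • s) = PowerSeries.map (base : BaseRing k σ' →+* BaseRing k σ) a • sections s
  map_opU : ∀ s : F'.H, F.opU (sections s) = sections (F'.opU s)
  map_opT : ∀ (i : σ) (s : F'.H), F.opT i (sections s) =
    ∑ l : σ', (PowerSeries.C (MvPowerSeries.pderiv k i (base (MvPowerSeries.X l))) :
      TotalRing k σ) • sections (F'.opT l s)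

end FormalFBundle

open FormalFBundle

/-!
The decomposition of the fibre first spreads out to the whole of `B × Spf k⟦u⟧`, and maximality then
makes the base split along with it.

*Splitting the connection.* Since the blocks of `K_b` have coprime characteristic polynomials, the
operator `X ↦ [K_b, X]` is invertible on matrices outside the diagonal blocks
(`eq_zero_of_mul_eq_mul_of_isCoprime`, `blockSylvester_bijective`). Removing the off-diagonal part
of `∇_{u² ∂_u}` by a change of frame is therefore a fixed point problem for a map that is
contracting in the `(t, u)`-adic topology (`exists_blockDiag_gauge`), and flatness forces the
operators `∇_{u ∂_t}` to be block diagonal in the new frame too (`blockDiag_of_flat`).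

*Splitting the base.* At `u = 0` the operators `μ(ξ)` commute and are block diagonal. By maximality
there are vector fields `ξ_γ` on `B`, indexed by the frame, with `μ(ξ_γ) h = e_γ` for the cyclic
vector `h`; then `μ(ξ_γ) e_α = μ(ξ_α) e_γ` vanishes if `α` and `γ` lie in different blocks, so that
`∇_{ξ_γ}` has no pole on the other blocks. The fields along which `∇` has no pole on a given block
form an involutive distribution, because `[∇_p, ∇_q] = ∇_{[p, q]}` (`alongZero_bracket`). The formal
Frobenius theorem `exists_first_integral` and the formal inverse function theorem
`substAlgHom_bijective` give coordinates on `B`, indexed by the frame, in which each block is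
regular along the coordinates of the other blocks (`exists_coordinates`).

*Descending to the factors.* Regularity and flatness allow each block to be trivialised along the
coordinates of the other blocks, by a Taylor series (`CompleteFiltration.exists_flat`,
`exists_flat_frame`). In such a frame the connection matrices of a block depend only on the
coordinates of that block (`ddt_connMatrix_eq_zero`), so that they define an F-bundle on the factor
(`exists_descent`). The given F-bundle is the product of these (`exists_prod_decomposition`), and
the components of `h` are cyclic vectors of the factors.
-/

namespace FormalFBundle

/-! ### Complete filtrations and contractions -/

/-- A decreasing filtration of a module, indexed by `ℕ` and starting with the whole module, for
which the module is separated and complete. Completeness is the convergence of every sequence whose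
`N`-th step lies in `F N`, with the corresponding rate of convergence. -/
structure CompleteFiltration {R M : Type*} [CommRing R] [AddCommGroup M] [Module R M]
    (F : ℕ → Submodule R M) : Prop where
  zero : F 0 = ⊤
  anti : Antitone F
  sep : ∀ x, (∀ N, x ∈ F N) → x = 0
  complete : ∀ s : ℕ → M, (∀ N, s (N + 1) - s N ∈ F N) → ∃ L, ∀ N, L - s N ∈ F N

namespace CompleteFiltration

section Basic

variable {R M : Type*} [CommRing R] [AddCommGroup M] [Module R M] {F : ℕ → Submodule R M}

theorem mem_zero (hF : CompleteFiltration F) (x : M) : x ∈ F 0 := by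
  rw [hF.zero]; trivial

/-- A map that improves the agreement of any two points by one step has a fixed point, the limit of
its iterates. -/
theorem exists_fixedPoint (hF : CompleteFiltration F) (Φ : M → M)
    (h : ∀ N x y, x - y ∈ F N → Φ x - Φ y ∈ F (N + 1)) : ∃ x, Φ x = x := by
  have hs : ∀ N, Φ^[N + 1] 0 - Φ^[N] 0 ∈ F N := by
    intro N
    induction N with
    | zero => exact hF.mem_zero _
    | succ N ih =>
      have := h _ _ _ ih
      rwa [← Function.iterate_succ_apply' Φ, ← Function.iterate_succ_apply' Φ] at this
  obtain ⟨L, hL⟩ := hF.complete (fun N => Φ^[N] 0) hs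
  refine ⟨L, sub_eq_zero.mp (hF.sep _ fun N => ?_)⟩
  have h1 := h _ _ _ (hL N)
  have h2 := hL (N + 1)
  simp only [Function.iterate_succ_apply'] at h2
  have := sub_mem h1 h2
  rw [sub_sub_sub_cancel_right] at this
  exact hF.anti N.le_succ this

theorem eq_zero_of_forall_succ (hF : CompleteFiltration F) {x : M}
    (h : ∀ N, x ∈ F N → x ∈ F (N + 1)) : x = 0 := by
  refine hF.sep x fun N => ?_
  induction N with
  | zero => exact hF.mem_zero _
  | succ N ih => exact h N ih

/-- The product filtration on a power of a filtered module. -/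
def piFil (J : Type*) (F : ℕ → Submodule R M) (N : ℕ) : Submodule R (J → M) :=
  Submodule.pi Set.univ fun _ => F N

theorem mem_piFil {J : Type*} {N : ℕ} {x : J → M} : x ∈ piFil J F N ↔ ∀ j, x j ∈ F N := by
  simp [piFil]

theorem pi (hF : CompleteFiltration F) (J : Type*) : CompleteFiltration (piFil J F) where
  zero := by ext x; simp [mem_piFil, hF.zero]
  anti := fun m n h x hx => mem_piFil.mpr fun j => hF.anti h (mem_piFil.mp hx j)
  sep x h := funext fun j => hF.sep _ fun N => mem_piFil.mp (h N) j
  complete s h := by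
    choose L hL using fun j => hF.complete (fun N => s N j) fun N => mem_piFil.mp (h N) j
    exact ⟨L, fun N => mem_piFil.mpr fun j => hL j N⟩

end Basic

/-! ### Flat sections along commuting vector fields -/

section Flat

variable {k R M : Type*} [Field k] [CommRing R] [Algebra k R] [AddCommGroup M]
  [Module R M] {F : ℕ → Submodule R M}

/-- The truncated Taylor series `∑_{m < N} (-y)^m / m! T^m s`. -/
noncomputable def taylorSum (k : Type*) {R M : Type*} [Field k] [CommRing R] [Algebra k R]
    [AddCommGroup M] [Module R M] (T : M →+ M) (y : R) (s : M) (N : ℕ) : M :=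
  ∑ m ∈ Finset.range N, (algebraMap k R ((m.factorial : k)⁻¹) * (-y) ^ m) • T^[m] s

theorem taylorSum_succ (T : M →+ M) (y : R) (s : M) (N : ℕ) :
    taylorSum k T y s (N + 1) =
      taylorSum k T y s N + (algebraMap k R ((N.factorial : k)⁻¹) * (-y) ^ N) • T^[N] s :=
  Finset.sum_range_succ _ _

/-- The sum telescopes: applying `T` leaves only the last term. -/
theorem apply_taylorSum [CharZero k] {D : Derivation k R R} {T : M →+ M}
    (hT : ∀ (f : R) (s : M), T (f • s) = D f • s + f • T s) {y : R} (hy : D y = 1) (s : M)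
    (N : ℕ) : T (taylorSum k T y s (N + 1)) =
      (algebraMap k R ((N.factorial : k)⁻¹) * (-y) ^ N) • T^[N + 1] s := by
  induction N with
  | zero => simp [taylorSum]
  | succ N ih =>
    have hfac : (algebraMap k R) (((N + 1).factorial : k)⁻¹) * ((N : R) + 1) =
        algebraMap k R ((N.factorial : k)⁻¹) := by
      have h1 : ((N : R) + 1) = algebraMap k R ((N : k) + 1) := by simp
      rw [h1, ← map_mul]
      congr 1
      rw [Nat.factorial_succ]
      have : (N : k) + 1 ≠ 0 := Nat.cast_add_one_ne_zero N
      have h2 : (N.factorial : k) ≠ 0 := Nat.cast_ne_zero.mpr (Nat.factorial_ne_zero N)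
      push_cast
      field_simp
    have hD : D (algebraMap k R (((N + 1).factorial : k)⁻¹) * (-y) ^ (N + 1)) =
        -(algebraMap k R ((N.factorial : k)⁻¹) * (-y) ^ N) := by
      rw [Derivation.leibniz, Derivation.map_algebraMap, Derivation.leibniz_pow, map_neg, hy,
        ← hfac]
      simp only [smul_eq_mul, nsmul_eq_mul, Nat.add_sub_cancel]
      push_cast
      ring
    rw [taylorSum_succ, map_add, ih, hT, hD, ← Function.iterate_succ_apply' T (N + 1) s, neg_smul]
    abel

theorem iterate_mem {T : M →+ M} (hTF : ∀ N x, x ∈ F (N + 1) → T x ∈ F N)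
    (hF : CompleteFiltration F) {s : M} {r : ℕ} (hs : T s ∈ F r) (m : ℕ) :
    T^[m + 1] s ∈ F (r - m) := by
  induction m with
  | zero => simpa using hs
  | succ m ih =>
    rw [Function.iterate_succ_apply']
    rcases Nat.lt_or_ge m r with h | h
    · apply hTF
      rwa [show r - (m + 1) + 1 = r - m by omega]
    · rw [show r - (m + 1) = 0 by omega]
      exact hF.mem_zero _

theorem pow_smul_mem {y : R} (hyF : ∀ N x, x ∈ F N → y • x ∈ F (N + 1)) (c : R) {N : ℕ} {x : M}
    (hx : x ∈ F N) (m : ℕ) : (c * (-y) ^ m) • x ∈ F (N + m) := by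
  induction m with
  | zero => simpa using Submodule.smul_mem _ c hx
  | succ m ih =>
    have h := Submodule.neg_mem _ (hyF _ _ ih)
    rwa [← neg_smul, smul_smul, show -y * (c * (-y) ^ m) = c * (-y) ^ (m + 1) by ring] at h

/-- Along one vector field `D` with `D y = 1`, the series `∑ (-y)^m / m! T^m s` converges to a
`T`-flat section. The last part says that flatness along a further direction, in which `y` is
constant, is not lost. -/
theorem exists_flat_one [CharZero k] (hF : CompleteFiltration F) {D : Derivation k R R} {T : M →+ M}
    (hT : ∀ (f : R) (s : M), T (f • s) = D f • s + f • T s)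
    (hTF : ∀ N x, x ∈ F (N + 1) → T x ∈ F N) {y : R} (hy : D y = 1)
    (hyF : ∀ N x, x ∈ F N → y • x ∈ F (N + 1)) (s : M) {r : ℕ} (hs : T s ∈ F r) :
    ∃ s', T s' = 0 ∧ s' - s ∈ F (r + 1) ∧
      ∀ (D' : Derivation k R R) (T' : M →+ M),
        (∀ (f : R) (s : M), T' (f • s) = D' f • s + f • T' s) →
        (∀ N x, x ∈ F (N + 1) → T' x ∈ F N) → D' y = 0 → (∀ x, T' (T x) = T (T' x)) →
        T' s = 0 → T' s' = 0 := by
  have hstep : ∀ N, taylorSum k T y s (N + 1) - taylorSum k T y s N ∈ F N := by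
    intro N
    rw [taylorSum_succ, add_sub_cancel_left]
    simpa using pow_smul_mem hyF _ (hF.mem_zero (T^[N] s)) N
  obtain ⟨L, hL⟩ := hF.complete _ hstep
  refine ⟨L, hF.sep _ fun N => ?_, ?_, ?_⟩
  · have h1 := hTF N _ (hL (N + 1))
    rw [map_sub, apply_taylorSum hT hy] at h1
    have h2 := pow_smul_mem hyF (algebraMap k R ((N.factorial : k)⁻¹))
      (hF.mem_zero (T^[N + 1] s)) N
    rw [zero_add] at h2
    simpa using add_mem h1 h2
  · have h2 : ∀ N, taylorSum k T y s (N + 1) - s ∈ F (r + 1) := by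
      intro N
      induction N with
      | zero => simp [taylorSum]
      | succ N ih =>
        rw [taylorSum_succ, add_sub_right_comm]
        refine add_mem ih (hF.anti ?_ (pow_smul_mem hyF _ (iterate_mem hTF hF hs N) (N + 1)))
        omega
    have := add_mem (hL (r + 1)) (h2 r)
    rwa [sub_add_sub_cancel] at this
  · intro D' T' hT' hTF' hy' hcomm h0
    have hiter : ∀ m, T' (T^[m] s) = 0 := by
      intro m
      induction m with
      | zero => exact h0
      | succ m ih => rw [Function.iterate_succ_apply', hcomm, ih, map_zero]
    have hsum : ∀ N, T' (taylorSum k T y s N) = 0 := by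
      intro N
      rw [taylorSum, map_sum]
      refine Finset.sum_eq_zero fun m _ => ?_
      rw [hT', hiter, smul_zero, add_zero, Derivation.leibniz, Derivation.map_algebraMap,
        Derivation.leibniz_pow, map_neg, hy']
      simp
    refine hF.sep _ fun N => ?_
    have h1 := hTF' N _ (hL (N + 1))
    rwa [map_sub, hsum, sub_zero] at h1

/-- Let `T j` be commuting operators on a complete filtered module, each obeying the Leibniz rule
over a vector field `D j`, and let `y j` be functions with `D j (y j') = δ`. Then every section
`s` can be corrected, by a term as small as the `T j s` allow, to one that is flat along all the
`D j`. -/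
theorem exists_flat [CharZero k] (hF : CompleteFiltration F) {J : Type*} [DecidableEq J]
    {D : J → Derivation k R R} {T : J → M →+ M}
    (hT : ∀ j (f : R) (s : M), T j (f • s) = D j f • s + f • T j s)
    (hTF : ∀ j N x, x ∈ F (N + 1) → T j x ∈ F N) {y : J → R}
    (hy : ∀ i j, D i (y j) = if i = j then 1 else 0)
    (hyF : ∀ j N x, x ∈ F N → y j • x ∈ F (N + 1))
    (hcomm : ∀ i j x, T i (T j x) = T j (T i x)) (s : M) {r : ℕ} (hs : ∀ j, T j s ∈ F r)
    (S : Finset J) : ∃ s', (∀ j ∈ S, T j s' = 0) ∧ s' - s ∈ F (r + 1) := by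
  induction S using Finset.induction_on with
  | empty => exact ⟨s, by simp, by simp⟩
  | insert j S hj ih =>
    obtain ⟨s₁, h1, h2⟩ := ih
    have hs1 : T j s₁ ∈ F r := by
      have := add_mem (hTF j _ _ h2) (hs j)
      rwa [map_sub, sub_add_cancel] at this
    obtain ⟨s₂, h3, h4, h5⟩ := exists_flat_one hF (hT j) (hTF j) (by simp [hy]) (hyF j) s₁ hs1
    refine ⟨s₂, fun i hi => ?_, ?_⟩
    · rcases Finset.mem_insert.mp hi with h | hi
      · rw [h]; exact h3
      · refine h5 (D i) (T i) (hT i) (hTF i) ?_ (hcomm i j) (h1 i hi)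
        rw [hy, if_neg (ne_of_mem_of_not_mem hi hj)]
    · have := add_mem h4 h2
      rwa [sub_add_sub_cancel] at this

end Flat

end CompleteFiltration

/-! ### The order filtrations on functions -/

section OrderFiltration

variable {k : Type u} [Field k] {σ : Type w}

/-- The ideal of power series of order at least `N`. -/
def baseFil (k : Type u) [Field k] (σ : Type w) (N : ℕ) : Ideal (MvPowerSeries σ k) where
  carrier := {f | (N : ℕ∞) ≤ f.order}
  add_mem' hf hg := le_trans (le_min hf hg) (MvPowerSeries.min_order_le_add)
  zero_mem' := by simp
  smul_mem' c f hf := (le_trans hf le_add_self).trans (MvPowerSeries.le_order_mul (f := c))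

theorem mem_baseFil {N : ℕ} {f : MvPowerSeries σ k} :
    f ∈ baseFil k σ N ↔ (N : ℕ∞) ≤ f.order :=
  Iff.rfl

theorem mem_baseFil_iff_coeff {N : ℕ} {f : MvPowerSeries σ k} :
    f ∈ baseFil k σ N ↔ ∀ d : σ →₀ ℕ, d.degree < N → MvPowerSeries.coeff d f = 0 :=
  ⟨fun h _ hd => MvPowerSeries.coeff_of_lt_order (lt_of_lt_of_le (by exact_mod_cast hd) h),
    MvPowerSeries.nat_le_order⟩

theorem mem_baseFil_one {f : MvPowerSeries σ k} :
    f ∈ baseFil k σ 1 ↔ MvPowerSeries.constantCoeff f = 0 := by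
  rw [mem_baseFil, Nat.cast_one, MvPowerSeries.one_le_order_iff_constCoeff_eq_zero]

theorem mul_mem_baseFil {a b : ℕ} {f g : MvPowerSeries σ k} (hf : f ∈ baseFil k σ a)
    (hg : g ∈ baseFil k σ b) : f * g ∈ baseFil k σ (a + b) := by
  rw [mem_baseFil, Nat.cast_add]
  exact (add_le_add hf hg).trans MvPowerSeries.le_order_mul

theorem pderiv_mem_baseFil {N : ℕ} {f : MvPowerSeries σ k} (hf : f ∈ baseFil k σ (N + 1)) (i : σ) :
    MvPowerSeries.pderiv k i f ∈ baseFil k σ N := by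
  rw [mem_baseFil_iff_coeff] at hf ⊢
  intro d hd
  rw [MvPowerSeries.coeff_pderiv, hf, zero_mul]
  simpa using hd

/-- In characteristic zero the order is detected by the derivatives and the constant term. -/
theorem mem_baseFil_succ_of_pderiv [CharZero k] {N : ℕ} {f : MvPowerSeries σ k}
    (h0 : MvPowerSeries.constantCoeff f = 0)
    (h : ∀ i, MvPowerSeries.pderiv k i f ∈ baseFil k σ N) : f ∈ baseFil k σ (N + 1) := by
  classical
  rw [mem_baseFil_iff_coeff]
  intro d hd
  by_cases hd0 : d = 0
  · subst hd0; simpa using h0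
  · obtain ⟨i, hi⟩ := Finsupp.ne_iff.mp hd0
    have hle : Finsupp.single i 1 ≤ d := by
      rw [Finsupp.single_le_iff]; exact Nat.one_le_iff_ne_zero.mpr hi
    have h1 := mem_baseFil_iff_coeff.mp (h i) (d - Finsupp.single i 1) (by
      have := congrArg Finsupp.degree (tsub_add_cancel_of_le hle)
      simp at this
      omega)
    rw [MvPowerSeries.coeff_pderiv, tsub_add_cancel_of_le hle] at h1
    exact (mul_eq_zero.mp h1).resolve_right (Nat.cast_add_one_ne_zero _)

theorem completeFiltration_baseFil : CompleteFiltration (baseFil k σ) where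
  zero := by ext f; simp [mem_baseFil]
  anti m n h f hf := le_trans (show (m : ℕ∞) ≤ n from mod_cast h) hf
  sep f h := by
    ext d
    exact mem_baseFil_iff_coeff.mp (h (d.degree + 1)) d (Nat.lt_succ_self _)
  complete s h := by
    let L : MvPowerSeries σ k := fun d => MvPowerSeries.coeff d (s (d.degree + 1))
    have hL : ∀ d, MvPowerSeries.coeff d L = MvPowerSeries.coeff d (s (d.degree + 1)) :=
      fun _ => rfl
    refine ⟨L, fun N => ?_⟩
    rw [mem_baseFil_iff_coeff]
    intro d hd
    have h1 : s N - s (d.degree + 1) ∈ baseFil k σ (d.degree + 1) := by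
      have hd : d.degree + 1 ≤ N := hd
      clear * - h hd
      induction N, hd using Nat.le_induction with
      | base => simp
      | succ n hmn ih =>
        have := add_mem (show s (n + 1) - s n ∈ baseFil k σ (d.degree + 1) from
          le_trans (show ((d.degree + 1 : ℕ) : ℕ∞) ≤ n from mod_cast hmn) (h n)) ih
        rwa [sub_add_sub_cancel] at this
    have h2 := mem_baseFil_iff_coeff.mp h1 d (Nat.lt_succ_self _)
    rw [map_sub, sub_eq_zero] at h2 ⊢
    rw [hL, h2]

/-- The ideal of functions on `B × Spf k⟦u⟧` of total order at least `N` in `t` and `u`: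
the coefficient of `u ^ n` has order at least `N - n`. The subtraction is truncated, so that there
is no condition for `n ≥ N`. -/
def totFil (k : Type u) [Field k] (σ : Type w) (N : ℕ) : Ideal (TotalRing k σ) where
  carrier := {f | ∀ n, PowerSeries.coeff n f ∈ baseFil k σ (N - n)}
  add_mem' hf hg n := by rw [map_add]; exact add_mem (hf n) (hg n)
  zero_mem' n := by rw [map_zero]; exact zero_mem _
  smul_mem' c f hf n := by
    rw [smul_eq_mul, PowerSeries.coeff_mul]
    refine Submodule.sum_mem _ fun p hp => Ideal.mul_mem_left _ _ ?_
    have := Finset.HasAntidiagonal.mem_antidiagonal.mp hp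
    exact completeFiltration_baseFil.anti (by omega) (hf p.2)

theorem mem_totFil {N : ℕ} {f : TotalRing k σ} :
    f ∈ totFil k σ N ↔ ∀ n, PowerSeries.coeff n f ∈ baseFil k σ (N - n) :=
  Iff.rfl

theorem mem_totFil_one {f : TotalRing k σ} : f ∈ totFil k σ 1 ↔ evalOrigin k σ f = 0 := by
  rw [mem_totFil]
  constructor
  · intro h
    have := h 0
    rw [tsub_zero, mem_baseFil_one, PowerSeries.coeff_zero_eq_constantCoeff_apply] at this
    exact this
  · rintro h (_ | n)
    · rw [tsub_zero, mem_baseFil_one]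
      rw [PowerSeries.coeff_zero_eq_constantCoeff_apply]
      exact h
    · rw [show 1 - (n + 1) = 0 by omega]
      exact completeFiltration_baseFil.mem_zero _

theorem mul_mem_totFil {a b : ℕ} {f g : TotalRing k σ} (hf : f ∈ totFil k σ a)
    (hg : g ∈ totFil k σ b) : f * g ∈ totFil k σ (a + b) := by
  intro n
  rw [PowerSeries.coeff_mul]
  refine Submodule.sum_mem _ fun p hp => ?_
  have := Finset.HasAntidiagonal.mem_antidiagonal.mp hp
  exact completeFiltration_baseFil.anti (by omega) (mul_mem_baseFil (hf p.1) (hg p.2))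

theorem uVar_mem_totFil : uVar k σ ∈ totFil k σ 1 := by
  rw [mem_totFil_one]; simp [evalOrigin]

theorem ddt_mem_totFil {N : ℕ} {f : TotalRing k σ} (hf : f ∈ totFil k σ (N + 1)) (i : σ) :
    ddt k i f ∈ totFil k σ N := by
  intro n
  rw [coeff_ddt]
  rcases Nat.lt_or_ge N n with h | h
  · rw [show N - n = 0 by omega]
    exact completeFiltration_baseFil.mem_zero _
  · apply pderiv_mem_baseFil
    rw [show N - n + 1 = N + 1 - n by omega]
    exact hf n

theorem sq_mul_ddu_mem_totFil {N : ℕ} {f : TotalRing k σ} (hf : f ∈ totFil k σ N) :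
    uVar k σ ^ 2 * ddu k σ f ∈ totFil k σ (N + 1) := by
  rintro (_ | _ | n)
  · rw [mul_comm, PowerSeries.coeff_mul_X_pow', if_neg (by omega)]
    exact zero_mem _
  · rw [mul_comm, PowerSeries.coeff_mul_X_pow', if_neg (by omega)]
    exact zero_mem _
  · rw [mul_comm, show n + 1 + 1 = n + 2 from rfl, PowerSeries.coeff_mul_X_pow, coeff_ddu]
    refine Ideal.mul_mem_right _ _ ?_
    rw [show N + 1 - (n + 2) = N - (n + 1) by omega]
    exact hf (n + 1)

theorem completeFiltration_totFil : CompleteFiltration (totFil k σ) where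
  zero := by
    ext f
    simp only [Submodule.mem_top, iff_true]
    intro n
    rw [show 0 - n = 0 by omega]
    exact completeFiltration_baseFil.mem_zero _
  anti m n h f hf i := completeFiltration_baseFil.anti (by omega) (hf i)
  sep f h := by
    ext1 n
    refine completeFiltration_baseFil.sep _ fun N => ?_
    simpa using h (N + n) n
  complete s h := by
    have h1 : ∀ n, ∃ L, ∀ N, L - PowerSeries.coeff n (s (N + n)) ∈ baseFil k σ N := by
      intro n
      refine completeFiltration_baseFil.complete (fun N => PowerSeries.coeff n (s (N + n)))
        fun N => ?_
      have := h (N + n) n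
      rwa [map_sub, Nat.add_sub_cancel, add_right_comm] at this
    choose L hL using h1
    refine ⟨PowerSeries.mk L, fun N n => ?_⟩
    rcases Nat.lt_or_ge N n with hn | hn
    · rw [show N - n = 0 by omega]
      exact completeFiltration_baseFil.mem_zero _
    · have := hL n (N - n)
      rw [Nat.sub_add_cancel hn] at this
      rwa [map_sub, PowerSeries.coeff_mk]

end OrderFiltration

/-! ### Matrices over local rings -/

section LocalMatrix

variable {k A : Type*} [Field k] [CommRing A] {κ σ : Type*} [Fintype κ] [Fintype σ]
  [DecidableEq κ] [DecidableEq σ]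

theorem isUnit_of_map_eq_one (π : A →+* k) (hπ : ∀ a, IsUnit (π a) → IsUnit a)
    {M : Matrix κ κ A} (hM : π.mapMatrix M = 1) : IsUnit M := by
  rw [Matrix.isUnit_iff_isUnit_det]
  apply hπ
  rw [RingHom.map_det, hM, Matrix.det_one]
  exact isUnit_one

/-- A (rectangular) matrix that is invertible at the closed point is invertible. -/
theorem exists_inverse_of_map [Algebra k A] (π : A →+* k) (hπ : ∀ a, IsUnit (π a) → IsUnit a)
    (hsec : ∀ c, π (algebraMap k A c) = c) {E : Matrix κ σ A} {G₀ : Matrix σ κ k}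
    (h1 : E.map π * G₀ = 1) (h2 : G₀ * E.map π = 1) :
    ∃ G : Matrix σ κ A, E * G = 1 ∧ G * E = 1 := by
  have hG : (G₀.map (algebraMap k A)).map π = G₀ := by
    ext i j
    simp [hsec]
  have hu1 : IsUnit (E * G₀.map (algebraMap k A)) := by
    apply isUnit_of_map_eq_one π hπ
    rw [RingHom.mapMatrix_apply, Matrix.map_mul, hG, h1]
  have hu2 : IsUnit (G₀.map (algebraMap k A) * E) := by
    apply isUnit_of_map_eq_one π hπ
    rw [RingHom.mapMatrix_apply, Matrix.map_mul, hG, h2]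
  obtain ⟨b, hb⟩ := hu1.exists_right_inv
  obtain ⟨c, hc⟩ := hu2.exists_left_inv
  rw [Matrix.mul_assoc] at hb
  rw [← Matrix.mul_assoc] at hc
  have hl : c * G₀.map (algebraMap k A) = G₀.map (algebraMap k A) * b := by
    calc c * G₀.map (algebraMap k A)
        = c * G₀.map (algebraMap k A) * (E * (G₀.map (algebraMap k A) * b)) := by
          rw [hb, Matrix.mul_one]
      _ = c * G₀.map (algebraMap k A) * E * (G₀.map (algebraMap k A) * b) := by
          simp only [Matrix.mul_assoc]
      _ = _ := by rw [hc, Matrix.one_mul]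
  exact ⟨G₀.map (algebraMap k A) * b, hb, by rw [← hl, hc]⟩

theorem isUnit_of_isUnit_constantCoeff {σ : Type*} (a : MvPowerSeries σ k)
    (h : IsUnit (MvPowerSeries.constantCoeff a)) : IsUnit a :=
  MvPowerSeries.isUnit_iff_constantCoeff.mpr h

theorem isUnit_of_isUnit_evalOrigin {k : Type u} [Field k] {σ : Type w} (a : TotalRing k σ)
    (h : IsUnit (evalOrigin k σ a)) : IsUnit a :=
  PowerSeries.isUnit_iff_constantCoeff.mpr (MvPowerSeries.isUnit_iff_constantCoeff.mpr h)

theorem algebraMap_totalRing {k : Type u} [Field k] {σ : Type w} (c : k) :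
    algebraMap k (TotalRing k σ) c = PowerSeries.C (MvPowerSeries.C c) := by
  rw [PowerSeries.algebraMap_apply]
  rfl

theorem evalOrigin_algebraMap {k : Type u} [Field k] {σ : Type w} (c : k) :
    evalOrigin k σ (algebraMap k (TotalRing k σ) c) = c := by
  rw [algebraMap_totalRing]
  simp [evalOrigin]

end LocalMatrix

/-! ### Substitution: the chain rule and the formal inverse function theorem -/

section InverseFunction

variable {k : Type u} [Field k] {σ κ : Type*}

theorem sub_truncTotal_mem_baseFil [Finite κ] (a : MvPowerSeries κ k) (N : ℕ) :
    a - (MvPowerSeries.truncTotal N a : MvPowerSeries κ k) ∈ baseFil k κ N := by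
  rw [mem_baseFil_iff_coeff]
  intro d hd
  rw [map_sub, MvPolynomial.coeff_coe, MvPowerSeries.coeff_truncTotal _ hd, sub_self]

theorem substAlgHom_mem_baseFil {f : κ → MvPowerSeries σ k} (hf : MvPowerSeries.HasSubst f)
    (hf0 : ∀ l, MvPowerSeries.constantCoeff (f l) = 0) {N : ℕ} {a : MvPowerSeries κ k}
    (ha : a ∈ baseFil k κ N) : MvPowerSeries.substAlgHom (R := k) hf a ∈ baseFil k σ N := by
  rw [mem_baseFil, MvPowerSeries.substAlgHom_apply]
  refine le_trans ?_ (MvPowerSeries.le_order_subst hf a)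
  refine le_trans ha ?_
  conv_lhs => rw [← one_mul a.order]
  gcongr
  exact le_iInf fun l => MvPowerSeries.one_le_order_iff_constCoeff_eq_zero.mpr (hf0 l)

theorem constantCoeff_substAlgHom {f : κ → MvPowerSeries σ k} (hf : MvPowerSeries.HasSubst f)
    (hf0 : ∀ l, MvPowerSeries.constantCoeff (f l) = 0) (a : MvPowerSeries κ k) :
    MvPowerSeries.constantCoeff (MvPowerSeries.substAlgHom (R := k) hf a) =
      MvPowerSeries.constantCoeff a := by
  have h : a - MvPowerSeries.C (MvPowerSeries.constantCoeff a) ∈ baseFil k κ 1 := by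
    rw [mem_baseFil_one]; simp
  have := mem_baseFil_one.mp (substAlgHom_mem_baseFil hf hf0 h)
  rw [map_sub, map_sub, sub_eq_zero] at this
  rw [this, MvPowerSeries.substAlgHom_apply, MvPowerSeries.subst_C,
    MvPowerSeries.constantCoeff_C]

variable [Fintype κ]

/-- The chain rule. It holds for polynomials, and both sides are continuous for the order
filtration. -/
theorem pderiv_substAlgHom {f : κ → MvPowerSeries σ k} (hf : MvPowerSeries.HasSubst f)
    (hf0 : ∀ l, MvPowerSeries.constantCoeff (f l) = 0) (i : σ) (a : MvPowerSeries κ k) :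
    MvPowerSeries.pderiv k i (MvPowerSeries.substAlgHom (R := k) hf a) =
      ∑ l, MvPowerSeries.pderiv k i (f l) *
        MvPowerSeries.substAlgHom (R := k) hf (MvPowerSeries.pderiv k l a) := by
  classical
  set φ := MvPowerSeries.substAlgHom (R := k) hf with hφ
  have hX : ∀ l, φ (MvPowerSeries.X l) = f l := fun l => MvPowerSeries.substAlgHom_X hf l
  have hpoly : ∀ p : MvPolynomial κ k,
      MvPowerSeries.pderiv k i (φ (p : MvPowerSeries κ k)) =
      ∑ l, MvPowerSeries.pderiv k i (f l) *
        φ (MvPowerSeries.pderiv k l (p : MvPowerSeries κ k)) := by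
    intro p
    induction p using MvPolynomial.induction_on with
    | C c =>
      have hc : φ (MvPowerSeries.C c) = MvPowerSeries.C c := φ.commutes c
      simp [hc]
    | add p q hp hq =>
      simp only [MvPolynomial.coe_add, map_add, hp, hq, mul_add, Finset.sum_add_distrib]
    | mul_X p l hp =>
      simp only [MvPolynomial.coe_mul, MvPolynomial.coe_X, map_mul, Derivation.leibniz, hp, hX,
        smul_eq_mul, map_add, mul_add, Finset.sum_add_distrib, Finset.mul_sum]
      congr 1
      · rw [Finset.sum_eq_single l]
        · rw [MvPowerSeries.pderiv_X_self, map_one]; ring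
        · intro b _ hb
          rw [MvPowerSeries.pderiv_X_of_ne hb.symm, map_zero]; ring
        · simp
      · exact Finset.sum_congr rfl fun _ _ => by ring
  rw [← sub_eq_zero]
  refine completeFiltration_baseFil.sep _ fun N => ?_
  have hrem := sub_truncTotal_mem_baseFil a (N + 1)
  set p := MvPowerSeries.truncTotal (N + 1) a
  have ha : a = (a - (p : MvPowerSeries κ k)) + (p : MvPowerSeries κ k) := by ring
  have h1 : MvPowerSeries.pderiv k i (φ a) -
      ∑ l, MvPowerSeries.pderiv k i (f l) * φ (MvPowerSeries.pderiv k l a) =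
      MvPowerSeries.pderiv k i (φ (a - p)) -
      ∑ l, MvPowerSeries.pderiv k i (f l) * φ (MvPowerSeries.pderiv k l (a - p)) := by
    simp only [map_sub, hpoly p, mul_sub, Finset.sum_sub_distrib]
    ring
  rw [h1]
  refine sub_mem (pderiv_mem_baseFil (substAlgHom_mem_baseFil hf hf0 hrem) i) ?_
  exact Submodule.sum_mem _ fun l _ => Ideal.mul_mem_left _ _
    (substAlgHom_mem_baseFil hf hf0 (pderiv_mem_baseFil hrem l))

variable [CharZero k] [Fintype σ] [DecidableEq κ]

/-- Injectivity half of the inverse function theorem: by the chain rule the derivatives of a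
series in the kernel are again in the kernel, so that it vanishes to all orders. -/
theorem substAlgHom_injective {f : κ → MvPowerSeries σ k} (hf : MvPowerSeries.HasSubst f)
    (hf0 : ∀ l, MvPowerSeries.constantCoeff (f l) = 0) {G : Matrix σ κ (MvPowerSeries σ k)}
    (hG : (Matrix.of fun l s => MvPowerSeries.pderiv k s (f l)) * G = 1) :
    Function.Injective (MvPowerSeries.substAlgHom (R := k) hf) := by
  rw [injective_iff_map_eq_zero]
  intro g hg
  refine completeFiltration_baseFil.sep _ fun N => ?_
  induction N generalizing g with
  | zero => exact completeFiltration_baseFil.mem_zero _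
  | succ N ih =>
    have h0 := constantCoeff_substAlgHom hf hf0 g
    rw [hg, map_zero] at h0
    refine mem_baseFil_succ_of_pderiv h0.symm fun l => ih _ ?_
    have hv : Matrix.vecMul
        (fun l => MvPowerSeries.substAlgHom (R := k) hf (MvPowerSeries.pderiv k l g))
        (Matrix.of fun l s => MvPowerSeries.pderiv k s (f l)) = 0 := by
      ext1 s
      have := pderiv_substAlgHom hf hf0 s g
      rw [hg, map_zero] at this
      simp only [Matrix.vecMul, dotProduct, Matrix.of_apply, Pi.zero_apply]
      rw [this]
      exact Finset.sum_congr rfl fun _ _ => mul_comm _ _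
    have := congrArg (fun v => Matrix.vecMul v G) hv
    simp only [Matrix.vecMul_vecMul, hG, Matrix.vecMul_one, Matrix.zero_vecMul] at this
    exact congrFun this l

/-- Substitution of series `X_s + ⋯` is surjective, because it differs from the identity by a
map that raises the order. -/
theorem substAlgHom_surjective_of_unipotent [DecidableEq σ] {f : σ → MvPowerSeries σ k}
    (hf : MvPowerSeries.HasSubst f) (hf0 : ∀ l, MvPowerSeries.constantCoeff (f l) = 0)
    (hf1 : ∀ l s, MvPowerSeries.constantCoeff (MvPowerSeries.pderiv k s (f l)) =
      if s = l then 1 else 0) :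
    Function.Surjective (MvPowerSeries.substAlgHom (R := k) hf) := by
  have key : ∀ N g, g ∈ baseFil k σ N →
      MvPowerSeries.substAlgHom (R := k) hf g - g ∈ baseFil k σ (N + 1) := by
    intro N
    induction N with
    | zero =>
      intro g _
      rw [mem_baseFil_one, map_sub, constantCoeff_substAlgHom hf hf0, sub_self]
    | succ N ih =>
      intro g hg
      refine mem_baseFil_succ_of_pderiv ?_ fun s => ?_
      · rw [map_sub, constantCoeff_substAlgHom hf hf0, sub_self]
      · have h1 : MvPowerSeries.pderiv k s (MvPowerSeries.substAlgHom (R := k) hf g - g) =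
            (MvPowerSeries.substAlgHom (R := k) hf (MvPowerSeries.pderiv k s g) -
              MvPowerSeries.pderiv k s g) +
            ∑ l, (MvPowerSeries.pderiv k s (f l) - if s = l then 1 else 0) *
              MvPowerSeries.substAlgHom (R := k) hf (MvPowerSeries.pderiv k l g) := by
          rw [map_sub, pderiv_substAlgHom hf hf0]
          simp only [sub_mul, Finset.sum_sub_distrib, ite_mul, one_mul, zero_mul,
            Finset.sum_ite_eq, Finset.mem_univ, if_true]
          ring
        rw [h1]
        refine add_mem (ih _ (pderiv_mem_baseFil hg s)) (Submodule.sum_mem _ fun l _ => ?_)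
        rw [add_comm N 1]
        refine mul_mem_baseFil ?_
          (substAlgHom_mem_baseFil hf hf0 (pderiv_mem_baseFil hg l))
        rw [mem_baseFil_one, map_sub, hf1]
        split_ifs <;> simp
  intro y
  obtain ⟨g, hg⟩ := completeFiltration_baseFil.exists_fixedPoint
    (fun g => y - (MvPowerSeries.substAlgHom (R := k) hf g - g)) (fun N a b hab => by
      have := Submodule.neg_mem _ (key N _ hab)
      rw [map_sub] at this
      convert this using 1
      ring)
  refine ⟨g, ?_⟩
  linear_combination -hg

/-- The formal inverse function theorem: substituting series with invertible linear part is a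
bijection. -/
theorem substAlgHom_bijective [DecidableEq σ] {f : κ → MvPowerSeries σ k}
    (hf : MvPowerSeries.HasSubst f)
    (hf0 : ∀ l, MvPowerSeries.constantCoeff (f l) = 0) {G : Matrix σ κ (MvPowerSeries σ k)}
    (hG : (Matrix.of fun l s => MvPowerSeries.pderiv k s (f l)) * G = 1)
    (hG' : G * (Matrix.of fun l s => MvPowerSeries.pderiv k s (f l)) = 1) :
    Function.Bijective (MvPowerSeries.substAlgHom (R := k) hf) := by
  refine ⟨substAlgHom_injective hf hf0 hG, ?_⟩
  -- the linear change of coordinates that makes the linear part of `f` the identity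
  let a : σ → MvPowerSeries κ k := fun s =>
    ∑ l, MvPowerSeries.C (MvPowerSeries.constantCoeff (G s l)) * MvPowerSeries.X l
  have ha0 : ∀ s, MvPowerSeries.constantCoeff (a s) = 0 := by
    intro s; simp [a]
  have ha := MvPowerSeries.hasSubst_of_constantCoeff_zero ha0
  have hC : ∀ c, MvPowerSeries.substAlgHom (R := k) hf (MvPowerSeries.C c) =
    MvPowerSeries.C c := fun c => (MvPowerSeries.substAlgHom (R := k) hf).commutes c
  have hfa : ∀ s, MvPowerSeries.substAlgHom (R := k) hf (a s) =
      ∑ l, MvPowerSeries.C (MvPowerSeries.constantCoeff (G s l)) * f l := by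
    intro s
    simp only [a, map_sum, map_mul, hC, MvPowerSeries.substAlgHom_X]
  have hsurj := substAlgHom_surjective_of_unipotent (ha.comp hf) (fun s => by
      rw [hfa]; simp [hf0]) (fun s t => by
      have := congrArg MvPowerSeries.constantCoeff (congrFun (congrFun hG' s) t)
      simp only [Matrix.mul_apply, Matrix.of_apply, map_sum, map_mul] at this
      rw [hfa]
      simp only [map_sum, Derivation.leibniz, MvPowerSeries.pderiv_C, smul_eq_mul, mul_zero,
        add_zero, map_mul, MvPowerSeries.constantCoeff_C, this, Matrix.one_apply, eq_comm (a := t)]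
      split_ifs <;> simp)
  intro y
  obtain ⟨g, hg⟩ := hsurj y
  refine ⟨MvPowerSeries.substAlgHom (R := k) ha g, ?_⟩
  rw [MvPowerSeries.substAlgHom_comp_substAlgHom_apply, hg]

end InverseFunction

/-! ### Functions pulled back from a factor -/

section Descent

variable {k : Type u} [Field k] {σ τ : Type*}

theorem mem_range_rename_of_pderiv [CharZero k] (e : τ ↪ σ) (f : MvPowerSeries σ k)
    (h : ∀ s ∉ Set.range e, MvPowerSeries.pderiv k s f = 0) :
    ∃ g, MvPowerSeries.rename e g = f := by
  classical
  refine ⟨MvPowerSeries.killCompl e f, ?_⟩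
  ext x
  by_cases hx : x ∈ Set.range (Finsupp.mapDomain (M := ℕ) e)
  · obtain ⟨y, rfl⟩ := hx
    rw [← Finsupp.embDomain_eq_mapDomain, MvPowerSeries.coeff_embDomain_rename,
      MvPowerSeries.coeff_killCompl]
  · rw [MvPowerSeries.coeff_rename_eq_zero _ _ hx]
    -- the exponent `x` involves a coordinate outside the image of `e`
    have : ∃ s ∉ Set.range e, x s ≠ 0 := by
      by_contra! hcon
      apply hx
      refine ⟨Finsupp.comapDomain e x e.injective.injOn, ?_⟩
      rw [Finsupp.mapDomain_comapDomain _ e.injective]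
      intro s hs
      by_contra hs'
      exact (Finsupp.mem_support_iff.mp hs) (hcon s hs')
    obtain ⟨s, hs, hxs⟩ := this
    have h1 := congrArg (MvPowerSeries.coeff (x - Finsupp.single s 1)) (h s hs)
    have hle : Finsupp.single s 1 ≤ x := by
      rw [Finsupp.single_le_iff]; exact Nat.one_le_iff_ne_zero.mpr hxs
    rw [MvPowerSeries.coeff_pderiv, tsub_add_cancel_of_le hle, map_zero] at h1
    exact ((mul_eq_zero.mp h1).resolve_right (Nat.cast_add_one_ne_zero _)).symm

theorem mem_range_projHom_of_ddt [CharZero k] (e : τ ↪ σ) (f : TotalRing k σ)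
    (h : ∀ s ∉ Set.range e, ddt k s f = 0) : ∃ g, projHom k e g = f := by
  choose g hg using fun n => mem_range_rename_of_pderiv e (PowerSeries.coeff n f) fun s hs => by
    rw [← coeff_ddt, h s hs, map_zero]
  refine ⟨PowerSeries.mk g, ?_⟩
  ext1 n
  simp [projHom, hg]

theorem projHom_injective (e : τ ↪ σ) : Function.Injective (projHom k e) :=
  PowerSeries.map_injective _ (MvPowerSeries.rename_injective e)

theorem evalOrigin_eq (f : TotalRing k σ) :
    evalOrigin k σ f = MvPowerSeries.constantCoeff (PowerSeries.coeff 0 f) := by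
  rw [PowerSeries.coeff_zero_eq_constantCoeff_apply]
  rfl

theorem evalOrigin_projHom (e : τ ↪ σ) (f : TotalRing k τ) :
    evalOrigin k σ (projHom k e f) = evalOrigin k τ f := by
  rw [evalOrigin_eq, evalOrigin_eq, projHom, PowerSeries.coeff_map]
  exact MvPowerSeries.constantCoeff_rename (f := e) (PowerSeries.coeff 0 f)

end Descent

/-! ### Vector fields on the base and the formal Frobenius theorem -/

section Frobenius

variable {k : Type u} [Field k] {σ κ : Type*} [Fintype σ]

/-- The vector field `∑ p_s ∂_{t_s}` on `B` with coefficients `p`. -/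
noncomputable def vectorField (p : σ → MvPowerSeries σ k) :
    Derivation k (MvPowerSeries σ k) (MvPowerSeries σ k) :=
  ∑ s, p s • MvPowerSeries.pderiv k s

theorem vectorField_apply (p : σ → MvPowerSeries σ k) (f : MvPowerSeries σ k) :
    vectorField p f = ∑ s, p s * MvPowerSeries.pderiv k s f := by
  have h : ∀ S : Finset σ, (∑ s ∈ S, p s • MvPowerSeries.pderiv k s) f =
      ∑ s ∈ S, p s * MvPowerSeries.pderiv k s f := by
    intro S
    classical
    induction S using Finset.induction_on with
    | empty => simp
    | insert a S ha ih =>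
      rw [Finset.sum_insert ha, Finset.sum_insert ha, Derivation.add_apply, ih,
        Derivation.smul_apply, smul_eq_mul]
  exact h _

theorem vectorField_sum_mul {J : Type*} [Fintype J] (c : J → MvPowerSeries σ k)
    (p : J → σ → MvPowerSeries σ k) (f : MvPowerSeries σ k) :
    vectorField (fun s => ∑ j, c j * p j s) f = ∑ j, c j * vectorField (p j) f := by
  simp only [vectorField_apply, Finset.sum_mul, Finset.mul_sum]
  rw [Finset.sum_comm]
  simp only [mul_assoc]

theorem vectorField_mem_baseFil (p : σ → MvPowerSeries σ k) {N : ℕ} {f : MvPowerSeries σ k}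
    (hf : f ∈ baseFil k σ (N + 1)) : vectorField p f ∈ baseFil k σ N := by
  rw [vectorField_apply]
  exact Submodule.sum_mem _ fun s _ => Ideal.mul_mem_left _ _ (pderiv_mem_baseFil hf s)

/-- The coefficients of the Lie bracket of two vector fields. -/
noncomputable def bracket (p q : σ → MvPowerSeries σ k) : σ → MvPowerSeries σ k :=
  fun s => vectorField p (q s) - vectorField q (p s)

theorem vectorField_bracket (p q : σ → MvPowerSeries σ k) (f : MvPowerSeries σ k) :
    vectorField (bracket p q) f =
      vectorField p (vectorField q f) - vectorField q (vectorField p f) := by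
  have h : ∀ p q : σ → MvPowerSeries σ k, vectorField p (vectorField q f) =
      ∑ s, vectorField p (q s) * MvPowerSeries.pderiv k s f +
      ∑ t, ∑ s, q t * p s * MvPowerSeries.pderiv k s (MvPowerSeries.pderiv k t f) := by
    intro p q
    rw [vectorField_apply q f, map_sum, ← Finset.sum_add_distrib]
    refine Finset.sum_congr rfl fun t _ => ?_
    rw [Derivation.leibniz, smul_eq_mul, smul_eq_mul,
      vectorField_apply p (MvPowerSeries.pderiv k t f), Finset.mul_sum, add_comm,
      mul_comm (MvPowerSeries.pderiv k t f)]
    simp only [mul_assoc]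
  rw [h, h, Finset.sum_comm (f := fun t s => q t * p s * _), add_sub_add_comm, vectorField_apply]
  simp only [bracket, sub_mul, Finset.sum_sub_distrib]
  refine (add_eq_left.mpr (sub_eq_zero.mpr ?_)).symm
  refine Finset.sum_congr rfl fun s _ => Finset.sum_congr rfl fun t _ => ?_
  rw [pderiv_comm, mul_comm (q t)]

/-- The linear function on `B` whose differential is the value at the origin of the 1-form
`∑ ω_s dt_s`. -/
noncomputable def linearPart (ω : σ → MvPowerSeries σ k) : MvPowerSeries σ k :=
  ∑ s, MvPowerSeries.C (MvPowerSeries.constantCoeff (ω s)) * MvPowerSeries.X s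

theorem constantCoeff_linearPart (ω : σ → MvPowerSeries σ k) :
    MvPowerSeries.constantCoeff (linearPart ω) = 0 := by
  simp [linearPart]

theorem pderiv_linearPart (ω : σ → MvPowerSeries σ k) (t : σ) :
    MvPowerSeries.pderiv k t (linearPart ω) =
      MvPowerSeries.C (MvPowerSeries.constantCoeff (ω t)) := by
  classical
  simp only [linearPart, map_sum, Derivation.leibniz, MvPowerSeries.pderiv_C, smul_eq_mul,
    mul_zero, add_zero]
  rw [Finset.sum_eq_single t]
  · rw [MvPowerSeries.pderiv_X_self, mul_one]
  · intro s _ hs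
    rw [MvPowerSeries.pderiv_X_of_ne hs, mul_zero]
  · simp

theorem constantCoeff_vectorField_linearPart (p ω : σ → MvPowerSeries σ k) :
    MvPowerSeries.constantCoeff (vectorField p (linearPart ω)) =
      MvPowerSeries.constantCoeff (∑ s, ω s * p s) := by
  simp only [vectorField_apply, pderiv_linearPart, map_sum, map_mul, MvPowerSeries.constantCoeff_C,
    mul_comm]

/-- The formal Frobenius theorem. The rows of `E` are a coframe on `B`, with dual frame the
columns of `g`; if the distribution annihilated by the forms `E α`, for `α` in `P`, is involutive,
then each such form agrees at the origin with the differential of a first integral.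

In terms of the linear functions `τ` with `dτ = E` at the origin, the distribution has a frame of
fields `d β`, for `β` outside `P`, with `d β (τ γ) = δ`; these commute, and the first integrals
are the flat sections obtained from the `τ α`. -/
theorem exists_first_integral [CharZero k] [Fintype κ] [DecidableEq κ] [DecidableEq σ]
    {E : Matrix κ σ (MvPowerSeries σ k)} {g : Matrix σ κ (MvPowerSeries σ k)} (hEg : E * g = 1)
    (hgE : g * E = 1) (P : κ → Prop)
    (hV : ∀ p q, (∀ α, P α → E.mulVec p α = 0) → (∀ α, P α → E.mulVec q α = 0) →
      ∀ α, P α → E.mulVec (bracket p q) α = 0) {α : κ} (hα : P α) :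
    ∃ f : MvPowerSeries σ k, MvPowerSeries.constantCoeff f = 0 ∧
      (∀ s, MvPowerSeries.constantCoeff (MvPowerSeries.pderiv k s f) =
        MvPowerSeries.constantCoeff (E α s)) ∧
      ∀ p, (∀ β, P β → E.mulVec p β = 0) → vectorField p f = 0 := by
  classical
  let J := {β : κ // ¬ P β}
  -- `ξ` is the dual frame, and `Q` the matrix of the derivatives of the `τ γ` along the `ξ β`, for
  -- indices outside `P`
  let τ : κ → MvPowerSeries σ k := fun β => linearPart (E β)
  let ξ : κ → σ → MvPowerSeries σ k := fun β s => g s β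
  have hEξ : ∀ β γ, ∑ s, E β s * ξ γ s = if β = γ then 1 else 0 := by
    intro β γ
    have := congrFun (congrFun hEg β) γ
    rwa [Matrix.mul_apply, Matrix.one_apply] at this
  have hξτ : ∀ β γ, MvPowerSeries.constantCoeff (vectorField (ξ β) (τ γ)) =
      if γ = β then 1 else 0 := by
    intro β γ
    rw [constantCoeff_vectorField_linearPart, hEξ]
    split_ifs <;> simp
  let Q : Matrix J J (MvPowerSeries σ k) := Matrix.of fun β γ => vectorField (ξ β) (τ γ)
  have hQ : IsUnit Q := by
    apply isUnit_of_map_eq_one MvPowerSeries.constantCoeff isUnit_of_isUnit_constantCoeff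
    ext β γ
    simp only [RingHom.mapMatrix_apply, Matrix.map_apply, Q, Matrix.of_apply, hξτ,
      Matrix.one_apply]
    exact if_congr (by rw [eq_comm, Subtype.ext_iff]) rfl rfl
  obtain ⟨Q', hQ'⟩ := hQ.exists_left_inv
  have hQ'' : Q * Q' = 1 := mul_eq_one_comm.mp hQ'
  let d : J → σ → MvPowerSeries σ k := fun β s => ∑ γ, Q' β γ * ξ γ s
  have hd : ∀ β f, vectorField (d β) f = ∑ γ, Q' β γ * vectorField (ξ γ) f := fun β f =>
    vectorField_sum_mul _ _ _
  have hdτ : ∀ β γ : J, vectorField (d β) (τ γ) = if β = γ then 1 else 0 := by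
    intro β γ
    rw [hd, ← Matrix.one_apply, ← hQ', Matrix.mul_apply]
    rfl
  have hdV : ∀ (β : J) α, P α → E.mulVec (d β) α = 0 := by
    intro β α hα
    simp only [Matrix.mulVec, dotProduct, d, Finset.mul_sum]
    rw [Finset.sum_comm]
    refine Finset.sum_eq_zero fun γ _ => ?_
    have := hEξ α γ
    rw [if_neg (fun h : α = γ => γ.2 (h ▸ hα))] at this
    rw [← mul_zero (Q' β γ), ← this, Finset.mul_sum]
    exact Finset.sum_congr rfl fun _ _ => by ring
  have hexp : ∀ p, (∀ α, P α → E.mulVec p α = 0) → ∀ f,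
      vectorField p f = ∑ γ : J, E.mulVec p γ * vectorField (ξ γ) f := by
    intro p hp f
    have h1 : p = fun s => ∑ γ, E.mulVec p γ * ξ γ s := by
      ext1 s
      have : g.mulVec (E.mulVec p) s = p s := by
        rw [Matrix.mulVec_mulVec, hgE, Matrix.one_mulVec]
      rw [← this]
      simp only [Matrix.mulVec, dotProduct, ξ, mul_comm]
    conv_lhs => rw [h1]
    rw [vectorField_sum_mul, ← Fintype.sum_subtype_add_sum_subtype P, Finset.sum_eq_zero, zero_add]
    intro γ _
    rw [hp γ γ.2, zero_mul]
  -- a field in the distribution is determined by the derivatives of the `τ γ`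
  have hzero : ∀ p, (∀ α, P α → E.mulVec p α = 0) → (∀ γ : J, vectorField p (τ γ) = 0) → ∀ f,
      vectorField p f = 0 := by
    intro p hp hpτ f
    have h1 : Matrix.vecMul (fun γ : J => E.mulVec p γ) Q = 0 := by
      ext1 γ
      rw [Pi.zero_apply, ← hpτ γ, hexp p hp]
      rfl
    have h2 := congrArg (fun v => Matrix.vecMul v Q') h1
    simp only [Matrix.vecMul_vecMul, hQ'', Matrix.vecMul_one, Matrix.zero_vecMul] at h2
    rw [hexp p hp]
    exact Finset.sum_eq_zero fun γ _ => by rw [show E.mulVec p γ = 0 from congrFun h2 γ, zero_mul]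
  -- the bracket lies in the distribution and kills the `τ γ`, on which the `d β` are constant
  have hcomm : ∀ β γ f, vectorField (d β) (vectorField (d γ) f) =
      vectorField (d γ) (vectorField (d β) f) := by
    intro β γ f
    rw [← sub_eq_zero, ← vectorField_bracket]
    refine hzero _ (hV _ _ (hdV β) (hdV γ)) (fun ε => ?_) f
    rw [vectorField_bracket, hdτ, hdτ]
    split_ifs <;> simp
  have hτ1 : ∀ γ, τ γ ∈ baseFil k σ 1 := fun γ => mem_baseFil_one.mpr (constantCoeff_linearPart _)
  obtain ⟨f, hf, hfτ⟩ := (completeFiltration_baseFil (k := k) (σ := σ)).exists_flat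
    (k := k) (D := fun β : J => vectorField (d β))
    (T := fun β : J => (vectorField (d β)).toLinearMap.toAddMonoidHom)
    (fun β f s => by
      change vectorField (d β) (f * s) = vectorField (d β) f * s + f * vectorField (d β) s
      rw [Derivation.leibniz, smul_eq_mul, smul_eq_mul]
      ring)
    (fun β N x hx => vectorField_mem_baseFil _ hx) (y := fun β : J => τ β) hdτ
    (fun β N x hx => by
      rw [add_comm, smul_eq_mul]
      exact mul_mem_baseFil (hτ1 β) hx)
    (fun β γ x => hcomm β γ x) (τ α) (r := 1) (fun β => by
      change vectorField (d β) (τ α) ∈ _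
      rw [mem_baseFil_one, hd, map_sum]
      refine Finset.sum_eq_zero fun γ _ => ?_
      rw [map_mul, hξτ, if_neg (fun h : α = γ => γ.2 (h ▸ hα)), mul_zero]) Finset.univ
  refine ⟨f, ?_, fun s => ?_, fun p hp => ?_⟩
  · have := mem_baseFil_one.mp (completeFiltration_baseFil.anti one_le_two hfτ)
    rwa [map_sub, constantCoeff_linearPart, sub_zero] at this
  · have := mem_baseFil_one.mp (pderiv_mem_baseFil hfτ s)
    rwa [map_sub, map_sub, pderiv_linearPart, MvPowerSeries.constantCoeff_C, sub_eq_zero] at this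
  · -- subtracting a combination of the `d β` from `p` gives a field that kills all the `τ β`
    let p' : σ → MvPowerSeries σ k := fun s => p s - ∑ β : J, vectorField p (τ β) * d β s
    have hp' : ∀ f, vectorField p' f =
        vectorField p f - ∑ β : J, vectorField p (τ β) * vectorField (d β) f := by
      intro f
      rw [← vectorField_sum_mul]
      simp only [vectorField_apply, p', sub_mul, Finset.sum_sub_distrib]
    have h1 := hzero p' (fun α hα => by
      have h2 : E.mulVec p' α =
          E.mulVec p α - ∑ β : J, vectorField p (τ β) * E.mulVec (d β) α := by
        simp only [Matrix.mulVec, dotProduct, p', mul_sub, Finset.sum_sub_distrib, Finset.mul_sum]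
        rw [Finset.sum_comm (γ := J)]
        simp only [mul_left_comm]
      rw [h2, hp α hα, zero_sub, neg_eq_zero]
      exact Finset.sum_eq_zero fun β _ => by rw [hdV β α hα, mul_zero]) (fun γ => by
      rw [hp', Finset.sum_eq_single γ, hdτ, if_pos rfl, mul_one, sub_self]
      · intro β _ hβ
        rw [hdτ, if_neg hβ, mul_zero]
      · simp) f
    rw [hp', sub_eq_zero] at h1
    rw [h1]
    refine Finset.sum_eq_zero fun β _ => ?_
    rw [show vectorField (d β) f = 0 from hf β (Finset.mem_univ _), mul_zero]

end Frobenius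

/-! ### The Sylvester operator -/

section Sylvester

/-- Sylvester's theorem: matrices with coprime characteristic polynomials have no nonzero
intertwiner. -/
theorem eq_zero_of_mul_eq_mul_of_isCoprime {k : Type*} [Field k] {m n : Type*} [Fintype m]
    [Fintype n] [DecidableEq m] [DecidableEq n] {A : Matrix m m k} {B : Matrix n n k}
    (h : IsCoprime A.charpoly B.charpoly) {X : Matrix m n k} (hX : A * X = X * B) : X = 0 := by
  have hpow : ∀ p : Polynomial k, Polynomial.aeval A p * X = X * Polynomial.aeval B p := by
    intro p
    induction p using Polynomial.induction_on' with
    | add p q hp hq => rw [map_add, map_add, Matrix.add_mul, Matrix.mul_add, hp, hq]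
    | monomial j c =>
      have hj : A ^ j * X = X * B ^ j := by
        induction j with
        | zero => simp
        | succ j ih => rw [pow_succ, pow_succ, Matrix.mul_assoc, hX, ← Matrix.mul_assoc, ih,
            Matrix.mul_assoc]
      rw [Polynomial.aeval_monomial, Polynomial.aeval_monomial, ← Algebra.smul_def,
        ← Algebra.smul_def, Matrix.smul_mul, Matrix.mul_smul, hj]
  obtain ⟨a, b, hab⟩ := h
  have h1 := hpow (a * A.charpoly + b * B.charpoly)
  have h2 : Polynomial.aeval A (b * B.charpoly) * X = 0 := by
    rw [hpow, map_mul, Matrix.aeval_self_charpoly, mul_zero, Matrix.mul_zero]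
  rw [map_add, Matrix.add_mul, h2, add_zero, map_mul, Matrix.aeval_self_charpoly, mul_zero,
    Matrix.zero_mul, hab, map_one, Matrix.mul_one] at h1
  exact h1.symm

variable {ι κ : Type*} [DecidableEq ι] [Fintype κ]

/-- The operator `X ↦ U X - X U` on the part of a matrix outside the diagonal blocks, extended by
the identity on the diagonal blocks; the block of an index is given by `blk`. -/
noncomputable def blockSylvester {A : Type*} [CommRing A] (blk : κ → ι) (U : Matrix κ κ A) :
    Matrix κ κ A →ₗ[A] Matrix κ κ A where
  toFun X := Matrix.of fun α β => if blk α = blk β then X α β else (U * X - X * U) α β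
  map_add' X Y := by
    ext α β
    simp only [Matrix.of_apply, Matrix.add_apply, Matrix.mul_add, Matrix.add_mul, Matrix.sub_apply]
    split_ifs
    · rfl
    · ring
  map_smul' c X := by
    ext α β
    simp only [Matrix.of_apply, Matrix.smul_apply, Matrix.mul_smul, Matrix.smul_mul,
      Matrix.sub_apply, RingHom.id_apply, smul_eq_mul]
    split_ifs
    · rfl
    · ring

theorem blockSylvester_of_eq {A : Type*} [CommRing A] {blk : κ → ι} {U X : Matrix κ κ A} {α β : κ}
    (h : blk α = blk β) : blockSylvester blk U X α β = X α β :=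
  if_pos h

theorem blockSylvester_of_ne {A : Type*} [CommRing A] {blk : κ → ι} {U X : Matrix κ κ A} {α β : κ}
    (h : blk α ≠ blk β) : blockSylvester blk U X α β = (U * X - X * U) α β :=
  if_neg h

/-- An endomorphism of a free module that is injective at the closed point is bijective. -/
theorem bijective_of_injective_map {k A J : Type*} [Field k] [CommRing A] [Fintype J]
    [DecidableEq J] (π : A →+* k) (hπ : ∀ a, IsUnit (π a) → IsUnit a) (S : (J → A) →ₗ[A] (J → A))
    (S₀ : (J → k) →ₗ[k] (J → k)) (hS : ∀ x j, π (S x j) = S₀ (fun i => π (x i)) j)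
    (hinj : Function.Injective S₀) : Function.Bijective S := by
  have hmap : π.mapMatrix (LinearMap.toMatrix' S) = LinearMap.toMatrix' S₀ := by
    ext i j
    simp only [RingHom.mapMatrix_apply, Matrix.map_apply, LinearMap.toMatrix'_apply, hS]
    have h1 : (fun l => π ((Pi.single j 1 : J → A) l)) = Pi.single j 1 := by
      ext1 l
      by_cases h : l = j
      · subst h; simp
      · simp [h]
    rw [h1]
  rw [← Module.End.isUnit_iff, LinearMap.isUnit_iff_isUnit_det]
  apply hπ
  rw [← LinearMap.det_toMatrix', RingHom.map_det, hmap, LinearMap.det_toMatrix']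
  exact LinearEquiv.isUnit_det' (LinearEquiv.ofInjectiveEndo S₀ hinj)

/-- The Sylvester operator of a block diagonal matrix is bijective if at the closed point there
is no nonzero intertwiner between different blocks. -/
theorem blockSylvester_bijective {k A : Type*} [Field k] [CommRing A] [DecidableEq κ]
    (π : A →+* k) (hπ : ∀ a, IsUnit (π a) → IsUnit a) {blk : κ → ι} {U : Matrix κ κ A}
    (hU : ∀ X : Matrix κ κ k, (∀ α β, blk α = blk β → X α β = 0) →
      (∀ α β, blk α ≠ blk β → (π.mapMatrix U * X) α β = (X * π.mapMatrix U) α β) → X = 0) :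
    Function.Bijective (blockSylvester blk U) := by
  -- matrices as columns, to which `bijective_of_injective_map` applies
  let c : (κ × κ → A) ≃ₗ[A] Matrix κ κ A :=
    (LinearEquiv.curry A A κ κ).trans (Matrix.ofLinearEquiv A)
  let c₀ : (κ × κ → k) ≃ₗ[k] Matrix κ κ k :=
    (LinearEquiv.curry k k κ κ).trans (Matrix.ofLinearEquiv k)
  have h0 : Function.Injective (blockSylvester blk (π.mapMatrix U)) := by
    rw [injective_iff_map_eq_zero]
    intro X hX
    refine hU X (fun α β h => ?_) (fun α β h => ?_)
    · have := blockSylvester_of_eq (U := π.mapMatrix U) (X := X) h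
      rw [← this, hX, Matrix.zero_apply]
    · have := blockSylvester_of_ne (U := π.mapMatrix U) (X := X) h
      rw [← sub_eq_zero, ← Matrix.sub_apply, ← this, hX, Matrix.zero_apply]
  have hnat : ∀ X : Matrix κ κ A, π.mapMatrix (blockSylvester blk U X) =
      blockSylvester blk (π.mapMatrix U) (π.mapMatrix X) := by
    intro X
    ext α β
    by_cases h : blk α = blk β
    · simp only [RingHom.mapMatrix_apply, Matrix.map_apply, blockSylvester_of_eq h]
    · rw [blockSylvester_of_ne h, ← map_mul, ← map_mul, ← map_sub]
      simp only [RingHom.mapMatrix_apply, Matrix.map_apply, blockSylvester_of_ne h]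
  have h1 := bijective_of_injective_map π hπ
    (c.symm.toLinearMap ∘ₗ blockSylvester blk U ∘ₗ c.toLinearMap)
    (c₀.symm.toLinearMap ∘ₗ blockSylvester blk (π.mapMatrix U) ∘ₗ c₀.toLinearMap)
    (fun x j => congrFun (congrFun (hnat (c x)) j.1) j.2)
    (c₀.symm.injective.comp (h0.comp c₀.injective))
  have h2 : ⇑(blockSylvester blk U) = c ∘ (c.symm.toLinearMap ∘ₗ blockSylvester blk U ∘ₗ
      c.toLinearMap) ∘ c.symm := by
    ext1 X
    simp
  rw [h2]
  exact c.bijective.comp (h1.comp c.symm.bijective)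

end Sylvester

/-! ### Splitting off the blocks of a connection -/

section BlockDiagonal

variable {k : Type u} [Field k] {σ : Type w} {ι κ : Type*} [Fintype κ]

/-- The filtration of matrices by the total order of their entries. -/
noncomputable def matFil (k : Type u) [Field k] (σ : Type w) (κ : Type*) (N : ℕ) :
    Submodule (TotalRing k σ) (Matrix κ κ (TotalRing k σ)) where
  carrier := {M | ∀ α β, M α β ∈ totFil k σ N}
  add_mem' hM hN α β := add_mem (hM α β) (hN α β)
  zero_mem' _ _ := zero_mem _
  smul_mem' c _ hM α β := Ideal.mul_mem_left _ c (hM α β)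

theorem mem_matFil {κ : Type*} {N : ℕ} {M : Matrix κ κ (TotalRing k σ)} :
    M ∈ matFil k σ κ N ↔ ∀ α β, M α β ∈ totFil k σ N :=
  Iff.rfl

theorem completeFiltration_matFil {κ : Type*} : CompleteFiltration (matFil k σ κ) where
  zero := by
    ext M
    simp only [Submodule.mem_top, iff_true]
    exact fun α β => completeFiltration_totFil.mem_zero _
  anti m n h M hM α β := completeFiltration_totFil.anti h (hM α β)
  sep M h := by
    ext1 α β
    exact completeFiltration_totFil.sep _ fun N => h N α β
  complete s h := by
    choose L hL using fun α β => completeFiltration_totFil.complete (fun N => s N α β)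
      fun N => h N α β
    exact ⟨Matrix.of L, fun N α β => hL α β N⟩

theorem mul_mem_matFil {a b : ℕ} {M N : Matrix κ κ (TotalRing k σ)} (hM : M ∈ matFil k σ κ a)
    (hN : N ∈ matFil k σ κ b) : M * N ∈ matFil k σ κ (a + b) := by
  rw [mem_matFil] at *
  intro α β
  rw [Matrix.mul_apply]
  exact Submodule.sum_mem _ fun γ _ => mul_mem_totFil (hM α γ) (hN γ β)

/-- Linear maps between matrices over the ring of functions preserve the filtration. -/
theorem map_mem_matFil [DecidableEq κ]
    (L : Matrix κ κ (TotalRing k σ) →ₗ[TotalRing k σ] Matrix κ κ (TotalRing k σ)) {N : ℕ}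
    {M : Matrix κ κ (TotalRing k σ)} (hM : M ∈ matFil k σ κ N) : L M ∈ matFil k σ κ N := by
  rw [Matrix.matrix_eq_sum_single M, map_sum]
  refine Submodule.sum_mem _ fun α _ => ?_
  rw [map_sum]
  refine Submodule.sum_mem _ fun β _ => ?_
  have h : Matrix.single α β (M α β) = M α β • Matrix.single α β (1 : TotalRing k σ) := by
    rw [Matrix.smul_single, smul_eq_mul, mul_one]
  rw [h, map_smul, mem_matFil]
  intro γ δ
  exact Ideal.mul_mem_right _ _ (mem_matFil.mp hM α β)

variable [DecidableEq ι] [DecidableEq κ]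

/-- A connection matrix in the direction `u² ∂_u` that is block diagonal at the origin, with no
nonzero intertwiners between different blocks there, is block diagonal in a suitable frame: there
are a gauge transformation `1 + x`, with `x` zero at the origin, and a block
diagonal matrix `V` with `u² ∂_u x + U (1 + x) = (1 + x) V`.

With `U = U_d + U_o` split into block diagonal and off-diagonal parts, the equation for an
off-diagonal `x` reads
`[U_d, x] = -(U_o + u² ∂_u x + (U_o x)_o - x (U_o x)_d)`; inverting the left-hand side, it becomes
a fixed point equation for a contraction. -/
theorem exists_blockDiag_gauge {blk : κ → ι} {U : Matrix κ κ (TotalRing k σ)}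
    (hU0 : ∀ α β, blk α ≠ blk β → evalOrigin k σ (U α β) = 0)
    (hU : ∀ X : Matrix κ κ k, (∀ α β, blk α = blk β → X α β = 0) →
      (∀ α β, blk α ≠ blk β → ((evalOrigin k σ).mapMatrix U * X) α β =
        (X * (evalOrigin k σ).mapMatrix U) α β) → X = 0) :
    ∃ x V : Matrix κ κ (TotalRing k σ), x ∈ matFil k σ κ 1 ∧
      (∀ α β, blk α ≠ blk β → V α β = 0) ∧
      (evalOrigin k σ).mapMatrix V = (evalOrigin k σ).mapMatrix U ∧
      x.map (fun f => uVar k σ ^ 2 * ddu k σ f) + U * (1 + x) = (1 + x) * V := by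
  -- the block diagonal and the off-diagonal part of a matrix
  let dg : Matrix κ κ (TotalRing k σ) → Matrix κ κ (TotalRing k σ) :=
    fun M => Matrix.of fun α β => if blk α = blk β then M α β else 0
  let od : Matrix κ κ (TotalRing k σ) → Matrix κ κ (TotalRing k σ) :=
    fun M => Matrix.of fun α β => if blk α = blk β then 0 else M α β
  have dg_eq : ∀ M {α β}, blk α = blk β → dg M α β = M α β := fun M {α β} h => if_pos h
  have dg_ne : ∀ M {α β}, blk α ≠ blk β → dg M α β = 0 := fun M {α β} h => if_neg h
  have od_eq : ∀ M {α β}, blk α = blk β → od M α β = 0 := fun M {α β} h => if_pos h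
  have od_ne : ∀ M {α β}, blk α ≠ blk β → od M α β = M α β := fun M {α β} h => if_neg h
  have dg_sub : ∀ M N, dg (M - N) = dg M - dg N := by
    intro M N; ext1 α β; by_cases h : blk α = blk β <;> simp [dg, h]
  have dg_mem : ∀ {N M}, M ∈ matFil k σ κ N → dg M ∈ matFil k σ κ N := by
    intro N M hM
    rw [mem_matFil] at *
    intro α β
    by_cases h : blk α = blk β
    · rw [dg_eq M h]; exact hM α β
    · rw [dg_ne M h]; exact zero_mem _
  let D : Matrix κ κ (TotalRing k σ) → Matrix κ κ (TotalRing k σ) :=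
    fun M => M.map (fun f => uVar k σ ^ 2 * ddu k σ f)
  have D_sub : ∀ M N, D (M - N) = D M - D N := by
    intro M N; ext1 α β
    simp [D, mul_sub]
  have D_mem : ∀ {N M}, M ∈ matFil k σ κ N → D M ∈ matFil k σ κ (N + 1) := fun {N M} hM =>
    mem_matFil.mpr fun α β => sq_mul_ddu_mem_totFil (mem_matFil.mp hM α β)
  have hUo : od U ∈ matFil k σ κ 1 := by
    rw [mem_matFil]
    intro α β
    by_cases h : blk α = blk β
    · rw [od_eq U h]; exact zero_mem _
    · rw [od_ne U h, mem_totFil_one]; exact hU0 α β h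
  have hmapd : (evalOrigin k σ).mapMatrix (dg U) = (evalOrigin k σ).mapMatrix U := by
    ext α β
    by_cases h : blk α = blk β
    · simp only [RingHom.mapMatrix_apply, Matrix.map_apply, dg_eq U h]
    · simp only [RingHom.mapMatrix_apply, Matrix.map_apply, dg_ne U h, hU0 α β h, map_zero]
  let S := LinearEquiv.ofBijective (blockSylvester blk (dg U))
    (blockSylvester_bijective (evalOrigin k σ) isUnit_of_isUnit_evalOrigin
      (by rw [hmapd]; exact hU))
  let W : Matrix κ κ (TotalRing k σ) → Matrix κ κ (TotalRing k σ) :=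
    fun x => od U * x - x * dg (od U * x) + od U + D x
  have W_sub : ∀ {N x y}, x - y ∈ matFil k σ κ N → W x - W y ∈ matFil k σ κ (N + 1) := by
    intro N x y h
    have e : W x - W y = od U * (x - y) - (x - y) * dg (od U * x) -
        y * dg (od U * (x - y)) + D (x - y) := by
      simp only [W, D_sub, Matrix.mul_sub, dg_sub, Matrix.sub_mul]
      abel
    rw [e]
    have h1 : od U * (x - y) ∈ matFil k σ κ (N + 1) := by
      rw [add_comm]; exact mul_mem_matFil hUo h
    have h0 : ∀ M, M ∈ matFil k σ κ 0 := completeFiltration_matFil.mem_zero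
    refine add_mem (sub_mem (sub_mem h1 ?_) ?_) (D_mem h)
    · exact mul_mem_matFil h (dg_mem (by simpa using mul_mem_matFil hUo (h0 x)))
    · simpa using mul_mem_matFil (h0 y) (dg_mem h1)
  have od_sub : ∀ M N, od (M - N) = od M - od N := by
    intro M N; ext1 α β; by_cases h : blk α = blk β <;> simp [od, h]
  have od_mem : ∀ {N M}, M ∈ matFil k σ κ N → od M ∈ matFil k σ κ N := by
    intro N M hM
    rw [mem_matFil] at *
    intro α β
    by_cases h : blk α = blk β
    · rw [od_eq M h]; exact zero_mem _
    · rw [od_ne M h]; exact hM α β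
  obtain ⟨x, hx⟩ := completeFiltration_matFil.exists_fixedPoint
    (fun x => S.symm (-od (W x))) (fun N x y h => by
      rw [← map_sub, ← neg_sub', ← od_sub]
      exact map_mem_matFil S.symm.toLinearMap (Submodule.neg_mem _ (od_mem (W_sub h))))
  have hSx : blockSylvester blk (dg U) x = -od (W x) := by
    have := congrArg S hx
    rw [LinearEquiv.apply_symm_apply] at this
    exact this.symm
  have hxo : ∀ {α β}, blk α = blk β → x α β = 0 := by
    intro α β h
    have := congrFun (congrFun hSx α) β
    rwa [blockSylvester_of_eq h, Matrix.neg_apply, od_eq _ h, neg_zero] at this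
  have hx1 : x ∈ matFil k σ κ 1 := by
    have h1 := W_sub (N := 0) (x := x) (y := 0) (completeFiltration_matFil.mem_zero _)
    have h2 : W 0 = od U := by
      ext1 α β
      simp [W, D]
    rw [h2] at h1
    have h3 := add_mem h1 hUo
    rw [sub_add_cancel] at h3
    rw [← hx]
    exact map_mem_matFil S.symm.toLinearMap (Submodule.neg_mem _ (od_mem h3))
  -- products of block diagonal and off-diagonal matrices
  have dg_mul : ∀ {α β}, blk α = blk β → ∀ M, (dg M * x) α β = 0 := by
    intro α β h M
    rw [Matrix.mul_apply]
    refine Finset.sum_eq_zero fun γ _ => ?_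
    by_cases h' : blk α = blk γ
    · rw [hxo (h'.symm.trans h), mul_zero]
    · rw [dg_ne M h', zero_mul]
  have mul_dg : ∀ {α β}, blk α = blk β → ∀ M, (x * dg M) α β = 0 := by
    intro α β h M
    rw [Matrix.mul_apply]
    refine Finset.sum_eq_zero fun γ _ => ?_
    by_cases h' : blk γ = blk β
    · rw [hxo (h.trans h'.symm), zero_mul]
    · rw [dg_ne M h', mul_zero]
  have hsplit : U = dg U + od U := by
    ext1 α β
    by_cases h : blk α = blk β
    · rw [Matrix.add_apply, dg_eq U h, od_eq U h, add_zero]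
    · rw [Matrix.add_apply, dg_ne U h, od_ne U h, zero_add]
  have hUox : od U * x ∈ matFil k σ κ 1 := by
    simpa using mul_mem_matFil hUo (completeFiltration_matFil.mem_zero x)
  refine ⟨x, dg U + dg (od U * x), hx1, fun α β h => ?_, ?_, ?_⟩
  · rw [Matrix.add_apply, dg_ne _ h, dg_ne _ h, add_zero]
  · rw [map_add, hmapd, add_eq_left]
    ext α β
    exact mem_totFil_one.mp (mem_matFil.mp (dg_mem hUox) α β)
  · change D x + U * (1 + x) = _
    have e : U * (1 + x) = dg U + od U + dg U * x + od U * x := by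
      conv_lhs => rw [hsplit, Matrix.mul_add, Matrix.mul_one, Matrix.add_mul]
      abel
    have e' : (1 + x) * (dg U + dg (od U * x)) =
        dg U + dg (od U * x) + x * dg U + x * dg (od U * x) := by
      rw [Matrix.add_mul, Matrix.one_mul, Matrix.mul_add]
      abel
    rw [e, e']
    ext1 α β
    by_cases h : blk α = blk β
    · simp only [Matrix.add_apply, dg_mul h, mul_dg h, od_eq U h, dg_eq (od U * x) h]
      simp [D, hxo h]
    · have := congrFun (congrFun hSx α) β
      rw [blockSylvester_of_ne h, Matrix.neg_apply, od_ne _ h] at this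
      simp only [W, Matrix.add_apply, Matrix.sub_apply, od_ne U h] at this
      simp only [Matrix.add_apply, dg_ne U h, od_ne U h, dg_ne (od U * x) h]
      linear_combination this

/-- A matrix `T` that obeys the flatness relation with a block diagonal matrix `U` without
intertwiners between different blocks at the origin is itself block diagonal: its off-diagonal part
`Y` satisfies `[U, Y] = u Y - u² ∂_u Y`, where the right-hand side has larger order than `Y`. -/
theorem blockDiag_of_flat {blk : κ → ι} {U T : Matrix κ κ (TotalRing k σ)}
    (hUd : ∀ α β, blk α ≠ blk β → U α β = 0)
    (hU : ∀ X : Matrix κ κ k, (∀ α β, blk α = blk β → X α β = 0) →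
      (∀ α β, blk α ≠ blk β → ((evalOrigin k σ).mapMatrix U * X) α β =
        (X * (evalOrigin k σ).mapMatrix U) α β) → X = 0)
    (hT : ∀ α β, blk α ≠ blk β → uVar k σ ^ 2 * ddu k σ (T α β) + (U * T) α β =
      (T * U) α β + uVar k σ * T α β) {α β : κ} (h : blk α ≠ blk β) : T α β = 0 := by
  let S := LinearEquiv.ofBijective (blockSylvester blk U)
    (blockSylvester_bijective (evalOrigin k σ) isUnit_of_isUnit_evalOrigin hU)
  let Y : Matrix κ κ (TotalRing k σ) :=
    Matrix.of fun α β => if blk α = blk β then 0 else T α β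
  have Y_eq : ∀ {α β}, blk α = blk β → Y α β = 0 := fun {α β} h => if_pos h
  have Y_ne : ∀ {α β}, blk α ≠ blk β → Y α β = T α β := fun {α β} h => if_neg h
  have h1 : ∀ {α β}, blk α ≠ blk β → (U * Y) α β = (U * T) α β := by
    intro α β h
    rw [Matrix.mul_apply, Matrix.mul_apply]
    refine Finset.sum_congr rfl fun γ _ => ?_
    by_cases h' : blk α = blk γ
    · rw [Y_ne (h' ▸ h)]
    · rw [hUd _ _ h', zero_mul, zero_mul]
  have h2 : ∀ {α β}, blk α ≠ blk β → (Y * U) α β = (T * U) α β := by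
    intro α β h
    rw [Matrix.mul_apply, Matrix.mul_apply]
    refine Finset.sum_congr rfl fun γ _ => ?_
    by_cases h' : blk γ = blk β
    · rw [Y_ne (h' ▸ h)]
    · rw [hUd _ _ h', mul_zero, mul_zero]
  have hY : Y = 0 := by
    refine completeFiltration_matFil.eq_zero_of_forall_succ fun N hN => ?_
    have h3 : S Y ∈ matFil k σ κ (N + 1) := by
      rw [mem_matFil]
      intro α β
      by_cases h : blk α = blk β
      · have : S Y α β = 0 := (blockSylvester_of_eq h).trans (Y_eq h)
        rw [this]
        exact zero_mem _
      · have : S Y α β = uVar k σ * Y α β - uVar k σ ^ 2 * ddu k σ (Y α β) := by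
          refine (blockSylvester_of_ne h).trans ?_
          rw [Matrix.sub_apply, h1 h, h2 h, Y_ne h]
          linear_combination hT α β h
        rw [this]
        refine sub_mem ?_ (sq_mul_ddu_mem_totFil (mem_matFil.mp hN α β))
        rw [add_comm]
        exact mul_mem_totFil uVar_mem_totFil (mem_matFil.mp hN α β)
    have h4 := map_mem_matFil S.symm.toLinearMap h3
    rwa [LinearEquiv.coe_coe, LinearEquiv.symm_apply_apply] at h4
  rw [← Y_ne h, hY, Matrix.zero_apply]

end BlockDiagonal

/-! ### Regular connections in frames -/

section Frame

variable {k : Type u} [Field k] {σ : Type w} {κ : Type*} {H : Type v} [AddCommGroup H]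
  [Module (TotalRing k σ) H]

/-- The matrix of an operator, such as `∇_{u² ∂_u}`, in a frame: its columns are the coordinates of
the images of the frame sections. -/
noncomputable def connMatrix (b : Module.Basis κ (TotalRing k σ) H) (T : H →+ H) :
    Matrix κ κ (TotalRing k σ) :=
  Matrix.of fun α β => b.repr (T (b β)) α

theorem connMatrix_apply (b : Module.Basis κ (TotalRing k σ) H) (T : H →+ H) (α β : κ) :
    connMatrix b T α β = b.repr (T (b β)) α :=
  rfl

variable [Fintype κ]

theorem repr_of_leibniz (b : Module.Basis κ (TotalRing k σ) H) {T : H →+ H}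
    {δ : TotalRing k σ → TotalRing k σ} (hT : ∀ f s, T (f • s) = δ f • s + f • T s) (x : H)
    (γ : κ) : b.repr (T x) γ =
      δ (b.repr x γ) + ∑ α, connMatrix b T γ α * b.repr x α := by
  classical
  conv_lhs => rw [← b.sum_repr x, map_sum, map_sum, Finsupp.finsetSum_apply]
  simp only [hT, map_add, map_smul, Finsupp.add_apply, Finsupp.smul_apply, b.repr_self,
    smul_eq_mul, Finset.sum_add_distrib, connMatrix_apply]
  congr 1
  · rw [Finset.sum_eq_single γ]
    · simp
    · intro β _ hβ
      simp [hβ]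
    · simp
  · exact Finset.sum_congr rfl fun _ _ => mul_comm _ _

theorem exists_basis_of_isUnit [DecidableEq κ] (b : Module.Basis κ (TotalRing k σ) H)
    {g : Matrix κ κ (TotalRing k σ)} (hg : IsUnit g) :
    ∃ c : Module.Basis κ (TotalRing k σ) H, ∀ β, c β = ∑ α, g α β • b α := by
  refine ⟨b.map (Matrix.toLinearEquiv b g ((Matrix.isUnit_iff_isUnit_det g).mp hg)), fun β => ?_⟩
  rw [Module.Basis.map_apply]
  exact Matrix.toLin_self b b g β

/-- A small change of a frame, by a matrix that vanishes at the origin, is again a frame. -/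
theorem exists_basis_of_mem_matFil [DecidableEq κ] (b : Module.Basis κ (TotalRing k σ) H)
    {x : Matrix κ κ (TotalRing k σ)} (hx : x ∈ matFil k σ κ 1) :
    ∃ c : Module.Basis κ (TotalRing k σ) H, (∀ β, c β = ∑ α, (1 + x) α β • b α) ∧
      ∀ β, c β - b β ∈ (originIdeal k σ • ⊤ : Submodule (TotalRing k σ) H) := by
  have hx0 : (evalOrigin k σ).mapMatrix x = 0 := by
    ext α β
    exact mem_totFil_one.mp (mem_matFil.mp hx α β)
  obtain ⟨c, hc⟩ := exists_basis_of_isUnit b (g := 1 + x)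
    (isUnit_of_map_eq_one (evalOrigin k σ) isUnit_of_isUnit_evalOrigin
      (by rw [map_add, map_one, hx0, add_zero]))
  refine ⟨c, hc, fun β => ?_⟩
  have h1 : c β - b β = ∑ α, x α β • b α := by
    rw [hc]
    simp [Matrix.add_apply, Matrix.one_apply, add_smul, Finset.sum_add_distrib, ite_smul]
  rw [h1]
  refine Submodule.sum_mem _ fun α _ => Submodule.smul_mem_smul ?_ trivial
  exact mem_totFil_one.mp (mem_matFil.mp hx α β)

namespace RegularForm

variable (R : RegularForm k σ H)

/-- The flatness relation between `∇_{u² ∂_u}` and `∇_{u ∂_{t_s}}`, in a frame. -/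
theorem connMatrix_comm (b : Module.Basis κ (TotalRing k σ) H) (s : σ) (α β : κ) :
    uVar k σ ^ 2 * ddu k σ (connMatrix b (R.opT s) α β) +
        (connMatrix b R.opU * connMatrix b (R.opT s)) α β =
      uVar k σ * ddt k s (connMatrix b R.opU α β) +
        (connMatrix b (R.opT s) * connMatrix b R.opU) α β +
        uVar k σ * connMatrix b (R.opT s) α β := by
  have h := congrArg (fun x => b.repr x α) (R.commUT s (b β))
  simp only [map_add, map_smul, Finsupp.add_apply, Finsupp.smul_apply, smul_eq_mul] at h
  rw [repr_of_leibniz b R.leibnizU (R.opT s (b β)),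
    repr_of_leibniz b (R.leibnizT s) (R.opU (b β))] at h
  exact h

/-- A frame in which `∇_{u² ∂_u}` is block diagonal at the origin, without intertwiners between
different blocks, can be changed into one in which the whole connection is block diagonal, without
changing its value at the origin. -/
theorem exists_blockDiag_basis {ι : Type*} [DecidableEq ι] [DecidableEq κ]
    (b : Module.Basis κ (TotalRing k σ) H) {blk : κ → ι}
    (hU0 : ∀ α β, blk α ≠ blk β → evalOrigin k σ (connMatrix b R.opU α β) = 0)
    (hU : ∀ X : Matrix κ κ k, (∀ α β, blk α = blk β → X α β = 0) →
      (∀ α β, blk α ≠ blk β → ((evalOrigin k σ).mapMatrix (connMatrix b R.opU) * X) α β =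
        (X * (evalOrigin k σ).mapMatrix (connMatrix b R.opU)) α β) → X = 0) :
    ∃ c : Module.Basis κ (TotalRing k σ) H,
      (∀ β, c β - b β ∈ (originIdeal k σ • ⊤ : Submodule (TotalRing k σ) H)) ∧
      (∀ α β, blk α ≠ blk β → connMatrix c R.opU α β = 0) ∧
      ∀ s α β, blk α ≠ blk β → connMatrix c (R.opT s) α β = 0 := by
  obtain ⟨x, V, hx, hV, hVU, hgauge⟩ := exists_blockDiag_gauge hU0 hU
  obtain ⟨c, hc, hcb⟩ := exists_basis_of_mem_matFil b hx
  have hreprc : ∀ β α, b.repr (c β) α = (1 + x) α β := by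
    intro β α
    rw [hc, b.repr_sum_self]
  have hcV : connMatrix c R.opU = V := by
    have h1 : ∀ β, R.opU (c β) = ∑ α, V α β • c α := by
      intro β
      refine b.ext_elem fun γ => ?_
      rw [repr_of_leibniz b R.leibnizU, map_sum, Finsupp.finsetSum_apply]
      simp only [hreprc, map_smul, Finsupp.smul_apply, smul_eq_mul]
      have h2 := congrFun (congrFun hgauge γ) β
      rw [Matrix.add_apply, Matrix.mul_apply, Matrix.mul_apply] at h2
      have h3 : ddu k σ ((1 + x) γ β) = ddu k σ (x γ β) := by
        rw [Matrix.add_apply, map_add, Matrix.one_apply]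
        split_ifs <;> simp
      rw [h3]
      refine h2.trans (Finset.sum_congr rfl fun _ _ => mul_comm _ _)
    ext1 α β
    rw [connMatrix_apply, h1, c.repr_sum_self]
  refine ⟨c, hcb, hcV ▸ hV, fun s α β h => ?_⟩
  refine blockDiag_of_flat (blk := blk) (U := connMatrix c R.opU) (hcV ▸ hV)
    (by rw [hcV, hVU]; exact hU) (fun α β h => ?_) h
  rw [R.connMatrix_comm c s α β, hcV, hV α β h]
  simp

end RegularForm

end Frame

/-! ### Covariant derivatives along vector fields of the base -/

section Along

variable {k : Type u} [Field k] {σ : Type w}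

theorem ddt_C (s : σ) (a : MvPowerSeries σ k) :
    ddt k s (PowerSeries.C a : TotalRing k σ) = PowerSeries.C (MvPowerSeries.pderiv k s a) := by
  ext1 n
  rw [coeff_ddt, PowerSeries.coeff_C, PowerSeries.coeff_C]
  split_ifs <;> simp

theorem ddu_C (a : MvPowerSeries σ k) : ddu k σ (PowerSeries.C a : TotalRing k σ) = 0 := by
  ext1 n
  rw [coeff_ddu, PowerSeries.coeff_C, if_neg n.succ_ne_zero, zero_mul, map_zero]

namespace RegularForm

variable [Fintype σ] {H : Type v} [AddCommGroup H] [Module (TotalRing k σ) H]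
  (R : RegularForm k σ H)

/-- The operator `∇_{u p}` for the vector field `p = ∑ p_s ∂_{t_s}` on `B`. -/
noncomputable def along (p : σ → MvPowerSeries σ k) : H →+ H :=
  AddMonoidHom.mk' (fun x => ∑ s, (PowerSeries.C (p s) : TotalRing k σ) • R.opT s x) fun x y => by
    simp only [map_add, smul_add, Finset.sum_add_distrib]

theorem along_apply (p : σ → MvPowerSeries σ k) (x : H) :
    R.along p x = ∑ s, (PowerSeries.C (p s) : TotalRing k σ) • R.opT s x :=
  rfl

theorem along_smul (p : σ → MvPowerSeries σ k) (f : TotalRing k σ) (x : H) :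
    R.along p (f • x) = (uVar k σ * ∑ s, PowerSeries.C (p s) * ddt k s f) • x +
      f • R.along p x := by
  simp only [along_apply, R.leibnizT, smul_add, Finset.sum_add_distrib, Finset.smul_sum,
    Finset.mul_sum, Finset.sum_smul, smul_smul]
  congr 1
  · exact Finset.sum_congr rfl fun _ _ => by congr 1; ring
  · exact Finset.sum_congr rfl fun _ _ => by congr 1; ring

theorem along_C_smul (p : σ → MvPowerSeries σ k) (a : MvPowerSeries σ k) (x : H) :
    R.along p ((PowerSeries.C a : TotalRing k σ) • x) =
      (uVar k σ * PowerSeries.C (vectorField p a)) • x +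
        (PowerSeries.C a : TotalRing k σ) • R.along p x := by
  rw [along_smul]
  simp only [ddt_C, ← map_mul, ← map_sum, vectorField_apply]

theorem along_uVar_smul (p : σ → MvPowerSeries σ k) (x : H) :
    R.along p (uVar k σ • x) = uVar k σ • R.along p x := by
  rw [along_smul]
  simp

theorem opU_along (p : σ → MvPowerSeries σ k) (x : H) :
    R.opU (R.along p x) = R.along p (R.opU x) + uVar k σ • R.along p x := by
  simp only [along_apply, map_sum, R.leibnizU, ddu_C, mul_zero, zero_smul, zero_add, R.commUT,
    smul_add, Finset.sum_add_distrib, Finset.smul_sum]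
  congr 1
  exact Finset.sum_congr rfl fun s _ => smul_comm _ _ _

theorem along_comm (p q : σ → MvPowerSeries σ k) (x : H) :
    R.along p (R.along q x) - R.along q (R.along p x) = uVar k σ • R.along (bracket p q) x := by
  have h : ∀ p q : σ → MvPowerSeries σ k, R.along p (R.along q x) =
      ∑ t, (uVar k σ * PowerSeries.C (vectorField p (q t))) • R.opT t x +
      ∑ t, ∑ s, (PowerSeries.C (q t) * PowerSeries.C (p s) : TotalRing k σ) •
        R.opT s (R.opT t x) := by
    intro p q
    rw [R.along_apply q, map_sum, ← Finset.sum_add_distrib]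
    refine Finset.sum_congr rfl fun t _ => ?_
    rw [along_C_smul, R.along_apply p, Finset.smul_sum]
    simp only [smul_smul]
  rw [h, h, Finset.sum_comm (f := fun t s => (PowerSeries.C (q t) * PowerSeries.C (p s) :
    TotalRing k σ) • R.opT s (R.opT t x)), add_sub_add_comm]
  have h2 : ∑ s, ∑ t, (PowerSeries.C (q t) * PowerSeries.C (p s) : TotalRing k σ) •
        R.opT s (R.opT t x) - ∑ t, ∑ s, (PowerSeries.C (p t) * PowerSeries.C (q s) :
        TotalRing k σ) • R.opT s (R.opT t x) = 0 := by
    rw [sub_eq_zero]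
    refine Finset.sum_congr rfl fun s _ => Finset.sum_congr rfl fun t _ => ?_
    rw [R.commTT, mul_comm]
  rw [h2, add_zero, along_apply, Finset.smul_sum, ← Finset.sum_sub_distrib]
  refine Finset.sum_congr rfl fun s _ => ?_
  rw [← sub_smul, smul_smul, bracket, map_sub, mul_sub]

end RegularForm

end Along

/-! ### Coordinates adapted to a splitting -/

section Coordinates

/-- The inverse of a block diagonal matrix is block diagonal. -/
theorem blockDiag_of_mul_eq_one {A κ ι : Type*} [CommRing A] [Fintype κ] [DecidableEq κ]
    [DecidableEq ι] {blk : κ → ι} {N N' : Matrix κ κ A} (h : N * N' = 1)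
    (hN : ∀ α β, blk α ≠ blk β → N α β = 0) {γ l : κ} (hγ : blk γ ≠ blk l) : N' γ l = 0 := by
  -- the part of the column `l` of `N'` in the block of `γ` is killed by `N`
  let v : κ → A := fun β => if blk β = blk γ then N' β l else 0
  have hv : N.mulVec v = 0 := by
    ext1 β
    by_cases hβ : blk β = blk γ
    · have h1 := congrFun (congrFun h β) l
      rw [Matrix.one_apply, if_neg (fun e => hγ (by rw [← hβ, e])), Matrix.mul_apply] at h1
      rw [Pi.zero_apply, ← h1, Matrix.mulVec, dotProduct]
      refine Finset.sum_congr rfl fun α _ => ?_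
      by_cases hα : blk α = blk γ
      · rw [show v α = N' α l from if_pos hα]
      · rw [hN β α (fun e => hα (by rw [← e, hβ])), zero_mul, zero_mul]
    · rw [Matrix.mulVec, dotProduct, Pi.zero_apply]
      refine Finset.sum_eq_zero fun α _ => ?_
      by_cases hα : blk α = blk γ
      · rw [hN β α (fun e => hβ (by rw [e, hα])), zero_mul]
      · rw [show v α = 0 from if_neg hα, mul_zero]
  have h2 := congrArg (fun w => N'.mulVec w) hv
  simp only [Matrix.mulVec_mulVec, mul_eq_one_comm.mp h, Matrix.one_mulVec, Matrix.mulVec_zero]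
    at h2
  have h3 := congrFun h2 γ
  rwa [show v γ = N' γ l from if_pos rfl] at h3

variable {k : Type u} [Field k] {σ : Type w} {κ ι : Type*} {H : Type v} [AddCommGroup H]
  [Module (TotalRing k σ) H]

/-- At `u = 0` the operators `∇_{u ∂_t}` are linear, so that their matrices commute. -/
theorem constantCoeff_connMatrix_comm [Fintype κ] (R : RegularForm k σ H)
    (c : Module.Basis κ (TotalRing k σ) H) (s t : σ) (α β : κ) :
    ∑ γ, PowerSeries.constantCoeff (connMatrix c (R.opT s) α γ) *
        PowerSeries.constantCoeff (connMatrix c (R.opT t) γ β) =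
      ∑ γ, PowerSeries.constantCoeff (connMatrix c (R.opT t) α γ) *
        PowerSeries.constantCoeff (connMatrix c (R.opT s) γ β) := by
  have h : ∀ s t, PowerSeries.constantCoeff (c.repr (R.opT s (R.opT t (c β))) α) =
      ∑ γ, PowerSeries.constantCoeff (connMatrix c (R.opT s) α γ) *
        PowerSeries.constantCoeff (connMatrix c (R.opT t) γ β) := by
    intro s t
    rw [repr_of_leibniz c (R.leibnizT s)]
    simp only [map_add, map_mul, PowerSeries.constantCoeff_X, zero_mul, zero_add, map_sum,
      connMatrix_apply]
  rw [← h, ← h, R.commTT]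

variable [Fintype σ]

/-- The matrix of `∇_{u p}` at `u = 0`. -/
noncomputable def alongZero (R : RegularForm k σ H) (c : Module.Basis κ (TotalRing k σ) H)
    (p : σ → MvPowerSeries σ k) : Matrix κ κ (MvPowerSeries σ k) :=
  Matrix.of fun α β => ∑ s, p s * PowerSeries.constantCoeff (connMatrix c (R.opT s) α β)

theorem constantCoeff_connMatrix_along (R : RegularForm k σ H)
    (c : Module.Basis κ (TotalRing k σ) H) (p : σ → MvPowerSeries σ k) (α β : κ) :
    PowerSeries.constantCoeff (connMatrix c (R.along p) α β) = alongZero R c p α β := by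
  simp only [connMatrix_apply, R.along_apply, map_sum, map_smul, Finsupp.finsetSum_apply,
    Finsupp.smul_apply, smul_eq_mul, map_mul, alongZero, Matrix.of_apply,
    PowerSeries.constantCoeff_C]

theorem alongZero_sum {J : Type*} [Fintype J] (R : RegularForm k σ H)
    (c : Module.Basis κ (TotalRing k σ) H) (a : J → MvPowerSeries σ k)
    (p : J → σ → MvPowerSeries σ k) (α β : κ) :
    alongZero R c (fun s => ∑ j, a j * p j s) α β = ∑ j, a j * alongZero R c (p j) α β := by
  simp only [alongZero, Matrix.of_apply, Finset.sum_mul, Finset.mul_sum]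
  rw [Finset.sum_comm]
  simp only [mul_assoc]

variable [Fintype κ]

theorem alongZero_comm (R : RegularForm k σ H) (c : Module.Basis κ (TotalRing k σ) H)
    (p q : σ → MvPowerSeries σ k) :
    alongZero R c p * alongZero R c q = alongZero R c q * alongZero R c p := by
  have h : ∀ p q : σ → MvPowerSeries σ k, ∀ α β, (alongZero R c p * alongZero R c q) α β =
      ∑ s, ∑ t, p s * q t * ∑ γ, PowerSeries.constantCoeff (connMatrix c (R.opT s) α γ) *
        PowerSeries.constantCoeff (connMatrix c (R.opT t) γ β) := by
    intro p q α β
    simp only [Matrix.mul_apply, alongZero, Matrix.of_apply, Finset.sum_mul_sum]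
    rw [Finset.sum_comm]
    refine Finset.sum_congr rfl fun s _ => ?_
    rw [Finset.sum_comm]
    refine Finset.sum_congr rfl fun t _ => ?_
    rw [Finset.mul_sum]
    refine Finset.sum_congr rfl fun γ _ => ?_
    ring
  ext1 α β
  rw [h, h, Finset.sum_comm]
  refine Finset.sum_congr rfl fun s _ => Finset.sum_congr rfl fun t _ => ?_
  rw [constantCoeff_connMatrix_comm, mul_comm (p t)]

/-- If the connection is block diagonal, the vector fields along which it has no pole on the block
`i` form an involutive distribution: the curvature relation
`[∇_p, ∇_q] = ∇_{[p, q]}` shows that `∇_{[p, q]}` is again regular on this block. -/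
theorem alongZero_bracket (R : RegularForm k σ H) (c : Module.Basis κ (TotalRing k σ) H)
    {blk : κ → ι} (hT : ∀ s α β, blk α ≠ blk β → connMatrix c (R.opT s) α β = 0) {i : ι}
    {p q : σ → MvPowerSeries σ k} (hp : ∀ α β, blk β = i → alongZero R c p α β = 0)
    (hq : ∀ α β, blk β = i → alongZero R c q α β = 0) (α β : κ) (hβ : blk β = i) :
    alongZero R c (bracket p q) α β = 0 := by
  classical
  -- along such fields, the operator `∇_{u p}` maps the block to `u` times itself
  have key : ∀ p : σ → MvPowerSeries σ k, (∀ α β, blk β = i → alongZero R c p α β = 0) → ∀ x : H,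
      (∀ β, blk β ≠ i → c.repr x β = 0) →
      ∃ y : H, (∀ β, blk β ≠ i → c.repr y β = 0) ∧ R.along p x = uVar k σ • y := by
    intro p hp x hx
    have h1 : ∀ β, ∃ f : TotalRing k σ, c.repr (R.along p x) β = uVar k σ * f := by
      intro β
      rw [repr_of_leibniz c (R.along_smul p)]
      refine (dvd_add (dvd_mul_right _ _) (Finset.dvd_sum fun α _ => ?_))
      by_cases hα : blk α = i
      · refine Dvd.dvd.mul_right ?_ _
        rw [PowerSeries.X_dvd_iff, constantCoeff_connMatrix_along, hp β α hα]
      · rw [hx α hα, mul_zero]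
        exact dvd_zero _
    have h2 : ∀ β, blk β ≠ i → c.repr (R.along p x) β = 0 := by
      intro β hβ
      rw [repr_of_leibniz c (R.along_smul p), hx β hβ]
      simp only [map_zero, mul_zero, Finset.sum_const_zero, zero_add]
      refine Finset.sum_eq_zero fun α _ => ?_
      by_cases hα : blk α = i
      · rw [connMatrix_apply, R.along_apply, map_sum, Finsupp.finsetSum_apply,
          Finset.sum_eq_zero, zero_mul]
        intro s _
        have := hT s β α (fun e => hβ (e.trans hα))
        rw [connMatrix_apply] at this
        rw [map_smul, Finsupp.smul_apply, this, smul_zero]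
      · rw [hx α hα, mul_zero]
    choose f hf using h1
    refine ⟨∑ β, f β • c β, fun β hβ => ?_, c.ext_elem fun β => ?_⟩
    · have := hf β
      rw [h2 β hβ] at this
      rw [c.repr_sum_self]
      exact (mul_eq_zero.mp this.symm).resolve_left PowerSeries.X_ne_zero
    · rw [map_smul, Finsupp.smul_apply, c.repr_sum_self, smul_eq_mul, hf]
  have hcβ : ∀ γ, blk γ ≠ i → c.repr (c β) γ = 0 := by
    intro γ hγ
    rw [c.repr_self, Finsupp.single_apply, if_neg]
    rintro rfl
    exact hγ hβ
  obtain ⟨y, hy, hpy⟩ := key p hp _ hcβ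
  obtain ⟨z, hz, hqz⟩ := key q hq _ hcβ
  obtain ⟨y', -, hy'⟩ := key q hq _ hy
  obtain ⟨z', -, hz'⟩ := key p hp _ hz
  have h3 := R.along_comm p q (c β)
  rw [hpy, hqz, R.along_uVar_smul, R.along_uVar_smul, hy', hz', ← smul_sub, ← smul_sub] at h3
  have h4 := congrArg (fun x => c.repr x α) h3
  simp only [map_smul, Finsupp.smul_apply, smul_eq_mul] at h4
  have h5 := mul_left_cancel₀ PowerSeries.X_ne_zero h4
  rw [← constantCoeff_connMatrix_along, connMatrix_apply, ← h5]
  simp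

variable [DecidableEq κ] [DecidableEq ι] [DecidableEq σ]

/-- Let the connection be block diagonal, and let `h` be a cyclic vector at the origin. Then there
are coordinates `f` on `B`, indexed by the frame, such that the connection is regular along
`∂_{f_l}` on all the blocks other than that of `l`.

The fields `ξ_γ` with `μ(ξ_γ) h = e_γ` satisfy `μ(ξ_γ) e_α = μ(ξ_α) e_γ`, which vanishes if `α` and
`γ` lie in different blocks. Hence the fields regular on the block `i` are spanned by the `ξ_γ` with
`γ` not in this block, and the coordinates come from the Frobenius theorem. -/
theorem exists_coordinates [CharZero k] (R : RegularForm k σ H)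
    (c : Module.Basis κ (TotalRing k σ) H) {blk : κ → ι}
    (hT : ∀ s α β, blk α ≠ blk β → connMatrix c (R.opT s) α β = 0) (h : κ → k)
    {G₀ : Matrix σ κ k}
    (hG : (Matrix.of fun β s => ∑ γ, evalOrigin k σ (connMatrix c (R.opT s) β γ) * h γ) * G₀ = 1)
    (hG' : G₀ * (Matrix.of fun β s => ∑ γ, evalOrigin k σ (connMatrix c (R.opT s) β γ) * h γ) = 1) :
    ∃ (f : κ → MvPowerSeries σ k) (G : Matrix σ κ (MvPowerSeries σ k)),
      (∀ α, MvPowerSeries.constantCoeff (f α) = 0) ∧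
      (Matrix.of fun l s => MvPowerSeries.pderiv k s (f l)) * G = 1 ∧
      G * (Matrix.of fun l s => MvPowerSeries.pderiv k s (f l)) = 1 ∧
      ∀ l β γ, blk l ≠ blk γ → alongZero R c (fun s => G s l) β γ = 0 := by
  let A : σ → Matrix κ κ (MvPowerSeries σ k) := fun s =>
    (connMatrix c (R.opT s)).map PowerSeries.constantCoeff
  -- the vector `h` is extended by constants; the forms `E β` are the components of `μ(·) h`
  let h' : κ → MvPowerSeries σ k := fun γ => MvPowerSeries.C (h γ)
  let E : Matrix κ σ (MvPowerSeries σ k) := Matrix.of fun β s => (A s).mulVec h' β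
  have hE0 : E.map MvPowerSeries.constantCoeff =
      Matrix.of fun β s => ∑ γ, evalOrigin k σ (connMatrix c (R.opT s) β γ) * h γ := by
    ext β s
    simp only [E, A, h', Matrix.map_apply, Matrix.of_apply, Matrix.mulVec, dotProduct, map_sum,
      map_mul, MvPowerSeries.constantCoeff_C]
    rfl
  obtain ⟨g, hEg, hgE⟩ := exists_inverse_of_map (A := MvPowerSeries σ k)
    MvPowerSeries.constantCoeff isUnit_of_isUnit_constantCoeff
    (fun c => MvPowerSeries.constantCoeff_C c) (E := E) (G₀ := G₀) (hE0 ▸ hG) (hE0 ▸ hG')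
  let ξ : κ → σ → MvPowerSeries σ k := fun γ s => g s γ
  have hblock : ∀ p α β, blk α ≠ blk β → alongZero R c p α β = 0 := by
    intro p α β hne
    refine Finset.sum_eq_zero fun s _ => ?_
    rw [hT s α β hne, map_zero, mul_zero]
  have hEp : ∀ p, E.mulVec p = (alongZero R c p).mulVec h' := by
    intro p
    ext1 β
    simp only [Matrix.mulVec, dotProduct, E, A, alongZero, Matrix.of_apply, Finset.sum_mul,
      Matrix.map_apply]
    rw [Finset.sum_comm]
    exact Finset.sum_congr rfl fun _ _ => Finset.sum_congr rfl fun _ _ => by ring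
  have hEξ : ∀ γ, E.mulVec (ξ γ) = Pi.single γ 1 := by
    intro γ
    ext1 β
    have := congrFun (congrFun hEg β) γ
    rw [Matrix.mul_apply, Matrix.one_apply] at this
    rw [Pi.single_apply]
    exact this
  -- `μ(ξ_γ) e_α = μ(ξ_γ) μ(ξ_α) h` is symmetric in `α` and `γ`
  have hcross : ∀ γ α β, blk γ ≠ blk α → alongZero R c (ξ γ) β α = 0 := by
    intro γ α β hne
    have h1 : ∀ γ α, alongZero R c (ξ γ) β α =
        (alongZero R c (ξ γ) * alongZero R c (ξ α)).mulVec h' β := by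
      intro γ α
      rw [← Matrix.mulVec_mulVec, ← hEp, hEξ, Matrix.mulVec_single_one]
      rfl
    by_cases hβ : blk β = blk α
    · rw [h1, alongZero_comm, ← h1]
      exact hblock _ _ _ (fun e => hne (e.symm.trans hβ))
    · exact hblock _ _ _ hβ
  have hexp : ∀ p, p = fun s => ∑ γ, E.mulVec p γ * ξ γ s := by
    intro p
    ext1 s
    have : g.mulVec (E.mulVec p) s = p s := by
      rw [Matrix.mulVec_mulVec, hgE, Matrix.one_mulVec]
    rw [← this]
    simp only [Matrix.mulVec, dotProduct, ξ, mul_comm]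
  -- the distributions annihilated by the forms of a block are those of `alongZero_bracket`
  have hreg : ∀ i p, (∀ α, blk α = i → E.mulVec p α = 0) →
      ∀ α β, blk β = i → alongZero R c p α β = 0 := by
    intro i p hp α β hβ
    rw [hexp p, alongZero_sum]
    refine Finset.sum_eq_zero fun γ _ => ?_
    by_cases hγ : blk γ = i
    · rw [hp γ hγ, zero_mul]
    · rw [hcross γ β α (fun e => hγ (e.trans hβ)), mul_zero]
  have hreg' : ∀ i p, (∀ α β, blk β = i → alongZero R c p α β = 0) →
      ∀ α, blk α = i → E.mulVec p α = 0 := by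
    intro i p hp α hα
    rw [hEp, Matrix.mulVec, dotProduct]
    refine Finset.sum_eq_zero fun γ _ => ?_
    by_cases hγ : blk γ = i
    · rw [hp α γ hγ, zero_mul]
    · rw [hblock p α γ (fun e => hγ (e.symm.trans hα)), zero_mul]
  have hfrob : ∀ α, ∃ f : MvPowerSeries σ k, MvPowerSeries.constantCoeff f = 0 ∧
      (∀ s, MvPowerSeries.constantCoeff (MvPowerSeries.pderiv k s f) =
        MvPowerSeries.constantCoeff (E α s)) ∧
      ∀ p, (∀ β, blk β = blk α → E.mulVec p β = 0) → vectorField p f = 0 := by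
    intro α
    refine exists_first_integral hEg hgE (fun β => blk β = blk α) (fun p q hp hq => ?_) rfl
    exact hreg' _ _ fun β γ hγ => alongZero_bracket R c hT (hreg _ p hp) (hreg _ q hq) β γ hγ
  choose f hf0 hf1 hfV using hfrob
  set M : Matrix κ σ (MvPowerSeries σ k) :=
    Matrix.of fun l s => MvPowerSeries.pderiv k s (f l) with hM
  have hME : M.map MvPowerSeries.constantCoeff = E.map MvPowerSeries.constantCoeff := by
    ext β s
    exact hf1 β s
  obtain ⟨G, hMG, hGM⟩ := exists_inverse_of_map (A := MvPowerSeries σ k)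
    MvPowerSeries.constantCoeff isUnit_of_isUnit_constantCoeff
    (fun c => MvPowerSeries.constantCoeff_C c) (E := M) (G₀ := G₀) (by rw [hME, hE0, hG])
    (by rw [hME, hE0, hG'])
  refine ⟨f, G, hf0, hMG, hGM, fun l β γ hne => ?_⟩
  -- the differentials of the `f α` in a block are combinations of the forms `E β` in this block
  have hK : ∀ α γ, blk α ≠ blk γ → (M * g) α γ = 0 := by
    intro α γ hne
    rw [Matrix.mul_apply, ← hfV α (ξ γ), vectorField_apply]
    · exact Finset.sum_congr rfl fun s _ => mul_comm _ _
    · intro β hβ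
      rw [hEξ, Pi.single_apply, if_neg]
      rintro rfl
      exact hne hβ.symm
  have hinv : (M * g) * (E * G) = 1 := by
    rw [Matrix.mul_assoc, ← Matrix.mul_assoc g, hgE, Matrix.one_mul, hMG]
  refine hreg (blk γ) _ (fun α hα => ?_) β γ rfl
  exact blockDiag_of_mul_eq_one hinv hK (fun e => hne (e.symm.trans hα))

end Coordinates

/-! ### Flat frames -/

section FlatFrame

variable {k : Type u} [Field k]

/-- The operator `δ + U` on columns of functions, for a derivation `δ` and a matrix `U`. -/
noncomputable def matrixOp {A J : Type*} [CommRing A] [Algebra k A] [Fintype J]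
    (δ : Derivation k A A) (U : Matrix J J A) : (J → A) →+ (J → A) :=
  AddMonoidHom.mk' (fun v a => δ (v a) + ∑ b, U a b * v b) fun v w => by
    ext a
    simp only [Pi.add_apply, map_add, mul_add, Finset.sum_add_distrib]
    ring

theorem matrixOp_apply {A J : Type*} [CommRing A] [Algebra k A] [Fintype J]
    (δ : Derivation k A A) (U : Matrix J J A) (v : J → A) (a : J) :
    matrixOp δ U v a = δ (v a) + ∑ b, U a b * v b :=
  rfl

theorem matrixOp_smul {A J : Type*} [CommRing A] [Algebra k A] [Fintype J]
    (δ : Derivation k A A) (U : Matrix J J A) (f : A) (v : J → A) :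
    matrixOp δ U (f • v) = δ f • v + f • matrixOp δ U v := by
  ext a
  simp only [matrixOp_apply, Pi.add_apply, Pi.smul_apply, smul_eq_mul, Derivation.leibniz, mul_add,
    Finset.mul_sum, mul_left_comm]
  ring

variable {σ : Type w} {κ : Type*} {H : Type v} [AddCommGroup H] [Module (TotalRing k σ) H]

theorem repr_mem_originIdeal (c : Module.Basis κ (TotalRing k σ) H) {x : H}
    (hx : x ∈ (originIdeal k σ • ⊤ : Submodule (TotalRing k σ) H)) (α : κ) :
    c.repr x α ∈ originIdeal k σ := by
  refine Submodule.smul_induction_on (p := fun x => c.repr x α ∈ originIdeal k σ) hx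
    (fun f hf s _ => ?_) (fun x y hx hy => ?_)
  · rw [map_smul, Finsupp.smul_apply, smul_eq_mul]
    exact Ideal.mul_mem_right _ _ hf
  · rw [map_add, Finsupp.add_apply]
    exact add_mem hx hy

/-- Sections that agree with a frame at the origin form a frame. -/
theorem exists_basis_of_sub_mem [Fintype κ] [DecidableEq κ]
    (c : Module.Basis κ (TotalRing k σ) H) (d : κ → H)
    (hd : ∀ β, d β - c β ∈ (originIdeal k σ • ⊤ : Submodule (TotalRing k σ) H)) :
    ∃ d' : Module.Basis κ (TotalRing k σ) H, ∀ β, d' β = d β := by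
  obtain ⟨d', hd', -⟩ := exists_basis_of_mem_matFil c
    (x := Matrix.of fun α β => c.repr (d β - c β) α)
    (fun α β => mem_totFil_one.mpr (repr_mem_originIdeal c (hd β) α))
  refine ⟨d', fun β => ?_⟩
  rw [hd']
  refine c.ext_elem fun γ => ?_
  rw [c.repr_sum_self, Matrix.add_apply, Matrix.of_apply, map_sub, Finsupp.sub_apply,
    c.repr_self, Finsupp.single_apply, Matrix.one_apply]
  simp only [eq_comm (a := β)]
  ring

/-- A connection that is block diagonal in a frame is so in any frame obtained by a block diagonal
transition matrix. -/
theorem connMatrix_blockDiag {ι : Type*} [DecidableEq ι] [Fintype κ] [DecidableEq κ]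
    (c d : Module.Basis κ (TotalRing k σ) H) {blk : κ → ι}
    (hcd : ∀ α β, blk α ≠ blk β → c.repr (d β) α = 0) {T : H →+ H}
    {δ : TotalRing k σ → TotalRing k σ} (hδ : δ 0 = 0)
    (hT : ∀ f s, T (f • s) = δ f • s + f • T s)
    (hcT : ∀ α β, blk α ≠ blk β → connMatrix c T α β = 0) {α β : κ} (h : blk α ≠ blk β) :
    connMatrix d T α β = 0 := by
  have hdc : ∀ α β, blk α ≠ blk β → d.repr (c β) α = 0 := fun α β h =>
    blockDiag_of_mul_eq_one (N := c.toMatrix d) (N' := d.toMatrix c)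
      (c.toMatrix_mul_toMatrix_flip d) hcd h
  have h1 : ∀ γ, blk γ ≠ blk β → c.repr (T (d β)) γ = 0 := by
    intro γ hγ
    rw [repr_of_leibniz c hT, hcd γ β hγ, hδ, zero_add]
    refine Finset.sum_eq_zero fun ε _ => ?_
    by_cases hε : blk ε = blk β
    · rw [hcT γ ε (fun e => hγ (e.trans hε)), zero_mul]
    · rw [hcd ε β hε, mul_zero]
  rw [connMatrix_apply, ← c.sum_repr (T (d β)), map_sum, Finsupp.finsetSum_apply]
  refine Finset.sum_eq_zero fun γ _ => ?_
  rw [map_smul, Finsupp.smul_apply, smul_eq_mul]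
  by_cases hγ : blk γ = blk β
  · rw [hdc α γ (fun e => h (e.trans hγ)), mul_zero]
  · rw [h1 γ hγ, zero_mul]

/-- In a flat frame, if `T (d β)` is flat along a coordinate `l` of another block, then the column
`β` of the matrix of `T` does not depend on this coordinate. Here `blk'` assigns blocks to the
coordinates. -/
theorem ddt_connMatrix_eq_zero {ι : Type*} [DecidableEq ι] [Fintype κ] (R : RegularForm k σ H)
    (d : Module.Basis κ (TotalRing k σ) H) {blk : κ → ι} {blk' : σ → ι}
    (hflat : ∀ l β, blk' l ≠ blk β → R.opT l (d β) = 0) {T : H →+ H}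
    (hT : ∀ α β, blk α ≠ blk β → connMatrix d T α β = 0) {l : σ} {β : κ} (hl : blk' l ≠ blk β)
    (h : R.opT l (T (d β)) = 0) (α : κ) : ddt k l (connMatrix d T α β) = 0 := by
  have h1 := repr_of_leibniz d (R.leibnizT l) (T (d β)) α
  rw [h, map_zero, Finsupp.zero_apply, Finset.sum_eq_zero, add_zero] at h1
  · exact (mul_eq_zero.mp h1.symm).resolve_left PowerSeries.X_ne_zero
  · intro γ _
    by_cases hγ : blk γ = blk β
    · rw [connMatrix_apply, hflat l γ (fun e => hl (e.trans hγ)), map_zero, Finsupp.zero_apply,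
        zero_mul]
    · have := hT γ β hγ
      rw [connMatrix_apply] at this
      rw [this, mul_zero]

end FlatFrame

section FlatFrame

variable {k : Type u} [Field k] [CharZero k] {κ : Type w} [Fintype κ] [DecidableEq κ]
  {ι : Type*} [DecidableEq ι] {H : Type v} [AddCommGroup H] [Module (TotalRing k κ) H]

/-- If the coordinates of `B` are indexed by a frame in which the connection is block diagonal, and
the connection is regular on each block along the coordinate fields of the other blocks, then a
section of the frame can be replaced by one that is flat along these fields, without changing its
value at the origin. -/
theorem exists_flat_section (R : RegularForm k κ H) (c : Module.Basis κ (TotalRing k κ) H)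
    {blk : κ → ι} (hT : ∀ s α β, blk α ≠ blk β → connMatrix c (R.opT s) α β = 0)
    (hreg : ∀ l α β, blk l ≠ blk β → PowerSeries.constantCoeff (connMatrix c (R.opT l) α β) = 0)
    (β : κ) : ∃ x : H, x - c β ∈ (originIdeal k κ • ⊤ : Submodule (TotalRing k κ) H) ∧
      (∀ γ, blk γ ≠ blk β → c.repr x γ = 0) ∧ ∀ l, blk l ≠ blk β → R.opT l x = 0 := by
  classical
  let J := {γ : κ // blk γ = blk β}
  let L := {l : κ // blk l ≠ blk β}
  -- on the block of `β`, the operators `∇_{∂_l} = u⁻¹ ∇_{u ∂_l}` are regular and commute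
  have hB : ∀ (l : L) (a b : J), ∃ f : TotalRing k κ,
      connMatrix c (R.opT l) a b = uVar k κ * f := fun l a b =>
    PowerSeries.X_dvd_iff.mpr (hreg l a b (by rw [b.2]; exact l.2))
  choose B hB using hB
  let incl : (J → TotalRing k κ) →ₗ[TotalRing k κ] H :=
    Fintype.linearCombination (TotalRing k κ) fun a : J => c a
  have hincl : ∀ v, incl v = ∑ a, v a • c a := fun v =>
    Fintype.linearCombination_apply (TotalRing k κ) _ _
  have hrepr : ∀ v (a : J), c.repr (incl v) a = v a := by
    intro v a
    rw [hincl, map_sum, Finsupp.finsetSum_apply, Finset.sum_eq_single a]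
    · simp
    · intro b _ hb
      rw [map_smul, c.repr_self, Finsupp.smul_apply, Finsupp.single_apply,
        if_neg (fun e => hb (Subtype.ext e)), smul_zero]
    · simp
  have hrepr' : ∀ v γ, blk γ ≠ blk β → c.repr (incl v) γ = 0 := by
    intro v γ hγ
    rw [hincl, map_sum, Finsupp.finsetSum_apply]
    refine Finset.sum_eq_zero fun b _ => ?_
    rw [map_smul, c.repr_self, Finsupp.smul_apply, Finsupp.single_apply,
      if_neg (fun e => hγ (by rw [← e, b.2])), smul_zero]
  have hinj : Function.Injective incl := by
    intro v w h
    ext1 a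
    rw [← hrepr v, h, hrepr]
  let T : L → (J → TotalRing k κ) →+ (J → TotalRing k κ) := fun l =>
    matrixOp (ddt k (l : κ)) (Matrix.of (B l))
  have hTc : ∀ (l : L) v, R.opT l (incl v) = uVar k κ • incl (T l v) := by
    intro l v
    refine c.ext_elem fun γ => ?_
    rw [repr_of_leibniz c (R.leibnizT l), map_smul, Finsupp.smul_apply, smul_eq_mul]
    by_cases hγ : blk γ = blk β
    · have h1 := hrepr v ⟨γ, hγ⟩
      have h2 := hrepr (T l v) ⟨γ, hγ⟩
      dsimp only at h1 h2
      rw [h1, h2, matrixOp_apply, mul_add, Finset.mul_sum,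
        ← Fintype.sum_subtype_add_sum_subtype (fun α => blk α = blk β)]
      rw [Finset.sum_eq_zero (s := (Finset.univ : Finset {α // ¬ blk α = blk β})), add_zero]
      · congr 1
        refine Finset.sum_congr rfl fun a _ => ?_
        rw [hrepr v a, Matrix.of_apply, ← mul_assoc]
        exact congrArg (· * v a) (hB l ⟨γ, hγ⟩ a)
      · intro a _
        rw [hrepr' v a a.2, mul_zero]
    · rw [hrepr' v γ hγ, hrepr' (T l v) γ hγ, map_zero, mul_zero, zero_add]
      refine Finset.sum_eq_zero fun α _ => ?_
      by_cases hα : blk α = blk β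
      · rw [hT l γ α (fun e => hγ (e.trans hα)), zero_mul]
      · rw [hrepr' v α hα, mul_zero]
  have hsm : ∀ (l : κ) (x : H), R.opT l (uVar k κ • x) = uVar k κ • R.opT l x := by
    intro l x
    rw [R.leibnizT, ddt_uVar, mul_zero, zero_smul, zero_add]
  have hcanc : ∀ x y : H, uVar k κ • x = uVar k κ • y → x = y := by
    intro x y h
    refine c.ext_elem fun γ => ?_
    have := congrArg (fun x => c.repr x γ) h
    simp only [map_smul, Finsupp.smul_apply, smul_eq_mul] at this
    exact mul_left_cancel₀ PowerSeries.X_ne_zero this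
  have hcomm : ∀ (l l' : L) v, T l (T l' v) = T l' (T l v) := by
    intro l l' v
    apply hinj
    apply hcanc
    apply hcanc
    rw [← hTc, ← hsm, ← hTc, ← hTc, ← hsm, ← hTc, R.commTT]
  have hCX : ∀ l : κ, (PowerSeries.C (MvPowerSeries.X l) : TotalRing k κ) ∈ totFil k κ 1 := by
    intro l
    rw [mem_totFil_one, evalOrigin_eq, PowerSeries.coeff_zero_C, MvPowerSeries.constantCoeff_X]
  obtain ⟨s, hs, hs1⟩ := (completeFiltration_totFil.pi J).exists_flat (k := k)
    (D := fun l : L => ddt k (l : κ)) (T := T) (fun l f v => matrixOp_smul _ _ f v)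
    (fun l N v hv => by
      rw [CompleteFiltration.mem_piFil] at hv ⊢
      intro a
      rw [matrixOp_apply]
      refine add_mem (ddt_mem_totFil (hv a) _) (Submodule.sum_mem _ fun b _ => ?_)
      exact Ideal.mul_mem_left _ _ (completeFiltration_totFil.anti N.le_succ (hv b)))
    (y := fun l : L => PowerSeries.C (MvPowerSeries.X (l : κ)))
    (fun l l' => by
      rw [ddt_C]
      by_cases h : l = l'
      · subst h
        rw [MvPowerSeries.pderiv_X_self, map_one, if_pos rfl]
      · rw [MvPowerSeries.pderiv_X_of_ne (fun e => h (Subtype.ext e).symm), map_zero, if_neg h])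
    (fun l N v hv => by
      rw [CompleteFiltration.mem_piFil] at hv ⊢
      intro a
      rw [add_comm]
      exact mul_mem_totFil (hCX l) (hv a))
    hcomm (Pi.single ⟨β, rfl⟩ 1) (r := 0)
    (fun l => (completeFiltration_totFil.pi J).mem_zero _) Finset.univ
  refine ⟨incl s, ?_, hrepr' s, fun l hl => ?_⟩
  · have h1 : c β = incl (Pi.single ⟨β, rfl⟩ 1) := by
      rw [hincl, Finset.sum_eq_single ⟨β, rfl⟩]
      · simp
      · intro b _ hb
        rw [Pi.single_eq_of_ne hb, zero_smul]
      · simp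
    rw [h1, ← map_sub, hincl]
    refine Submodule.sum_mem _ fun a _ => Submodule.smul_mem_smul ?_ trivial
    exact mem_totFil_one.mp (CompleteFiltration.mem_piFil.mp hs1 a)
  · have h1 := hs ⟨l, hl⟩ (Finset.mem_univ _)
    have h2 := hTc ⟨l, hl⟩ s
    rw [h1, map_zero, smul_zero] at h2
    exact h2

/-- In the situation of `exists_flat_section`, there is a frame with the same value at the origin,
in which the connection is block diagonal and each section is flat along the coordinate fields of
the other blocks. -/
theorem exists_flat_frame (R : RegularForm k κ H) (c : Module.Basis κ (TotalRing k κ) H)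
    {blk : κ → ι} (hU : ∀ α β, blk α ≠ blk β → connMatrix c R.opU α β = 0)
    (hT : ∀ s α β, blk α ≠ blk β → connMatrix c (R.opT s) α β = 0)
    (hreg : ∀ l α β, blk l ≠ blk β → PowerSeries.constantCoeff (connMatrix c (R.opT l) α β) = 0) :
    ∃ d : Module.Basis κ (TotalRing k κ) H,
      (∀ β, d β - c β ∈ (originIdeal k κ • ⊤ : Submodule (TotalRing k κ) H)) ∧
      (∀ α β, blk α ≠ blk β → connMatrix d R.opU α β = 0) ∧
      (∀ s α β, blk α ≠ blk β → connMatrix d (R.opT s) α β = 0) ∧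
      ∀ l β, blk l ≠ blk β → R.opT l (d β) = 0 := by
  choose x hx0 hx1 hx2 using exists_flat_section R c hT hreg
  obtain ⟨d, hd⟩ := exists_basis_of_sub_mem c x hx0
  have hcd : ∀ α β, blk α ≠ blk β → c.repr (d β) α = 0 := fun α β h => by
    rw [hd, hx1 β α h]
  refine ⟨d, fun β => by rw [hd]; exact hx0 β, fun α β h => ?_, fun s α β h => ?_,
    fun l β h => by rw [hd]; exact hx2 β l h⟩
  · exact connMatrix_blockDiag c d hcd (by rw [map_zero, mul_zero]) R.leibnizU hU h
  · exact connMatrix_blockDiag c d hcd (by rw [map_zero, mul_zero]) (R.leibnizT s) (hT s) h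

end FlatFrame

/-! ### Frames of the fibre -/

section FibreBasis

variable {k : Type u} [Field k] {σ : Type w} {κ : Type*} {H : Type v} [AddCommGroup H]
  [Module (TotalRing k σ) H]

theorem fibre_smul_eq (f : TotalRing k σ) (x : Fibre k σ H) : f • x = evalOrigin k σ f • x := by
  obtain ⟨s, rfl⟩ := toFibre_surjective x
  rw [fibre_smul_def, ← sub_eq_zero, ← sub_smul, ← map_smul, toFibre_eq_zero]
  refine Submodule.smul_mem_smul ?_ trivial
  rw [originIdeal, RingHom.mem_ker, map_sub, evalOrigin_algebraMap, sub_self]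

/-- The values at the origin of a frame form a basis of the fibre. -/
noncomputable def fibreBasis (b : Module.Basis κ (TotalRing k σ) H) :
    Module.Basis κ k (Fibre k σ H) :=
  Module.Basis.mk (v := fun a => toFibre (b a))
    (by
      rw [linearIndependent_iff]
      intro c hc
      ext a
      have h1 : toFibre (k := k) (σ := σ) (H := H)
          (b.repr.symm (c.mapRange (algebraMap k (TotalRing k σ)) (map_zero _))) = 0 := by
        rw [← hc, Module.Basis.repr_symm_apply, Finsupp.linearCombination_apply,
          Finsupp.sum_mapRange_index (by simp), Finsupp.linearCombination_apply, Finsupp.sum,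
          Finsupp.sum, map_sum]
        exact Finset.sum_congr rfl fun i _ => map_smul _ _ _
      have h2 := repr_mem_originIdeal b (toFibre_eq_zero.mp h1) a
      rw [LinearEquiv.apply_symm_apply, Finsupp.mapRange_apply, originIdeal, RingHom.mem_ker,
        evalOrigin_algebraMap] at h2
      exact h2)
    (by
      intro x _
      obtain ⟨s, rfl⟩ := toFibre_surjective x
      rw [← b.linearCombination_repr s, Finsupp.linearCombination_apply, Finsupp.sum, map_sum]
      refine sum_mem fun a _ => ?_
      rw [map_smul, fibre_smul_eq]
      exact Submodule.smul_mem _ _ (Submodule.subset_span ⟨a, rfl⟩))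

theorem fibreBasis_apply (b : Module.Basis κ (TotalRing k σ) H) (a : κ) :
    fibreBasis b a = toFibre (b a) := by
  rw [fibreBasis, Module.Basis.mk_apply]

theorem fibreBasis_repr (b : Module.Basis κ (TotalRing k σ) H) (s : H) (a : κ) :
    (fibreBasis b).repr (toFibre s) a = evalOrigin k σ (b.repr s a) := by
  have h : toFibre (k := k) (σ := σ) s =
      (fibreBasis b).repr.symm ((b.repr s).mapRange (evalOrigin k σ) (map_zero _)) := by
    conv_lhs => rw [← b.linearCombination_repr s]
    rw [Module.Basis.repr_symm_apply, Finsupp.linearCombination_apply,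
      Finsupp.linearCombination_apply, Finsupp.sum_mapRange_index (by simp), Finsupp.sum,
      Finsupp.sum, map_sum]
    refine Finset.sum_congr rfl fun i _ => ?_
    rw [map_smul, fibre_smul_eq, fibreBasis_apply]
  rw [h, LinearEquiv.apply_symm_apply, Finsupp.mapRange_apply]

theorem FBundle.mu_toFibre [Fintype σ] (F : FBundle.{u, v, w} k σ) (p : σ → k) (s : F.H) :
    F.mu p (toFibre s) =
      toFibre (∑ l, algebraMap k (TotalRing k σ) (p l) • F.opT l s) := by
  rw [FBundle.mu, LinearMap.sum_apply, LinearMap.sum_apply, map_sum]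
  refine Finset.sum_congr rfl fun l _ => ?_
  rw [map_smul]
  rfl

/-- Over a frame indexed by the coordinates of `B`, injectivity of `v ↦ μ_b(v)(h)` suffices for
maximality. -/
theorem FBundle.isMaximal_of_injective [Fintype σ] (F : FBundle.{u, v, w} k σ)
    (b : Module.Basis σ (TotalRing k σ) F.H) (s : F.H)
    (hs : ∀ p : σ → k, (∑ l, algebraMap k (TotalRing k σ) (p l) • F.opT l s) ∈
      (originIdeal k σ • ⊤ : Submodule (TotalRing k σ) F.H) → p = 0) : F.IsMaximal := by
  refine ⟨toFibre s, ?_⟩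
  let L : (σ → k) →ₗ[k] F.fibre := (LinearMap.applyₗ (toFibre s)).comp F.mu
  have hinj : Function.Injective L := by
    rw [injective_iff_map_eq_zero]
    intro p hp
    refine hs p (toFibre_eq_zero.mp ?_)
    rw [← F.mu_toFibre]
    exact hp
  have : FiniteDimensional k F.fibre := (fibreBasis b).finiteDimensional_of_finite
  have hfr : Module.finrank k (σ → k) = Module.finrank k F.fibre := by
    rw [Module.finrank_eq_card_basis (fibreBasis b), Module.finrank_fintype_fun_eq_card]
  exact ⟨hinj, (LinearMap.injective_iff_surjective_of_finrank_eq_finrank hfr).mp hinj⟩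

end FibreBasis

/-! ### Descent to a factor -/

section Descent

variable {k : Type u} [Field k] {σ : Type*} {τ : Type w} {J : Type v} [Fintype J] {H : Type*}
  [AddCommGroup H] [Module (TotalRing k σ) H]

/-- The pullback along a coordinate projection of columns of functions, written in a family of
sections `v`. -/
noncomputable def pullColumn (e : τ ↪ σ) (v : J → H) : (J → TotalRing k τ) →+ H :=
  AddMonoidHom.mk' (fun x => ∑ a, projHom k e (x a) • v a) fun x y => by
    simp only [Pi.add_apply, map_add, add_smul, Finset.sum_add_distrib]

theorem pullColumn_apply (e : τ ↪ σ) (v : J → H) (x : J → TotalRing k τ) :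
    pullColumn e v x = ∑ a, projHom k e (x a) • v a :=
  rfl

theorem pullColumn_smul (e : τ ↪ σ) (v : J → H) (f : TotalRing k τ) (x : J → TotalRing k τ) :
    pullColumn e v (f • x) = projHom k e f • pullColumn e v x := by
  simp only [pullColumn_apply, Pi.smul_apply, smul_eq_mul, map_mul, mul_smul, Finset.smul_sum]

theorem pullColumn_single [DecidableEq J] (e : τ ↪ σ) (v : J → H) (a : J) :
    pullColumn (k := k) e v (Pi.single a 1) = v a := by
  rw [pullColumn_apply, Finset.sum_eq_single a]
  · simp
  · intro b _ hb
    simp [hb]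
  · simp

theorem pullColumn_injective (e : τ ↪ σ) {v : J → H} (hv : LinearIndependent (TotalRing k σ) v) :
    Function.Injective (pullColumn (k := k) e v) := by
  rw [injective_iff_map_eq_zero]
  intro x hx
  ext1 a
  exact (map_eq_zero_iff _ (projHom_injective e)).mp
    (Fintype.linearIndependent_iff.mp hv (fun a => projHom k e (x a)) hx a)

theorem apply_pullColumn (e : τ ↪ σ) (v : J → H) {δ : Derivation k (TotalRing k τ) (TotalRing k τ)}
    {δ' : Derivation k (TotalRing k σ) (TotalRing k σ)}
    (hδ : ∀ f, δ' (projHom k e f) = projHom k e (δ f)) {T : H →+ H}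
    (hT : ∀ (f : TotalRing k σ) (s : H), T (f • s) = δ' f • s + f • T s)
    {U : Matrix J J (TotalRing k τ)} (hU : ∀ b, T (v b) = ∑ a, projHom k e (U a b) • v a)
    (x : J → TotalRing k τ) : T (pullColumn e v x) = pullColumn e v (matrixOp δ U x) := by
  simp only [pullColumn_apply, map_sum, hT, hδ, hU, matrixOp_apply, map_add, add_smul,
    Finset.sum_add_distrib, map_mul, Finset.sum_smul, Finset.smul_sum]
  congr 1
  rw [Finset.sum_comm]
  refine Finset.sum_congr rfl fun a _ => Finset.sum_congr rfl fun b _ => ?_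
  rw [smul_smul, mul_comm]

/-- A family of independent sections whose connection matrices are pulled back along a coordinate
projection spans the pullback of an F-bundle on the smaller base. -/
theorem exists_descent [DecidableEq J] (R : RegularForm k σ H) (e : τ ↪ σ) {v : J → H}
    (hv : LinearIndependent (TotalRing k σ) v)
    {U : Matrix J J (TotalRing k τ)} (hU : ∀ b, R.opU (v b) = ∑ a, projHom k e (U a b) • v a)
    {T : τ → Matrix J J (TotalRing k τ)}
    (hT : ∀ l b, R.opT (e l) (v b) = ∑ a, projHom k e (T l a b) • v a) :
    ∃ (G : FBundle.{u, max u w v, w} k τ) (b : Module.Basis J (TotalRing k τ) G.H) (Ψ : G.H →+ H),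
      (∀ f x, Ψ (f • x) = projHom k e f • Ψ x) ∧ (∀ a, Ψ (b a) = v a) ∧
      (∀ x, R.opU (Ψ x) = Ψ (G.opU x)) ∧ ∀ l x, R.opT (e l) (Ψ x) = Ψ (G.opT l x) := by
  have hinj := pullColumn_injective e hv
  have hU' : ∀ x, R.opU (pullColumn e v x) =
      pullColumn e v (matrixOp (uVar k τ ^ 2 • ddu k τ) U x) :=
    apply_pullColumn e v (δ' := uVar k σ ^ 2 • ddu k σ) (fun f => by
      change uVar k σ ^ 2 * ddu k σ (projHom k e f) = projHom k e (uVar k τ ^ 2 * ddu k τ f)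
      rw [map_mul, map_pow, projHom_uVar, ddu_projHom]) R.leibnizU hU
  have hT' : ∀ l x, R.opT (e l) (pullColumn e v x) =
      pullColumn e v (matrixOp (uVar k τ • ddt k l) (T l) x) := fun l =>
    apply_pullColumn e v (δ' := uVar k σ • ddt k (e l)) (fun f => by
      change uVar k σ * ddt k (e l) (projHom k e f) = projHom k e (uVar k τ * ddt k l f)
      rw [map_mul, projHom_uVar, ddt_projHom_self]) (R.leibnizT (e l)) (hT l)
  let RG : RegularForm k τ (J → TotalRing k τ) :=
    { opU := matrixOp (uVar k τ ^ 2 • ddu k τ) U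
      opT := fun l => matrixOp (uVar k τ • ddt k l) (T l)
      leibnizU := matrixOp_smul _ _
      leibnizT := fun l => matrixOp_smul _ _
      commUT := fun l x => hinj (by
        rw [map_add, pullColumn_smul, ← hU', ← hT', ← hT', ← hU', R.commUT, projHom_uVar])
      commTT := fun l l' x => hinj (by rw [← hT', ← hT', ← hT', ← hT', R.commTT]) }
  exact ⟨RG.toFBundle, Pi.basisFun _ _, pullColumn e v, pullColumn_smul e v,
    fun a => (congrArg (pullColumn e v) (Pi.basisFun_apply _ _ a)).trans (pullColumn_single e v a),
    fun x => (hU' x).trans (congrArg (pullColumn e v) (RG.toFBundle_opU x).symm),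
    fun l x => (hT' l x).trans (congrArg (pullColumn e v) (RG.toFBundle_opT l x).symm)⟩

end Descent

/-! ### Frames of pullbacks and products -/

section PullbackFrame

variable {k : Type u} [Field k] {σ τ : Type*} (e : τ ↪ σ) {M : Type*} [AddCommGroup M]
  [Module (TotalRing k τ) M]

/-- The pullback `1 ⊗ m` of a section `m`. -/
noncomputable def pullSection : M →+ Pullback k e M :=
  letI := (projHom k e).toAlgebra
  AddMonoidHom.mk' (fun m => (1 : TotalRing k σ) ⊗ₜ[TotalRing k τ] m)
    fun _ _ => TensorProduct.tmul_add _ _ _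

theorem pullSection_smul (f : TotalRing k τ) (m : M) :
    pullSection (k := k) e (f • m) = projHom k e f • pullSection e m := by
  let := (projHom k e).toAlgebra
  change (1 : TotalRing k σ) ⊗ₜ[TotalRing k τ] (f • m) =
    projHom k e f • ((1 : TotalRing k σ) ⊗ₜ[TotalRing k τ] m)
  rw [← TensorProduct.smul_tmul, TensorProduct.smul_tmul', Algebra.smul_def, smul_eq_mul]
  rfl

/-- The frame of a pullback given by the pullbacks of the sections of a frame. -/
noncomputable def pullbackBasis {J : Type*} (b : Module.Basis J (TotalRing k τ) M) :
    Module.Basis J (TotalRing k σ) (Pullback k e M) :=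
  letI := (projHom k e).toAlgebra
  show Module.Basis J (TotalRing k σ) (TotalRing k σ ⊗[TotalRing k τ] M) from
    Algebra.TensorProduct.basis (TotalRing k σ) b

theorem pullbackBasis_apply {J : Type*} (b : Module.Basis J (TotalRing k τ) M) (a : J) :
    pullbackBasis e b a = pullSection e (b a) := by
  let := (projHom k e).toAlgebra
  exact Algebra.TensorProduct.basis_apply b a

theorem pullback_opU_pullSection (R : RegularForm k τ M) (m : M) :
    (R.pullback e).opU (pullSection e m) = pullSection e (R.opU m) := by
  let := (projHom k e).toAlgebra
  change (uVar k σ ^ 2 • ddu k σ) (1 : TotalRing k σ) ⊗ₜ[TotalRing k τ] m +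
    (1 : TotalRing k σ) ⊗ₜ[TotalRing k τ] R.opU m = _
  rw [Derivation.map_one_eq_zero, TensorProduct.zero_tmul, zero_add]
  rfl

theorem pullback_opT_pullSection (R : RegularForm k τ M) (s : σ) (m : M) :
    (R.pullback e).opT s (pullSection e m) = pullSection e (projOp e R s m) := by
  let := (projHom k e).toAlgebra
  change (uVar k σ • ddt k s) (1 : TotalRing k σ) ⊗ₜ[TotalRing k τ] m +
    (1 : TotalRing k σ) ⊗ₜ[TotalRing k τ] projOp e R s m = _
  rw [Derivation.map_one_eq_zero, TensorProduct.zero_tmul, zero_add]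
  rfl

end PullbackFrame

theorem projHom_algebraMap {k : Type u} [Field k] {σ τ : Type*} (e : τ ↪ σ) (c : k) :
    projHom k e (algebraMap k (TotalRing k τ) c) = algebraMap k (TotalRing k σ) c := by
  rw [algebraMap_totalRing, algebraMap_totalRing]
  simp [projHom]

theorem RegularForm.opT_mem {k : Type u} [Field k] {σ : Type w} {H : Type v} [AddCommGroup H]
    [Module (TotalRing k σ) H] (R : RegularForm k σ H) (s : σ) {x : H}
    (hx : x ∈ (originIdeal k σ • ⊤ : Submodule (TotalRing k σ) H)) :
    R.opT s x ∈ (originIdeal k σ • ⊤ : Submodule (TotalRing k σ) H) := by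
  have h := fibreOp_toFibre (fun f => uVar k σ * ddt k s f)
    (fun _ => Ideal.mul_mem_right _ _ uVar_mem_originIdeal) (R.opT s) (R.leibnizT s) x
  rw [toFibre_eq_zero.mpr hx, map_zero] at h
  exact toFibre_eq_zero.mp h.symm

/-- A semilinear map is determined by its values on a frame. -/
theorem eq_of_basis {A A' H H' J : Type*} [CommRing A] [CommRing A'] [AddCommGroup H] [Module A H]
    [AddCommGroup H'] [Module A' H'] (b : Module.Basis J A H) (φ : A →+* A') {P Q : H →+ H'}
    (hP : ∀ (f : A) (s : H), P (f • s) = φ f • P s) (hQ : ∀ (f : A) (s : H), Q (f • s) = φ f • Q s)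
    (h : ∀ a, P (b a) = Q (b a)) (x : H) : P x = Q x := by
  rw [← b.linearCombination_repr x, Finsupp.linearCombination_apply, Finsupp.sum, map_sum, map_sum]
  exact Finset.sum_congr rfl fun a _ => by rw [hP, hQ, h]

/-- Two operators with the same Leibniz rule are intertwined by a linear map as soon as they are so
on a frame. -/
theorem intertwine_of_basis {A H H' J : Type*} [CommRing A] [AddCommGroup H]
    [Module A H] [AddCommGroup H'] [Module A H'] (b : Module.Basis J A H) (e : H →ₗ[A] H')
    {δ : A → A} {T : H →+ H} {T' : H' →+ H'}
    (hT : ∀ (f : A) (s : H), T (f • s) = δ f • s + f • T s)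
    (hT' : ∀ (f : A) (s : H'), T' (f • s) = δ f • s + f • T' s)
    (h : ∀ a, T' (e (b a)) = e (T (b a))) (x : H) : T' (e x) = e (T x) := by
  have h1 := eq_of_basis b (RingHom.id A)
    (P := T'.comp e.toAddMonoidHom - e.toAddMonoidHom.comp T) (Q := 0)
    (fun f s => by
      change T' (e (f • s)) - e (T (f • s)) = f • (T' (e s) - e (T s))
      rw [map_smul, hT, hT', map_add, map_smul, map_smul, smul_sub, add_sub_add_left_eq_sub])
    (fun f s => (smul_zero f).symm) (fun a => sub_eq_zero.mpr (h a)) x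
  exact sub_eq_zero.mp h1

section ProductFrame

variable {k : Type u} [Field k] {ι : Type*} [Fintype ι] [DecidableEq ι] {τ : ι → Type w}

/-- The frame of a product of F-bundles obtained from frames of the factors. -/
noncomputable def prodBasis (G : ∀ i, FBundle.{u, v, w} k (τ i)) {J : ι → Type*}
    (b : ∀ i, Module.Basis (J i) (TotalRing k (τ i)) (G i).H) :
    Module.Basis (Σ i, J i) (TotalRing k (Σ i, τ i)) (FBundle.prod G).H :=
  show Module.Basis (Σ i, J i) (TotalRing k (Σ i, τ i)) (∀ i, FBundle.ProdSummand G i) from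
    Pi.basis fun i => pullbackBasis (Function.Embedding.sigmaMk (β := τ) i) (b i)

/-- The pullback of a section of a factor, as a section of the product. -/
noncomputable def prodSection (G : ∀ i, FBundle.{u, v, w} k (τ i)) (i : ι) :
    (G i).H →+ (FBundle.prod G).H :=
  AddMonoidHom.mk' (fun x => FBundle.prodIncl G i (pullSection _ x)) fun x y => by
    rw [map_add]
    exact Pi.single_add _ _ _

theorem prodSection_smul (G : ∀ i, FBundle.{u, v, w} k (τ i)) (i : ι) (f : TotalRing k (τ i))
    (x : (G i).H) : prodSection G i (f • x) =
      projHom k (Function.Embedding.sigmaMk (β := τ) i) f • prodSection G i x := by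
  change (Pi.single i (pullSection _ (f • x)) : ∀ j, FBundle.ProdSummand G j) = _
  rw [pullSection_smul]
  exact Pi.single_smul (f := fun i => FBundle.ProdSummand G i) i _ _

theorem prodBasis_apply (G : ∀ i, FBundle.{u, v, w} k (τ i)) {J : ι → Type*}
    (b : ∀ i, Module.Basis (J i) (TotalRing k (τ i)) (G i).H) (j : Σ i, J i) :
    prodBasis G b j = prodSection G j.1 (b j.1 j.2) := by
  refine (Pi.basis_apply _ j).trans ?_
  rw [pullbackBasis_apply]
  rfl

theorem prod_opU_prodSection (G : ∀ i, FBundle.{u, v, w} k (τ i)) (i : ι) (x : (G i).H) :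
    (FBundle.prod G).opU (prodSection G i x) = prodSection G i ((G i).opU x) := by
  refine (RegularForm.toFBundle_opU _ _).trans ?_
  change (fun j => ((G j).regularForm.pullback _).opU
    ((Pi.single i (pullSection _ x) : ∀ j, FBundle.ProdSummand G j) j)) =
      (Pi.single i (pullSection _ ((G i).opU x)) : ∀ j, FBundle.ProdSummand G j)
  ext1 j
  by_cases h : j = i
  · subst h
    rw [Pi.single_eq_same, Pi.single_eq_same, pullback_opU_pullSection]
    rfl
  · rw [Pi.single_eq_of_ne h, Pi.single_eq_of_ne h, map_zero]

theorem prod_opT_prodSection (G : ∀ i, FBundle.{u, v, w} k (τ i)) (i : ι) (s : Σ i, τ i)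
    (x : (G i).H) : (FBundle.prod G).opT s (prodSection G i x) =
      prodSection G i (projOp (Function.Embedding.sigmaMk (β := τ) i) (G i).regularForm s x) := by
  refine (RegularForm.toFBundle_opT _ _ _).trans ?_
  change (fun j => ((G j).regularForm.pullback _).opT s
    ((Pi.single i (pullSection _ x) : ∀ j, FBundle.ProdSummand G j) j)) =
      (Pi.single i (pullSection _ (projOp _ (G i).regularForm s x)) :
        ∀ j, FBundle.ProdSummand G j)
  ext1 j
  by_cases h : j = i
  · subst h
    rw [Pi.single_eq_same, Pi.single_eq_same, pullback_opT_pullSection]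
  · rw [Pi.single_eq_of_ne h, Pi.single_eq_of_ne h, map_zero]

theorem prod_opT_prodSection_self (G : ∀ i, FBundle.{u, v, w} k (τ i)) (i : ι) (l : τ i)
    (x : (G i).H) :
    (FBundle.prod G).opT ⟨i, l⟩ (prodSection G i x) = prodSection G i ((G i).opT l x) := by
  rw [prod_opT_prodSection]
  congr 1
  have h := Function.partialInv_left (Function.Embedding.sigmaMk (β := τ) i).injective l
  unfold projOp
  rw [show (⟨i, l⟩ : Σ i, τ i) = Function.Embedding.sigmaMk (β := τ) i l from rfl, h]
  rfl

theorem prod_opT_prodSection_of_ne (G : ∀ i, FBundle.{u, v, w} k (τ i)) (i : ι) (s : Σ i, τ i)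
    (hs : s.1 ≠ i) (x : (G i).H) : (FBundle.prod G).opT s (prodSection G i x) = 0 := by
  rw [prod_opT_prodSection, projOp, partialInv_of_notMem]
  · exact map_zero _
  · rintro ⟨l, rfl⟩
    exact hs rfl

/-- If frames of the F-bundles `G i` correspond to the blocks of a frame of `H`, compatibly with the
connections, then `H` is the product of the `G i`. -/
theorem exists_prod_equiv {H : Type*} [AddCommGroup H] [Module (TotalRing k (Σ i, τ i)) H]
    (R : RegularForm k (Σ i, τ i) H) (G : ∀ i, FBundle.{u, v, w} k (τ i)) {J : ι → Type*}
    (b : ∀ i, Module.Basis (J i) (TotalRing k (τ i)) (G i).H)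
    (d : Module.Basis (Σ i, J i) (TotalRing k (Σ i, τ i)) H) (Ψ : ∀ i, (G i).H →+ H)
    (hΨ : ∀ i f x, Ψ i (f • x) = projHom k (Function.Embedding.sigmaMk (β := τ) i) f • Ψ i x)
    (hd : ∀ i a, Ψ i (b i a) = d ⟨i, a⟩) (hU : ∀ i x, R.opU (Ψ i x) = Ψ i ((G i).opU x))
    (hT : ∀ i l x, R.opT ⟨i, l⟩ (Ψ i x) = Ψ i ((G i).opT l x))
    (hT' : ∀ i s, s.1 ≠ i → ∀ a, R.opT s (d ⟨i, a⟩) = 0) :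
    ∃ e : (FBundle.prod G).H ≃ₗ[TotalRing k (Σ i, τ i)] H,
      (∀ x, R.opU (e x) = e ((FBundle.prod G).opU x)) ∧
      (∀ s x, R.opT s (e x) = e ((FBundle.prod G).opT s x)) ∧
      ∀ i, (Set.range fun x : FBundle.ProdSummand G i => e (FBundle.prodIncl G i x)) =
        Submodule.span (TotalRing k (Σ i, τ i)) (Set.range fun a => d ⟨i, a⟩) := by
  let e := (prodBasis G b).equiv d (Equiv.refl _)
  have he : ∀ j, e (prodSection G j.1 (b j.1 j.2)) = d j := fun j => by
    rw [← prodBasis_apply, Module.Basis.equiv_apply, Equiv.refl_apply]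
  have heΨ : ∀ i x, e (prodSection G i x) = Ψ i x := fun i x =>
    eq_of_basis (b i) (projHom k (Function.Embedding.sigmaMk (β := τ) i))
      (P := e.toAddEquiv.toAddMonoidHom.comp (prodSection G i)) (Q := Ψ i)
      (fun f s => by
        change e (prodSection G i (f • s)) = _ • e (prodSection G i s)
        rw [prodSection_smul, map_smul])
      (hΨ i) (fun a => (he ⟨i, a⟩).trans (hd i a).symm) x
  refine ⟨e, ?_, fun s => ?_, fun i => ?_⟩
  · refine intertwine_of_basis (prodBasis G b) e.toLinearMap
      (FBundle.prod G).regularForm.leibnizU R.leibnizU fun j => ?_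
    change R.opU (e (prodBasis G b j)) = e ((FBundle.prod G).opU (prodBasis G b j))
    rw [prodBasis_apply, prod_opU_prodSection, heΨ, heΨ, hU]
  · refine intertwine_of_basis (prodBasis G b) e.toLinearMap
      ((FBundle.prod G).regularForm.leibnizT s) (R.leibnizT s) fun j => ?_
    change R.opT s (e (prodBasis G b j)) = e ((FBundle.prod G).opT s (prodBasis G b j))
    obtain ⟨i, a⟩ := j
    rw [prodBasis_apply]
    by_cases h : s.1 = i
    · obtain ⟨i', l⟩ := s
      obtain rfl : i' = i := h
      rw [prod_opT_prodSection_self, heΨ, heΨ, hT]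
    · rw [prod_opT_prodSection_of_ne G i s h, map_zero, heΨ, hd, hT' i s h]
  · let L : FBundle.ProdSummand G i →ₗ[TotalRing k (Σ i, τ i)] H :=
      e.toLinearMap.comp (LinearMap.single _ (FBundle.ProdSummand G) i)
    have hL : (Set.range fun x : FBundle.ProdSummand G i => e (FBundle.prodIncl G i x)) =
        LinearMap.range L := rfl
    rw [hL, LinearMap.range_eq_map, ← (pullbackBasis _ (b i)).span_eq, Submodule.map_span,
      ← Set.range_comp]
    congr 3
    ext1 a
    rw [Function.comp_apply, pullbackBasis_apply]
    exact he ⟨i, a⟩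

/-- In a flat frame indexed by the coordinates of `B`, the connection is the product of connections
that depend only on the coordinates of one block, and the factors are maximal if the connection
is. -/
theorem exists_prod_decomposition [CharZero k] [∀ i, Fintype (τ i)] [∀ i, DecidableEq (τ i)]
    {H : Type*} [AddCommGroup H] [Module (TotalRing k (Σ i, τ i)) H]
    (R : RegularForm k (Σ i, τ i) H) (d : Module.Basis (Σ i, τ i) (TotalRing k (Σ i, τ i)) H)
    (hU : ∀ α β, α.1 ≠ β.1 → connMatrix d R.opU α β = 0)
    (hT : ∀ s α β, α.1 ≠ β.1 → connMatrix d (R.opT s) α β = 0)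
    (hflat : ∀ l β, l.1 ≠ β.1 → R.opT l (d β) = 0) {h : H}
    (hh : ∀ p : (Σ i, τ i) → k, (∑ l, algebraMap k (TotalRing k (Σ i, τ i)) (p l) • R.opT l h) ∈
      (originIdeal k (Σ i, τ i) • ⊤ : Submodule (TotalRing k (Σ i, τ i)) H) → p = 0) :
    ∃ (G : ∀ i, FBundle.{u, max u w, w} k (τ i))
      (e : (FBundle.prod G).H ≃ₗ[TotalRing k (Σ i, τ i)] H),
      (∀ i, (G i).IsMaximal) ∧ (∀ x, R.opU (e x) = e ((FBundle.prod G).opU x)) ∧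
      (∀ s x, R.opT s (e x) = e ((FBundle.prod G).opT s x)) ∧
      ∀ i, (Set.range fun x : FBundle.ProdSummand G i => e (FBundle.prodIncl G i x)) =
        Submodule.span (TotalRing k (Σ i, τ i)) (Set.range fun a => d ⟨i, a⟩) := by
  have hrange : ∀ i (s : Σ i, τ i), s ∉ Set.range (Function.Embedding.sigmaMk (β := τ) i) →
      s.1 ≠ i := by
    rintro i ⟨j, l⟩ hs rfl
    exact hs ⟨l, rfl⟩
  -- the entries of the connection matrices depend only on the coordinates of their block
  have hdesc : ∀ {T : H →+ H}, (∀ α β, α.1 ≠ β.1 → connMatrix d T α β = 0) → ∀ i,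
      (∀ l b, l.1 ≠ i → R.opT l (T (d ⟨i, b⟩)) = 0) → ∃ U : Matrix (τ i) (τ i) (TotalRing k (τ i)),
        ∀ b, T (d ⟨i, b⟩) =
          ∑ a, projHom k (Function.Embedding.sigmaMk (β := τ) i) (U a b) • d ⟨i, a⟩ := by
    intro T hT i hTi
    have h1 : ∀ a b, ∃ g, projHom k (Function.Embedding.sigmaMk (β := τ) i) g =
        connMatrix d T ⟨i, a⟩ ⟨i, b⟩ := fun a b =>
      mem_range_projHom_of_ddt _ _ fun l hl =>
        ddt_connMatrix_eq_zero R d hflat hT (hrange i l hl) (hTi l b (hrange i l hl)) _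
    choose g hg using h1
    refine ⟨Matrix.of g, fun b => ?_⟩
    simp only [Matrix.of_apply, hg, connMatrix_apply]
    conv_lhs => rw [← d.sum_repr (T (d ⟨i, b⟩)), Fintype.sum_sigma]
    rw [Finset.sum_eq_single i]
    · intro j _ hj
      refine Finset.sum_eq_zero fun a _ => ?_
      have := hT ⟨j, a⟩ ⟨i, b⟩ hj
      rw [connMatrix_apply] at this
      rw [this, zero_smul]
    · exact fun hi => (hi (Finset.mem_univ i)).elim
  have hfac : ∀ i, ∃ (G : FBundle.{u, max u w, w} k (τ i))
      (b : Module.Basis (τ i) (TotalRing k (τ i)) G.H) (Ψ : G.H →+ H),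
      (∀ f x, Ψ (f • x) = projHom k (Function.Embedding.sigmaMk (β := τ) i) f • Ψ x) ∧
      (∀ a, Ψ (b a) = d ⟨i, a⟩) ∧ (∀ x, R.opU (Ψ x) = Ψ (G.opU x)) ∧
      ∀ l x, R.opT ⟨i, l⟩ (Ψ x) = Ψ (G.opT l x) := by
    intro i
    obtain ⟨U, hU'⟩ := hdesc hU i fun l b hl => by
      have h1 := R.commUT l (d ⟨i, b⟩)
      rw [hflat l ⟨i, b⟩ hl, map_zero, smul_zero, add_zero] at h1
      exact h1.symm
    choose T hT' using fun l => hdesc (hT ⟨i, l⟩) i fun l' b hl => by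
      rw [R.commTT, hflat l' ⟨i, b⟩ hl, map_zero]
    exact exists_descent R (Function.Embedding.sigmaMk (β := τ) i)
      (d.linearIndependent.comp (fun a => (⟨i, a⟩ : Σ i, τ i)) sigma_mk_injective) hU' hT'
  choose G b Ψ hΨ hΨd hΨU hΨT using hfac
  obtain ⟨e, he1, he2, he3⟩ := exists_prod_equiv R G b d Ψ hΨ hΨd hΨU hΨT
    fun i s hs a => hflat s ⟨i, a⟩ hs
  refine ⟨G, e, fun i => ?_, he1, he2, he3⟩
  -- the components of a cyclic vector are cyclic vectors of the factors
  let c : (Σ i, τ i) → k := fun α => evalOrigin k _ (d.repr h α)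
  have hΨc : ∀ (i : ι) (c : k) (x : (G i).H), Ψ i (algebraMap k (TotalRing k (τ i)) c • x) =
      algebraMap k (TotalRing k (Σ i, τ i)) c • Ψ i x := fun i c x => by
    rw [hΨ, projHom_algebraMap]
  have hTc : ∀ s (c : k) (x : H), R.opT s (algebraMap k (TotalRing k (Σ i, τ i)) c • x) =
      algebraMap k (TotalRing k (Σ i, τ i)) c • R.opT s x := fun s c x => by
    rw [R.leibnizT, Derivation.map_algebraMap, mul_zero, zero_smul, zero_add]
  have hc : h - ∑ α, algebraMap k (TotalRing k (Σ i, τ i)) (c α) • d α ∈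
      (originIdeal k (Σ i, τ i) • ⊤ : Submodule (TotalRing k (Σ i, τ i)) H) := by
    have h1 : h - ∑ α, algebraMap k (TotalRing k (Σ i, τ i)) (c α) • d α =
        ∑ α, (d.repr h α - algebraMap k (TotalRing k (Σ i, τ i)) (c α)) • d α := by
      simp only [sub_smul, Finset.sum_sub_distrib, d.sum_repr]
    rw [h1]
    refine sum_mem fun α _ => ?_
    refine Submodule.smul_mem_smul ?_ trivial
    rw [originIdeal, RingHom.mem_ker, map_sub, evalOrigin_algebraMap, sub_self]
  refine (G i).isMaximal_of_injective (b i)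
    (∑ a, algebraMap k (TotalRing k (τ i)) (c ⟨i, a⟩) • b i a) fun p hp => ?_
  have h1 : ∀ l : τ i, R.opT ⟨i, l⟩ h -
      Ψ i ((G i).opT l (∑ a, algebraMap k (TotalRing k (τ i)) (c ⟨i, a⟩) • b i a)) ∈
      (originIdeal k (Σ i, τ i) • ⊤ : Submodule (TotalRing k (Σ i, τ i)) H) := by
    intro l
    have h2 := R.opT_mem ⟨i, l⟩ hc
    rw [map_sub, map_sum, Fintype.sum_sigma, Finset.sum_eq_single i] at h2
    · rw [← hΨT, map_sum, map_sum]
      simpa only [hΨc, hΨd] using h2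
    · intro j _ hj
      refine Finset.sum_eq_zero fun a _ => ?_
      rw [hTc, hflat ⟨i, l⟩ ⟨j, a⟩ (Ne.symm hj), smul_zero]
    · exact fun hi => (hi (Finset.mem_univ i)).elim
  have h3 : Ψ i (∑ l, algebraMap k (TotalRing k (τ i)) (p l) • (G i).opT l
      (∑ a, algebraMap k (TotalRing k (τ i)) (c ⟨i, a⟩) • b i a)) ∈
      (originIdeal k (Σ i, τ i) • ⊤ : Submodule (TotalRing k (Σ i, τ i)) H) := by
    refine Submodule.smul_induction_on (p := fun x => Ψ i x ∈
      (originIdeal k (Σ i, τ i) • ⊤ : Submodule (TotalRing k (Σ i, τ i)) H)) hp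
      (fun f hf s _ => ?_) (fun x y hx hy => ?_)
    · rw [hΨ]
      refine Submodule.smul_mem_smul ?_ trivial
      rw [originIdeal, RingHom.mem_ker, evalOrigin_projHom]
      exact hf
    · rw [map_add]
      exact add_mem hx hy
  have h4 := hh (fun s => (Pi.single i p : ∀ j, τ j → k) s.1 s.2) (by
    rw [Fintype.sum_sigma, Finset.sum_eq_single i]
    · rw [map_sum] at h3
      have h5 := add_mem h3 (sum_mem fun l (_ : l ∈ Finset.univ) =>
        Submodule.smul_mem _ (algebraMap k (TotalRing k (Σ i, τ i)) (p l)) (h1 l))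
      rw [← Finset.sum_add_distrib] at h5
      refine (congrArg (· ∈ _) (Finset.sum_congr rfl fun l _ => ?_)).mp h5
      rw [Pi.single_eq_same, hΨc, smul_sub, add_sub_cancel]
    · intro j _ hj
      refine Finset.sum_eq_zero fun a _ => ?_
      rw [Pi.single_eq_of_ne hj, Pi.zero_apply, map_zero, zero_smul]
    · exact fun hi => (hi (Finset.mem_univ i)).elim)
  ext1 l
  have h5 := congrFun h4 ⟨i, l⟩
  rwa [Pi.single_eq_same] at h5

end ProductFrame

/-! ### Change of coordinates -/

section ChangeOfCoordinates

variable {k : Type u} [Field k] {σ κ : Type*}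

/-- An isomorphism between rings of functions on the bases, extended by `u ↦ u`. -/
noncomputable def totalEquiv (φ : BaseRing k κ ≃ₐ[k] BaseRing k σ) :
    TotalRing k κ ≃+* TotalRing k σ :=
  RingEquiv.ofRingHom (PowerSeries.map (φ : BaseRing k κ →+* BaseRing k σ))
    (PowerSeries.map (φ.symm : BaseRing k σ →+* BaseRing k κ))
    (by
      ext f n : 2
      simp only [RingHom.comp_apply, PowerSeries.coeff_map, RingHom.id_apply]
      exact φ.apply_symm_apply _)
    (by
      ext f n : 2
      simp only [RingHom.comp_apply, PowerSeries.coeff_map, RingHom.id_apply]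
      exact φ.symm_apply_apply _)

theorem totalEquiv_apply (φ : BaseRing k κ ≃ₐ[k] BaseRing k σ) (f : TotalRing k κ) :
    totalEquiv φ f = PowerSeries.map (φ : BaseRing k κ →+* BaseRing k σ) f :=
  rfl

theorem coeff_totalEquiv (φ : BaseRing k κ ≃ₐ[k] BaseRing k σ) (f : TotalRing k κ) (n : ℕ) :
    PowerSeries.coeff n (totalEquiv φ f) = φ (PowerSeries.coeff n f) := by
  rw [totalEquiv_apply, PowerSeries.coeff_map]
  rfl

theorem totalEquiv_uVar (φ : BaseRing k κ ≃ₐ[k] BaseRing k σ) :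
    totalEquiv φ (uVar k κ) = uVar k σ := by
  rw [totalEquiv_apply, PowerSeries.map_X]

theorem totalEquiv_algebraMap (φ : BaseRing k κ ≃ₐ[k] BaseRing k σ) (c : k) :
    totalEquiv φ (algebraMap k (TotalRing k κ) c) = algebraMap k (TotalRing k σ) c := by
  rw [algebraMap_totalRing, algebraMap_totalRing, totalEquiv_apply, PowerSeries.map_C]
  exact congrArg PowerSeries.C (φ.commutes c)

theorem ddu_totalEquiv (φ : BaseRing k κ ≃ₐ[k] BaseRing k σ) (f : TotalRing k κ) :
    ddu k σ (totalEquiv φ f) = totalEquiv φ (ddu k κ f) := by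
  ext1 n
  simp only [coeff_ddu, coeff_totalEquiv, map_mul, map_add, map_natCast, map_one]

variable {H : Type*} [AddCommGroup H] [Module (TotalRing k σ) H]

theorem mem_originIdeal_totalEquiv (φ : BaseRing k κ ≃ₐ[k] BaseRing k σ)
    (hφ0 : ∀ a, MvPowerSeries.constantCoeff (φ a) = MvPowerSeries.constantCoeff a)
    {g : TotalRing k κ} (hg : g ∈ originIdeal k κ) : totalEquiv φ g ∈ originIdeal k σ := by
  rw [originIdeal, RingHom.mem_ker, evalOrigin_eq] at hg ⊢
  rw [coeff_totalEquiv, hφ0, hg]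

/-- Sections that vanish at the origin for the module structure in the new coordinates do so for the
original one. -/
theorem mem_originIdeal_smul_of_smul [Module (TotalRing k κ) H]
    (φ : BaseRing k κ ≃ₐ[k] BaseRing k σ)
    (hsmul : ∀ (f : TotalRing k κ) (x : H), f • x = totalEquiv φ f • x)
    (hφ0 : ∀ a, MvPowerSeries.constantCoeff (φ a) = MvPowerSeries.constantCoeff a) {x : H}
    (hx : x ∈ (originIdeal k κ • ⊤ : Submodule (TotalRing k κ) H)) :
    x ∈ (originIdeal k σ • ⊤ : Submodule (TotalRing k σ) H) := by
  refine Submodule.smul_induction_on (p := fun x =>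
    x ∈ (originIdeal k σ • ⊤ : Submodule (TotalRing k σ) H)) hx (fun f hf s _ => ?_)
    (fun x y hx hy => add_mem hx hy)
  rw [hsmul]
  exact Submodule.smul_mem_smul (mem_originIdeal_totalEquiv φ hφ0 hf) trivial

/-- A frame, as a frame over the ring of functions in other coordinates. -/
noncomputable def changeBasis {J : Type*} [Module (TotalRing k κ) H]
    (φ : BaseRing k κ ≃ₐ[k] BaseRing k σ)
    (hsmul : ∀ (f : TotalRing k κ) (x : H), f • x = totalEquiv φ f • x)
    (c : Module.Basis J (TotalRing k σ) H) : Module.Basis J (TotalRing k κ) H :=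
  c.mapCoeffs (totalEquiv φ).symm fun f x => by rw [hsmul, RingEquiv.apply_symm_apply]

theorem changeBasis_apply {J : Type*} [Module (TotalRing k κ) H]
    (φ : BaseRing k κ ≃ₐ[k] BaseRing k σ)
    (hsmul : ∀ (f : TotalRing k κ) (x : H), f • x = totalEquiv φ f • x)
    (c : Module.Basis J (TotalRing k σ) H) (a : J) : changeBasis φ hsmul c a = c a :=
  Module.Basis.mapCoeffs_apply _ _ _ _

theorem totalEquiv_connMatrix {J : Type*} [Fintype J] [Module (TotalRing k κ) H]
    (φ : BaseRing k κ ≃ₐ[k] BaseRing k σ)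
    (hsmul : ∀ (f : TotalRing k κ) (x : H), f • x = totalEquiv φ f • x)
    (c : Module.Basis J (TotalRing k σ) H) (T : H →+ H) (α β : J) :
    totalEquiv φ (connMatrix (changeBasis φ hsmul c) T α β) = connMatrix c T α β := by
  rw [connMatrix_apply, connMatrix_apply, changeBasis_apply]
  conv_rhs => rw [← (changeBasis φ hsmul c).sum_repr (T (c β))]
  simp only [hsmul, changeBasis_apply]
  rw [c.repr_sum_self]

variable [Fintype σ] [Fintype κ] [DecidableEq κ]

/-- The columns of the inverse Jacobian matrix are the coordinate fields of the new coordinates. -/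
theorem sum_ddt_totalEquiv (φ : BaseRing k κ ≃ₐ[k] BaseRing k σ)
    {f : κ → BaseRing k σ} {G : Matrix σ κ (BaseRing k σ)}
    (hφ : ∀ s a, MvPowerSeries.pderiv k s (φ a) =
      ∑ l, MvPowerSeries.pderiv k s (f l) * φ (MvPowerSeries.pderiv k l a))
    (hG : (Matrix.of fun l s => MvPowerSeries.pderiv k s (f l)) * G = 1) (l : κ)
    (g : TotalRing k κ) :
    ∑ s, PowerSeries.C (G s l) * ddt k s (totalEquiv φ g) = totalEquiv φ (ddt k l g) := by
  ext1 n
  simp only [map_sum, PowerSeries.coeff_C_mul, coeff_ddt, coeff_totalEquiv, hφ, Finset.mul_sum]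
  rw [Finset.sum_comm, Finset.sum_eq_single l]
  · have h := congrFun (congrFun hG l) l
    rw [Matrix.mul_apply, Matrix.one_apply_eq] at h
    conv_rhs => rw [← one_mul (φ (MvPowerSeries.pderiv k l (PowerSeries.coeff n g))), ← h,
      Finset.sum_mul]
    exact Finset.sum_congr rfl fun s _ => by rw [Matrix.of_apply]; ring
  · intro l' _ hl'
    have h := congrFun (congrFun hG l') l
    rw [Matrix.mul_apply, Matrix.one_apply_ne hl'] at h
    rw [← zero_mul (φ (MvPowerSeries.pderiv k l' (PowerSeries.coeff n g))), ← h, Finset.sum_mul]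
    exact Finset.sum_congr rfl fun s _ => by rw [Matrix.of_apply]; ring
  · simp

variable [DecidableEq σ]

/-- Coordinate vector fields commute. -/
theorem bracket_inverse_jacobian {f : κ → BaseRing k σ} {G : Matrix σ κ (BaseRing k σ)}
    (hG : (Matrix.of fun l s => MvPowerSeries.pderiv k s (f l)) * G = 1)
    (hG' : G * (Matrix.of fun l s => MvPowerSeries.pderiv k s (f l)) = 1) (l l' : κ) :
    bracket (fun s => G s l) (fun s => G s l') = 0 := by
  have h1 : ∀ l α, vectorField (fun s => G s l) (f α) = (1 : Matrix κ κ (BaseRing k σ)) α l := by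
    intro l α
    rw [vectorField_apply, ← hG, Matrix.mul_apply]
    exact Finset.sum_congr rfl fun s _ => by rw [Matrix.of_apply, mul_comm]
  have h2 : ∀ l l' α, vectorField (fun s => G s l) ((1 : Matrix κ κ (BaseRing k σ)) α l') = 0 := by
    intro l l' α
    rw [Matrix.one_apply]
    split_ifs
    · exact Derivation.map_one_eq_zero _
    · exact map_zero _
  have h3 : (Matrix.of fun l s => MvPowerSeries.pderiv k s (f l)).mulVec
      (bracket (fun s => G s l) (fun s => G s l')) = 0 := by
    ext1 α
    have h4 := vectorField_bracket (fun s => G s l) (fun s => G s l') (f α)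
    rw [h1, h1, h2, h2, sub_self, vectorField_apply] at h4
    rw [Matrix.mulVec, dotProduct, Pi.zero_apply, ← h4]
    exact Finset.sum_congr rfl fun s _ => by rw [Matrix.of_apply, mul_comm]
  have h4 := congrArg G.mulVec h3
  rwa [Matrix.mulVec_mulVec, hG', Matrix.one_mulVec, Matrix.mulVec_zero] at h4

/-- A regular connection on a module over `k⟦t, u⟧`, written in new coordinates: the covariant
derivatives along the new coordinate fields are those along the columns of the inverse Jacobian
matrix. The module structure over the new ring of functions is given by restriction of scalars. -/
noncomputable def RegularForm.changeCoordinates (R : RegularForm k σ H) [Module (TotalRing k κ) H]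
    (φ : BaseRing k κ ≃ₐ[k] BaseRing k σ)
    (hsmul : ∀ (f : TotalRing k κ) (x : H), f • x = totalEquiv φ f • x)
    {f : κ → BaseRing k σ} {G : Matrix σ κ (BaseRing k σ)}
    (hφ : ∀ s a, MvPowerSeries.pderiv k s (φ a) =
      ∑ l, MvPowerSeries.pderiv k s (f l) * φ (MvPowerSeries.pderiv k l a))
    (hG : (Matrix.of fun l s => MvPowerSeries.pderiv k s (f l)) * G = 1)
    (hG' : G * (Matrix.of fun l s => MvPowerSeries.pderiv k s (f l)) = 1) :
    RegularForm k κ H where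
  opU := R.opU
  opT l := R.along fun s => G s l
  leibnizU g x := by
    rw [hsmul, hsmul, hsmul, R.leibnizU, ddu_totalEquiv, map_mul, map_pow, totalEquiv_uVar]
  leibnizT l g x := by
    rw [hsmul, hsmul, hsmul, R.along_smul, sum_ddt_totalEquiv φ hφ hG, map_mul, totalEquiv_uVar]
  commUT l x := by rw [hsmul, totalEquiv_uVar, R.opU_along]
  commTT l l' x := by
    rw [← sub_eq_zero, R.along_comm, bracket_inverse_jacobian hG hG', R.along_apply]
    simp

end ChangeOfCoordinates

/-! ### The decomposition attached to an adapted frame -/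

section AdaptedFrame

universe w'

variable {k : Type u} [Field k] {σ : Type w} [Fintype σ] [DecidableEq σ]

/-- The matrix, in frames, of the isomorphism `v ↦ μ_b(v)(h)` has an inverse. -/
theorem FBundle.IsMaximal.exists_inverse {κ : Type*} [Fintype κ] [DecidableEq κ]
    {F : FBundle.{u, v, w} k σ} (hF : F.IsMaximal) (c : Module.Basis κ (TotalRing k σ) F.H) :
    ∃ (h : F.H) (G₀ : Matrix σ κ k),
      (∀ p : σ → k, (∑ l, algebraMap k (TotalRing k σ) (p l) • F.opT l h) ∈
        (originIdeal k σ • ⊤ : Submodule (TotalRing k σ) F.H) → p = 0) ∧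
      (Matrix.of fun β s => ∑ γ, evalOrigin k σ (connMatrix c (F.opT s) β γ) *
        evalOrigin k σ (c.repr h γ)) * G₀ = 1 ∧
      G₀ * (Matrix.of fun β s => ∑ γ, evalOrigin k σ (connMatrix c (F.opT s) β γ) *
        evalOrigin k σ (c.repr h γ)) = 1 := by
  obtain ⟨h', hbij⟩ := hF
  obtain ⟨h, rfl⟩ := toFibre_surjective h'
  let L : (σ → k) ≃ₗ[k] F.fibre :=
    LinearEquiv.ofBijective ((LinearMap.applyₗ (toFibre h)).comp F.mu) hbij
  have hL : ∀ p, L p = toFibre (∑ l, algebraMap k (TotalRing k σ) (p l) • F.opT l h) :=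
    fun p => F.mu_toFibre p h
  have hE : (Matrix.of fun β s => ∑ γ, evalOrigin k σ (connMatrix c (F.opT s) β γ) *
        evalOrigin k σ (c.repr h γ)) =
      LinearMap.toMatrix (Pi.basisFun k σ) (fibreBasis c) L.toLinearMap := by
    ext β s
    have h1 : L (Pi.basisFun k σ s) = toFibre (F.opT s h) := by
      rw [hL, Finset.sum_eq_single s]
      · simp
      · intro l _ hl
        simp [hl]
      · simp
    have h2 : c.repr (F.opT s h) β = uVar k σ * ddt k s (c.repr h β) +
        ∑ γ, connMatrix c (F.opT s) β γ * c.repr h γ :=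
      repr_of_leibniz c (F.regularForm.leibnizT s) h β
    rw [LinearMap.toMatrix_apply, LinearEquiv.coe_coe, h1, fibreBasis_repr, h2, map_add, map_mul,
      show evalOrigin k σ (uVar k σ) = 0 from uVar_mem_originIdeal, zero_mul, zero_add, map_sum]
    simp only [map_mul, Matrix.of_apply]
  refine ⟨h, LinearMap.toMatrix (fibreBasis c) (Pi.basisFun k σ) L.symm.toLinearMap,
    fun p hp => ?_, ?_, ?_⟩
  · rw [← toFibre_eq_zero, ← hL] at hp
    exact L.map_eq_zero_iff.mp hp
  · rw [hE, ← LinearMap.toMatrix_comp, LinearEquiv.comp_coe, LinearEquiv.symm_trans_self,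
      LinearEquiv.refl_toLinearMap, LinearMap.toMatrix_id]
  · rw [hE, ← LinearMap.toMatrix_comp, LinearEquiv.comp_coe, LinearEquiv.self_trans_symm,
      LinearEquiv.refl_toLinearMap, LinearMap.toMatrix_id]

variable {ι : Type*} [Fintype ι] [DecidableEq ι] {τ : ι → Type w'} [∀ i, Fintype (τ i)]
  [∀ i, DecidableEq (τ i)]

/-- A maximal F-bundle with a frame in which `∇_{u² ∂_u}` is block diagonal at the origin, without
intertwiners between different blocks, is isomorphic to a product of maximal F-bundles, whose fibres
at the origin are spanned by the blocks of the frame. -/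
theorem FBundle.IsMaximal.exists_iso_prod [CharZero k] {F : FBundle.{u, v, w} k σ}
    (hF : F.IsMaximal) (b : Module.Basis (Σ i, τ i) (TotalRing k σ) F.H)
    (hU0 : ∀ α β, α.1 ≠ β.1 → evalOrigin k σ (connMatrix b F.opU α β) = 0)
    (hU : ∀ X : Matrix (Σ i, τ i) (Σ i, τ i) k, (∀ α β, α.1 = β.1 → X α β = 0) →
      (∀ α β, α.1 ≠ β.1 → ((evalOrigin k σ).mapMatrix (connMatrix b F.opU) * X) α β =
        (X * (evalOrigin k σ).mapMatrix (connMatrix b F.opU)) α β) → X = 0) :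
    ∃ (G : ∀ i, FBundle.{u, max u w', w'} k (τ i)) (e : F.Iso (FBundle.prod G)),
      (∀ i, (G i).IsMaximal) ∧
      ∀ i, (Set.range fun x : FBundle.ProdSummand G i =>
          toFibre (k := k) (σ := σ) (e.sections (FBundle.prodIncl G i x))) =
        (Submodule.span k (Set.range fun a => toFibre (k := k) (σ := σ) (b ⟨i, a⟩)) :
          Set F.fibre) := by
  obtain ⟨c, hcb, hcU, hcT⟩ := RegularForm.exists_blockDiag_basis F.regularForm b hU0 hU
  obtain ⟨h, G₀, hh, hG₀, hG₀'⟩ := hF.exists_inverse c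
  obtain ⟨f, J, hf0, hJ, hJ', hreg⟩ :=
    exists_coordinates F.regularForm c hcT (fun γ => evalOrigin k σ (c.repr h γ)) hG₀ hG₀'
  -- from here on `H` is also a module over the functions in the coordinates `f`
  have hf := MvPowerSeries.hasSubst_of_constantCoeff_zero hf0
  let φ : BaseRing k (Σ i, τ i) ≃ₐ[k] BaseRing k σ :=
    AlgEquiv.ofBijective (MvPowerSeries.substAlgHom hf) (substAlgHom_bijective hf hf0 hJ hJ')
  have hφ0 : ∀ a, MvPowerSeries.constantCoeff (φ a) = MvPowerSeries.constantCoeff a :=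
    constantCoeff_substAlgHom hf hf0
  have hφ : ∀ s a, MvPowerSeries.pderiv k s (φ a) =
      ∑ l, MvPowerSeries.pderiv k s (f l) * φ (MvPowerSeries.pderiv k l a) :=
    pderiv_substAlgHom hf hf0
  have hφX : ∀ l, φ (MvPowerSeries.X l) = f l := MvPowerSeries.substAlgHom_X hf
  let : Module (TotalRing k (Σ i, τ i)) F.H :=
    Module.compHom F.H (totalEquiv φ : TotalRing k (Σ i, τ i) →+* TotalRing k σ)
  have hsmul : ∀ (g : TotalRing k (Σ i, τ i)) (x : F.H), g • x = totalEquiv φ g • x :=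
    fun _ _ => rfl
  let R := F.regularForm.changeCoordinates φ hsmul hφ hJ hJ'
  have hRT : ∀ l x, R.opT l x = ∑ s, (PowerSeries.C (J s l) : TotalRing k σ) • F.opT s x :=
    fun _ _ => rfl
  have hzero : ∀ {T : F.H →+ F.H} {α β}, connMatrix c T α β = 0 →
      connMatrix (changeBasis φ hsmul c) T α β = 0 := fun {T α β} hT => by
    rw [← (totalEquiv φ).map_eq_zero_iff, totalEquiv_connMatrix, hT]
  obtain ⟨d, hdc, hdU, hdT, hflat⟩ := exists_flat_frame R (changeBasis φ hsmul c)
    (blk := Sigma.fst) (fun α β hαβ => hzero (hcU α β hαβ))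
    (fun l α β hαβ => hzero (by
      change c.repr (∑ s, (PowerSeries.C (J s l) : TotalRing k σ) • F.opT s (c β)) α = 0
      rw [map_sum, Finsupp.finsetSum_apply]
      refine Finset.sum_eq_zero fun s _ => ?_
      rw [map_smul, Finsupp.smul_apply, smul_eq_mul]
      exact mul_eq_zero_of_right _ (hcT s α β hαβ)))
    (fun l α β hlβ => by
      have h1 := hreg l α β hlβ
      rw [← constantCoeff_connMatrix_along] at h1
      have h2 : PowerSeries.constantCoeff (totalEquiv φ
          (connMatrix (changeBasis φ hsmul c) (R.opT l) α β)) = 0 := by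
        rw [totalEquiv_connMatrix]
        exact h1
      rw [← PowerSeries.coeff_zero_eq_constantCoeff_apply, coeff_totalEquiv,
        PowerSeries.coeff_zero_eq_constantCoeff_apply] at h2
      exact (map_eq_zero_iff φ φ.injective).mp h2)
  -- a change of coordinates acts on tangent vectors at the origin by the matrix `J₀`, which is
  -- invertible, so that `h` is still a cyclic vector
  have hmax : ∀ p : (Σ i, τ i) → k,
      (∑ l, algebraMap k (TotalRing k (Σ i, τ i)) (p l) • R.opT l h) ∈
        (originIdeal k (Σ i, τ i) • ⊤ : Submodule (TotalRing k (Σ i, τ i)) F.H) → p = 0 := by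
    intro p hp
    have h1 := toFibre_eq_zero.mpr (mem_originIdeal_smul_of_smul φ hsmul hφ0 hp)
    let J₀ : Matrix σ (Σ i, τ i) k := J.map MvPowerSeries.constantCoeff
    have h2 : J₀.mulVec p = 0 := by
      refine hh _ (toFibre_eq_zero.mp (Eq.trans ?_ h1))
      simp only [map_sum, map_smul, hsmul, totalEquiv_algebraMap, hRT, fibre_smul_eq,
        evalOrigin_algebraMap, Finset.smul_sum, Matrix.mulVec, dotProduct, Finset.sum_smul]
      rw [Finset.sum_comm]
      refine Finset.sum_congr rfl fun l _ => Finset.sum_congr rfl fun s _ => ?_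
      rw [smul_smul, mul_comm]
      rfl
    have h3 : (Matrix.of fun l s => MvPowerSeries.pderiv k s (f l)).map
        MvPowerSeries.constantCoeff * J₀ = 1 := by
      rw [← Matrix.map_mul, hJ, Matrix.map_one _ (map_zero _) (map_one _)]
    rw [← Matrix.one_mulVec p, ← h3, ← Matrix.mulVec_mulVec, h2, Matrix.mulVec_zero]
  obtain ⟨G, e, hG, heU, heT, hrange⟩ :=
    exists_prod_decomposition R d hdU hdT hflat hmax
  refine ⟨G,
    { base := φ
      sections := e.toAddEquiv
      map_smul := fun a s => e.map_smul a s
      map_opU := heU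
      map_opT := fun i s => ?_ }, hG, fun i => ?_⟩
  -- the coordinate fields `∂_{t_i}` in terms of the columns of the inverse Jacobian matrix `J`
  · have h1 : ∀ l, e ((FBundle.prod G).opT l s) =
        ∑ s', (PowerSeries.C (J s' l) : TotalRing k σ) • F.opT s' (e s) := fun l => by
      rw [← heT, hRT]
    change F.opT i (e s) = ∑ l, (PowerSeries.C (MvPowerSeries.pderiv k i
      (φ (MvPowerSeries.X l))) : TotalRing k σ) • e ((FBundle.prod G).opT l s)
    simp only [h1, hφX, Finset.smul_sum, smul_smul, ← map_mul]
    rw [Finset.sum_comm]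
    simp only [← Finset.sum_smul, ← map_sum]
    have h2 : ∀ s', ∑ l, MvPowerSeries.pderiv k i (f l) * J s' l =
        (1 : Matrix σ σ (BaseRing k σ)) s' i := fun s' => by
      rw [← hJ', Matrix.mul_apply]
      exact Finset.sum_congr rfl fun l _ => mul_comm _ _
    simp only [h2]
    rw [Finset.sum_eq_single i]
    · rw [Matrix.one_apply_eq, map_one, one_smul]
    · intro s' _ hs'
      rw [Matrix.one_apply_ne hs', map_zero, zero_smul]
    · simp
  · have h1 : ∀ a, toFibre (k := k) (σ := σ) (d ⟨i, a⟩) = toFibre (b ⟨i, a⟩) := fun a => by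
      rw [← sub_eq_zero, ← map_sub, toFibre_eq_zero, ← sub_add_sub_cancel _ (c ⟨i, a⟩)]
      refine add_mem ?_ (hcb _)
      have h2 := mem_originIdeal_smul_of_smul φ hsmul hφ0 (hdc ⟨i, a⟩)
      rwa [changeBasis_apply] at h2
    have h2 : (Set.range fun x : FBundle.ProdSummand G i =>
        toFibre (k := k) (σ := σ) (e (FBundle.prodIncl G i x))) =
        toFibre (k := k) (σ := σ) '' (Submodule.span (TotalRing k (Σ i, τ i))
          (Set.range fun a => d ⟨i, a⟩) : Set F.H) := by
      rw [← hrange i, ← Set.range_comp]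
      rfl
    refine h2.trans ?_
    simp only [← h1]
    ext x
    constructor
    · rintro ⟨y, hy, rfl⟩
      refine Submodule.span_induction (p := fun y _ => toFibre (k := k) (σ := σ) y ∈
        Submodule.span k (Set.range fun a => toFibre (k := k) (σ := σ) (d ⟨i, a⟩)))
        ?_ ?_ ?_ ?_ hy
      · rintro _ ⟨a, rfl⟩
        exact Submodule.subset_span ⟨a, rfl⟩
      · rw [map_zero]
        exact zero_mem _
      · intro y z _ _ hy hz
        rw [map_add]
        exact add_mem hy hz
      · intro g y _ hy
        rw [hsmul, map_smul, fibre_smul_eq]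
        exact Submodule.smul_mem _ _ hy
    · intro hx
      refine Submodule.span_induction (p := fun x _ => x ∈ toFibre (k := k) (σ := σ) ''
        (Submodule.span (TotalRing k (Σ i, τ i)) (Set.range fun a => d ⟨i, a⟩) : Set F.H))
        ?_ ?_ ?_ ?_ hx
      · rintro _ ⟨a, rfl⟩
        exact ⟨_, Submodule.subset_span ⟨a, rfl⟩, rfl⟩
      · exact ⟨0, zero_mem _, map_zero _⟩
      · rintro _ _ _ _ ⟨y, hy, rfl⟩ ⟨z, hz, rfl⟩
        exact ⟨y + z, add_mem hy hz, map_add _ _ _⟩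
      · rintro t _ _ ⟨y, hy, rfl⟩
        refine ⟨algebraMap k _ t • y, Submodule.smul_mem _ _ hy, ?_⟩
        rw [hsmul, totalEquiv_algebraMap, map_smul, fibre_smul_def]

end AdaptedFrame

/-! ### Adapted frames from a spectral decomposition of the fibre -/

section Spectral

variable {k : Type u} [Field k]

/-- Every basis of the fibre at the origin lifts to a frame: the module is free over a local ring,
and the determinant of any lift in a frame is a unit at the origin. -/
theorem exists_basis_of_fibre {σ : Type w} {κ : Type*} [Fintype κ] {H : Type v} [AddCommGroup H]
    [Module (TotalRing k σ) H] [Module.Finite (TotalRing k σ) H]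
    [Module.Projective (TotalRing k σ) H] (y : Module.Basis κ k (Fibre k σ H)) :
    ∃ b : Module.Basis κ (TotalRing k σ) H, ∀ a, toFibre (b a) = y a := by
  classical
  have hloc : IsLocalRing (TotalRing k σ) :=
    inferInstanceAs (IsLocalRing (MvPowerSeries Unit (MvPowerSeries σ k)))
  have hfree : Module.Free (TotalRing k σ) H := Module.free_of_flat_of_isLocalRing
  let b₀ := Module.Free.chooseBasis (TotalRing k σ) H
  let b₁ := b₀.reindex ((fibreBasis b₀).indexEquiv y)
  choose z hz using fun a => toFibre_surjective (y a)
  have hdet : evalOrigin k σ (b₁.det z) = (fibreBasis b₁).det y := by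
    rw [Module.Basis.det_apply, Module.Basis.det_apply, RingHom.map_det]
    congr 1
    ext α β
    rw [RingHom.mapMatrix_apply, Matrix.map_apply, Module.Basis.toMatrix_apply,
      Module.Basis.toMatrix_apply, ← hz, fibreBasis_repr]
  have hunit : IsUnit (b₁.det z) := by
    refine isUnit_of_isUnit_evalOrigin _ ?_
    rw [hdet]
    exact Module.Basis.isUnit_det _ _
  obtain ⟨h1, h2⟩ := (b₁.is_basis_iff_det).mpr hunit
  exact ⟨Module.Basis.mk h1 h2.ge, fun a => by rw [Module.Basis.mk_apply, hz]⟩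

theorem mem_geometricSpectrum {V : Type v} [AddCommGroup V] [Module k V] [FiniteDimensional k V]
    (f : Module.End k V) {a : AlgebraicClosure k} (ha : Polynomial.aeval a f.charpoly = 0) :
    a ∈ geometricSpectrum f := by
  rw [geometricSpectrum, Module.End.mem_spectrum_iff_isRoot_charpoly, LinearMap.charpoly_baseChange,
    Polynomial.IsRoot, Polynomial.eval_map_algebraMap]
  exact ha

/-- Endomorphisms with disjoint spectra over an algebraic closure have coprime characteristic
polynomials. -/
theorem isCoprime_charpoly_of_disjoint {V V' : Type v} [AddCommGroup V] [Module k V]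
    [FiniteDimensional k V] [AddCommGroup V'] [Module k V'] [FiniteDimensional k V']
    {f : Module.End k V} {g : Module.End k V'}
    (h : Disjoint (geometricSpectrum f) (geometricSpectrum g)) :
    IsCoprime f.charpoly g.charpoly := by
  rw [Polynomial.isCoprime_iff_aeval_ne_zero_of_isAlgClosed k (AlgebraicClosure k)]
  intro a
  by_contra! ha
  exact Set.disjoint_left.mp h (mem_geometricSpectrum f ha.1) (mem_geometricSpectrum g ha.2)

/-- There are no nonzero intertwiners between the different blocks of a block diagonal matrix whose
blocks have pairwise coprime characteristic polynomials. -/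
theorem eq_zero_of_blockDiagonal_comm {ι : Type*} [Fintype ι] [DecidableEq ι] {τ : ι → Type*}
    [∀ i, Fintype (τ i)] [∀ i, DecidableEq (τ i)] {A : ∀ i, Matrix (τ i) (τ i) k}
    (hA : ∀ i j, i ≠ j → IsCoprime (A i).charpoly (A j).charpoly)
    {X : Matrix (Σ i, τ i) (Σ i, τ i) k} (hX : ∀ α β, α.1 = β.1 → X α β = 0)
    (hcomm : ∀ α β, α.1 ≠ β.1 →
      (Matrix.blockDiagonal' A * X) α β = (X * Matrix.blockDiagonal' A) α β) : X = 0 := by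
  ext ⟨i, a⟩ ⟨j, b⟩
  by_cases hij : i = j
  · exact hX _ _ hij
  have h := eq_zero_of_mul_eq_mul_of_isCoprime (hA i j hij)
    (X := Matrix.of fun a b => X ⟨i, a⟩ ⟨j, b⟩) (by
      ext a b
      have h1 := hcomm ⟨i, a⟩ ⟨j, b⟩ hij
      rw [Matrix.mul_apply, Matrix.mul_apply, Fintype.sum_sigma, Fintype.sum_sigma,
        Finset.sum_eq_single i, Finset.sum_eq_single j] at h1
      · simpa only [Matrix.blockDiagonal'_apply_eq, Matrix.mul_apply, Matrix.of_apply] using h1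
      · intro l _ hl
        exact Finset.sum_eq_zero fun c _ => by
          rw [Matrix.blockDiagonal'_apply_ne _ _ _ hl, mul_zero]
      · simp
      · intro l _ hl
        exact Finset.sum_eq_zero fun c _ => by
          rw [Matrix.blockDiagonal'_apply_ne _ _ _ (Ne.symm hl), zero_mul]
      · simp)
  exact congrFun (congrFun h a) b

theorem mapMatrix_connMatrix_opU {σ : Type w} {κ : Type*} [Fintype κ] [DecidableEq κ]
    (F : FBundle.{u, v, w} k σ) (b : Module.Basis κ (TotalRing k σ) F.H) :
    (evalOrigin k σ).mapMatrix (connMatrix b F.opU) =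
      LinearMap.toMatrix (fibreBasis b) (fibreBasis b) F.K := by
  ext α β
  rw [RingHom.mapMatrix_apply, Matrix.map_apply, connMatrix_apply, LinearMap.toMatrix_apply,
    fibreBasis_apply, ← fibreBasis_repr]
  rfl

end Spectral

end FormalFBundle

theorem mainTheorem1 {k : Type u} [Field k] [CharZero k] {n : ℕ} (F : FBundle.{u, v, 0} k (Fin n))
    (hF : F.IsMaximal) {ι : Type w} [Fintype ι] [DecidableEq ι] (W : ι → Submodule k F.fibre)
    (hW : DirectSum.IsInternal W) (hK : ∀ i, ∀ x ∈ W i, F.K x ∈ W i)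
    (hspec : ∀ i j, i ≠ j → Disjoint (geometricSpectrum (F.K.restrict (hK i)))
      (geometricSpectrum (F.K.restrict (hK j)))) :
    ∃ (m : ι → ℕ) (G : ∀ i, FBundle.{u, u, 0} k (Fin (m i))) (e : F.Iso (FBundle.prod G)),
      (∀ i, (G i).IsMaximal) ∧
      ∀ i, (W i : Set F.fibre) =
        Set.range fun x : FBundle.ProdSummand G i =>
          toFibre (e.sections (FBundle.prodIncl G i x)) := by
  obtain ⟨h, hh⟩ := hF
  have hfin : FiniteDimensional k F.fibre :=
    LinearEquiv.finiteDimensional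
      (LinearEquiv.ofBijective ((LinearMap.applyₗ h).comp F.mu) hh)
  let y : ∀ i, Module.Basis (Fin (Module.finrank k (W i))) k (W i) := fun i =>
    Module.finBasis k (W i)
  obtain ⟨b, hb⟩ := exists_basis_of_fibre (hW.collectedBasis y)
  have hby : fibreBasis b = hW.collectedBasis y :=
    Module.Basis.eq_of_apply_eq fun a => by rw [fibreBasis_apply, hb]
  have hKb : (evalOrigin k (Fin n)).mapMatrix (connMatrix b F.opU) =
      Matrix.blockDiagonal' fun i => LinearMap.toMatrix (y i) (y i) (F.K.restrict (hK i)) := by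
    rw [mapMatrix_connMatrix_opU, hby]
    exact LinearMap.toMatrix_directSum_collectedBasis_eq_blockDiagonal' hW hW y y hK
  have hcop : ∀ i j, i ≠ j →
      IsCoprime (LinearMap.toMatrix (y i) (y i) (F.K.restrict (hK i))).charpoly
        (LinearMap.toMatrix (y j) (y j) (F.K.restrict (hK j))).charpoly := fun i j hij => by
    rw [LinearMap.charpoly_toMatrix, LinearMap.charpoly_toMatrix]
    exact isCoprime_charpoly_of_disjoint (hspec i j hij)
  obtain ⟨G, e, hG, he⟩ := FBundle.IsMaximal.exists_iso_prod ⟨h, hh⟩ b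
    (fun α β hαβ => by
      have h1 := congrFun (congrFun hKb α) β
      rw [RingHom.mapMatrix_apply, Matrix.map_apply] at h1
      rw [h1]
      exact Matrix.blockDiagonal'_apply_ne _ _ _ hαβ)
    (fun X hX hcomm => by
      rw [hKb] at hcomm
      exact eq_zero_of_blockDiagonal_comm hcop hX hcomm)
  refine ⟨fun i => Module.finrank k (W i), G, e, hG, fun i => Eq.trans ?_ (he i).symm⟩
  have h1 : ∀ a, toFibre (b ⟨i, a⟩) = (W i).subtype (y i a) := fun a => by
    rw [hb, hW.collectedBasis_coe]
    rfl
  simp only [h1]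
  rw [Set.range_comp' (W i).subtype, ← Submodule.map_span, (y i).span_eq, Submodule.map_subtype_top]
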